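/- Let $0<q<1$, $\Delta=(q+q^{-1})/2$, and for $x\in\mathbb{Z}^3$ put $l(x)=x^1+x^2+x^3$ and let $|x_\perp|$ be the Euclidean norm of the component of $x$ orthogonal to $(1,1,1)$. Let $\Sigma^\infty$ be the infinite stick $\dots,-e_2-e_3,-e_3,0,e_1,e_1+e_2,e_1+e_2+e_3,e_1+e_2+e_3+e_1,\dots$. A cylindrical volume is a set $\Lambda=\{x+y : x\in\Gamma,\ y\in\Sigma^\infty,\ |l(y)|\le L/2\}$ with $\Gamma$ a finite subset of the plane $l=0$ and $L\ge 0$ an even integer. On $(\mathbb{C}^2)^{\otimes\Lambda}$ consider the spin-$\tfrac12$ XXZ Hamiltonian with interface boundary terms $$H_\Lambda=\sum_{\substack{x_0,x_1\in\Lambda,\ |x_0-x_1|=1\\ l(x_1)=l(x_0)+1}}\Big[-\Delta^{-1}\big(S^{(1)}_{x_0}S^{(1)}_{x_1}+S^{(2)}_{x_0}S^{(2)}_{x_1}\big)-S^{(3)}_{x_0}S^{(3)}_{x_1}+\tfrac14-\tfrac12\sqrt{1-\Delta^{-2}}\,\big(S^{(3)}_{x_1}-S^{(3)}_{x_0}\big)\Big].$$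 Write $|\alpha\rangle$, $\alpha\in\{0,1\}^\Lambda$, for the configuration basis ($0$ = spin up, $1$ = spin down), $\mathsf N|\alpha\rangle=(\sum_x\alpha(x))|\alpha\rangle$, and let $$\psi_0(\Lambda,n)=\sum_{\alpha:\,\sum_x\alpha(x)=n}\ \prod_{x\in\Lambda}q^{l(x)\alpha(x)}\,|\alpha\rangle,\qquad \psi^{GC}(\Lambda,\mu)=\bigotimes_{x\in\Lambda}\big(|{\uparrow}\rangle+q^{l(x)-\mu}|{\downarrow}\rangle\big)$$ be the canonical and grand canonical 111-interface states. Let $E_0(\Lambda,n)$ be the minimum of $\langle\psi|H_\Lambda|\psi\rangle/\|\psi\|^2$ over nonzero $\psi$ with $\mathsf N\psi=n\psi$, and $E_1(\Lambda,n)$ the minimum over those $\psi$ that are in addition orthogonal to $\psi_0(\Lambda,n)$. For $R>0$ and an amplitude $s\in\mathbb{R}$ define the state perturbed in the cylinder of radius $R$ around the 111 axis, $$\psi=\prod_{x\in\Lambda,\ |x_\perp|\le R}e^{2i\phi_xS^{(3)}_x}\,\psi_0(\Lambda,n),\qquad \phi_x=s\,J_0\big(z_0|x_\perp|/R\big),$$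 where $J_0$ is the Bessel function and $z_0$ its first positive zero, and let $\chi=\psi-\frac{\langle\psi_0|\psi\rangle}{\langle\psi_0|\psi_0\rangle}\psi_0$ with $\psi_0=\psi_0(\Lambda,n)$. Let $R>70$, let $(\Lambda_k)$ be a sequence of cylindrical volumes such that every $x\in\mathbb{Z}^3$ lies in $\Lambda_k$ for all large $k$, and let $n_k$ be particle numbers with chemical potentials $\mu_k$, determined by $\langle\psi^{GC}(\Lambda_k,\mu_k)|\mathsf N|\psi^{GC}(\Lambda_k,\mu_k)\rangle/\|\psi^{GC}(\Lambda_k,\mu_k)\|^2=n_k$, such that $\mu_k\to\mu\in\mathbb{R}$. Let $\delta(\mu)$ be the distance from $\mu$ to the nearest integer. Then there is $s_0>0$ such that for every $s$ with $0<|s|<s_0$ and all sufficiently large $k$ (depending on $s$): $\psi_0(\Lambda_k,n_k)$ is a nonzero vector with $n_k$ down spins and energy $E_0(\Lambda_k,n_k)$; the excitation $\chi=\chi_{k,s}$ is nonzero, satisfies $\mathsf N\chi=n_k\chi$ and is orthogonal to $\psi_0(\Lambda_k,n_k)$; and $$E_1(\Lambda_k,n_k)-E_0(\Lambda_k,n_k)\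 \le\ \frac{\langle\chi|H_{\Lambda_k}|\chi\rangle}{\|\chi\|^2}-E_0(\Lambda_k,n_k)\ \le\ \frac{100\,q^{2(1-\delta(\mu))}}{(1-q^2)\,R^2}.$$ In particular the gap $\gamma_R$ of the localized excitation, i.e. the middle quantity in the limit $k\to\infty$ (upper limit) and then $s\to0$, satisfies $\gamma_R\le 100\,q^{2(1-\delta(\mu))}/((1-q^2)R^2)$. -/

import Mathlib

open Filter Topology

noncomputable section

namespace XXZ

/-! ### Geometry of cylindrical volumes along the 111 axis -/

/-- Sites of the lattice `ℤ³`. -/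
abbrev Site := Fin 3 → ℤ

/-- The signed height `l(x) = x¹ + x² + x³`. -/
def height (x : Site) : ℤ := x 0 + x 1 + x 2

/-- Oriented nearest-neighbour bonds `(x₀, x₁)`: Euclidean distance one and
`l(x₁) = l(x₀) + 1`. -/
abbrev IsBond (x y : Site) : Prop :=
  ∑ i, (x i - y i) ^ 2 = 1 ∧ height y = height x + 1

/-- The unique vertex at height `l` of the infinite stick
`…, -e₂-e₃, -e₃, 0, e₁, e₁+e₂, e₁+e₂+e₃, e₁+e₂+e₃+e₁, …`. -/
def stick (l : ℤ) : Site :=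
  ![l / 3 + (if 1 ≤ l % 3 then 1 else 0), l / 3 + (if 2 ≤ l % 3 then 1 else 0), l / 3]

/-- The cylinder with base `Γ` and (even) length `L = 2 * h`: all `x + y` with `x ∈ Γ` and `y` in
the finite stick `-L/2 ≤ l(y) ≤ L/2`. -/
def cylinder (Γ : Finset Site) (h : ℕ) : Finset Site :=
  (Γ ×ˢ Finset.Icc (-(h : ℤ)) h).image fun p => p.1 + stick p.2

/-- Distance of `x` to the 111 axis, i.e. the Euclidean norm of the component of `x` orthogonal
to `(1,1,1)`, in the orthonormal coordinates of the plane `l = 0`. -/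
def axisDist (x : Site) : ℝ :=
  √(((2 * x 0 - x 1 - x 2 : ℝ) / √6) ^ 2 + ((x 1 - x 2 : ℝ) / √2) ^ 2)

/-! ### Spin one-half systems -/

/-- Particle configurations on `Λ`; `0` is spin up (empty), `1` is spin down (occupied). -/
abbrev Config (Λ : Finset Site) := Λ → Fin 2

/-- The Hilbert space `(ℂ²)^{⊗Λ}`, in the orthonormal basis given by the configurations. -/
abbrev State (Λ : Finset Site) := EuclideanSpace ℂ (Config Λ)

/-- Operators on `(ℂ²)^{⊗Λ}`, as matrices in the configuration basis. -/
abbrev Op (Λ : Finset Site) := Matrix (Config Λ) (Config Λ) ℂ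

def S1 : Matrix (Fin 2) (Fin 2) ℂ := !![0, 1 / 2; 1 / 2, 0]

def S2 : Matrix (Fin 2) (Fin 2) ℂ := !![0, -Complex.I / 2; Complex.I / 2, 0]

def S3 : Matrix (Fin 2) (Fin 2) ℂ := !![1 / 2, 0; 0, -1 / 2]

variable {Λ : Finset Site}

/-- The operator acting as `M` at the site `x` and as the identity elsewhere. -/
def siteOp (M : Matrix (Fin 2) (Fin 2) ℂ) (x : Λ) : Op Λ :=
  Matrix.of fun α β => if ∀ y, y ≠ x → α y = β y then M (α x) (β x) else 0

/-- The anisotropy `Δ = (q + q⁻¹) / 2`. -/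
def anisotropy (q : ℝ) : ℝ := (q + q⁻¹) / 2

/-- The coefficient `A(Δ) = ½ √(1 - Δ⁻²)` of the boundary field. -/
def boundaryCoeff (q : ℝ) : ℝ := √(1 - 1 / anisotropy q ^ 2) / 2

/-- The bond Hamiltonian. On the bond it is the orthogonal projection onto the vector
`(1 + q²)^{-1/2} (q |↓↑⟩ - |↑↓⟩)`. -/
def bondHamiltonian (q : ℝ) (x y : Λ) : Op Λ :=
  -((anisotropy q : ℂ)⁻¹ • (siteOp S1 x * siteOp S1 y + siteOp S2 x * siteOp S2 y))
    - siteOp S3 x * siteOp S3 y + (1 / 4 : ℂ) • 1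
    - (boundaryCoeff q : ℂ) • (siteOp S3 y - siteOp S3 x)

/-- The XXZ Hamiltonian: sum of the bond Hamiltonians over the oriented bonds inside `Λ`. -/
def hamiltonian (q : ℝ) (Λ : Finset Site) : Op Λ :=
  ∑ b : Λ × Λ with IsBond b.1 b.2, bondHamiltonian q b.1 b.2

/-- The number of down spins in a configuration. -/
def particles (α : Config Λ) : ℕ := ∑ x, (α x : ℕ)

/-- The number operator `N = ∑ₓ (1/2 - S³ₓ)`. -/
def numberOp (Λ : Finset Site) : Op Λ := Matrix.diagonal fun α => (particles α : ℂ)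

/-- Application of an operator to a vector. -/
abbrev app (X : Op Λ) (ψ : State Λ) : State Λ := Matrix.toEuclideanLin X ψ

/-- The normalized expectation `⟨ψ|X|ψ⟩ / ‖ψ‖²` (for self-adjoint `X`). -/
def expect (X : Op Λ) (ψ : State Λ) : ℝ := (inner ℂ ψ (app X ψ)).re / ‖ψ‖ ^ 2

/-! ### Interface states -/

/-- The canonical interface state `ψ₀(Λ, n)` with `n` down spins. -/
def interfaceState (q : ℝ) (Λ : Finset Site) (n : ℕ) : State Λ :=
  WithLp.toLp 2 fun α =>
    if particles α = n then ((∏ x : Λ, q ^ (height x * (α x : ℕ) : ℤ) : ℝ) : ℂ) else 0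

/-- The grand canonical interface state `⊗ₓ (|↑⟩ + q^{l(x)-μ} |↓⟩)`. -/
def grandCanonicalState (q : ℝ) (Λ : Finset Site) (μ : ℝ) : State Λ :=
  WithLp.toLp 2 fun α => ((∏ x : Λ, q ^ (((height x : ℝ) - μ) * (α x : ℕ)) : ℝ) : ℂ)

/-- The sector of vectors with exactly `n` down spins, i.e. with fixed total magnetization. -/
def InSector (n : ℕ) (ψ : State Λ) : Prop := app (numberOp Λ) ψ = (n : ℂ) • ψ

/-- The ground state energy `E₀` of `H_Λ` in the sector with `n` down spins. -/
def groundEnergy (q : ℝ) (Λ : Finset Site) (n : ℕ) : ℝ :=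
  sInf {E | ∃ ψ : State Λ, ψ ≠ 0 ∧ InSector n ψ ∧ E = expect (hamiltonian q Λ) ψ}

/-- The first excited energy `E₁` of `H_Λ` in the sector with `n` down spins: the least energy of
vectors in the sector orthogonal to the ground state `ψ₀(Λ, n)`. -/
def excitedEnergy (q : ℝ) (Λ : Finset Site) (n : ℕ) : ℝ :=
  sInf {E | ∃ ψ : State Λ, ψ ≠ 0 ∧ InSector n ψ ∧ inner ℂ (interfaceState q Λ n) ψ = 0 ∧
    E = expect (hamiltonian q Λ) ψ}

/-! ### The localized excitation -/

/-- The Bessel function `J₀`. -/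
def besselJ0 (t : ℝ) : ℝ := ∑' m : ℕ, (-1) ^ m / (m.factorial : ℝ) ^ 2 * (t / 2) ^ (2 * m)

/-- The first positive zero of `J₀`. -/
def besselZero : ℝ := sInf {t | 0 < t ∧ besselJ0 t = 0}

/-- The unitary `∏ₓ exp(2 i φₓ S³ₓ)` over the sites `x` of `Λ` at distance at most `R` from the
111 axis (the factors commute, so the product is the exponential of the sum). -/
def localTwist (Λ : Finset Site) (R : ℝ) (φ : Site → ℝ) : Op Λ :=
  NormedSpace.exp (∑ x ∈ (Finset.univ : Finset Λ).filter (fun x : Λ => axisDist x ≤ R),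
    (2 * Complex.I * (φ x : ℂ)) • siteOp S3 x)

/-- The phases `φₓ = s J₀(z₀ |x_⊥| / R)`, with amplitude `s`. -/
def besselPhase (R s : ℝ) (x : Site) : ℝ := s * besselJ0 (besselZero * (axisDist x / R))

/-- The perturbed state `ψ = ∏ₓ exp(2 i φₓ S³ₓ) ψ₀(Λ, n)`. -/
def perturbedState (q : ℝ) (Λ : Finset Site) (n : ℕ) (R s : ℝ) : State Λ :=
  app (localTwist Λ R (besselPhase R s)) (interfaceState q Λ n)

/-- The excitation: the component of the perturbed state orthogonal to `ψ₀(Λ, n)`. -/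
def excitation (q : ℝ) (Λ : Finset Site) (n : ℕ) (R s : ℝ) : State Λ :=
  perturbedState q Λ n R s -
    (inner ℂ (interfaceState q Λ n) (perturbedState q Λ n R s) /
      inner ℂ (interfaceState q Λ n) (interfaceState q Λ n)) • interfaceState q Λ n

/-- The distance of `μ` to the nearest integer. -/
def intDist (μ : ℝ) : ℝ := min |μ - ⌊μ⌋| |1 - μ + ⌊μ⌋|

end XXZ

end

open Filter Topology

set_option linter.unusedSectionVars false

namespace XXZ

/-! ### The canonical ensemble of a finite lattice gas -/

section Canonical

open Polynomial

variable {ι : Type*} [Fintype ι] [DecidableEq ι]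

/-! Every bond term is a rank-one projection that annihilates the interface state, so the ground
energy is 0. Removing the `ψ₀` component from the twisted state changes no bond energy. Hence the
gap is bounded by a quotient: the energy of the twisted state over the squared norm of its component
orthogonal to `ψ₀`. Since `|ψ₀(α)|²` is the Boltzmann weight of a lattice gas with `n` particles and
activities `q ^ (2 l(x))`, both quantities become canonical expectations.

Numerator. A bond costs at most `4 (φ_x - φ_y)² q² / (1 + q²)` times the weight of `x` occupied, `y`
empty (`bondEnergy_perturbedState_le`). Detailed balance makes that probability equal to the density
drop across the bond divided by `1 - q²`. Densities depend only on height and decrease with it, so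
summing over layers telescopes to a total drop of at most 1. What remains is the Dirichlet sum of
the profile over the bonds leaving one layer (`energy_excitation_le`,
`sum_sq_besselProfile_sub_le`).

Denominator. Only the layer `L` at the height nearest to `μ` is used. A trial vector carries the
phase of the twist outside `L` times a centred linear statistic of the occupations in `L`.
Exchangeability inside `L` makes it orthogonal to `ψ₀`, and Cauchy-Schwarz bounds the excitation
below by the variance of the twist inside the layer (`le_norm_sq_excitation`). To leading order in
`s` this is `4 s² c ∑ f²`, where `c` is the probability that one given site of `L` is occupied and
another is empty. The centring correction disappears as the layer grows.

Bounding `c` below is a comparison of ensembles. Log-concavity of the coefficients of `∏ (1 + w_x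
X)` gives negative correlation of distinct sites (`density_mul_le_pairProb`). The fixed particle
number makes truncated correlations sum to zero, so each is small when layers are large
(`card_mul_pairProb_le`). Therefore the effective fugacities `ρ / ((1 - ρ) w)` are nearly
independent of the site. The grand canonical fugacity lies between two of them, since both ensembles
have the same mean particle number (`le_pairProb_of_sum_eq`). The limit bound for `c` is at least `q
^ (2 δ(μ)) / 4`, which produces the power `q ^ (2 (1 - δ(μ)))`.

The rest is numerical: alternating-series bounds for `J₁` control the profile and its zero, and unit
cells count the sites of a layer. The area `discArea` of the unit disc enters both numerator and
denominator and cancels, so its value is never needed. -/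

/-- The occupation number of a site, as a real number. -/
def occ (α : ι → Fin 2) (x : ι) : ℝ := ((α x : ℕ) : ℝ)

/-- Boltzmann weight of a configuration with `n` particles and activities `w`. -/
def canonWeight (w : ι → ℝ) (n : ℕ) (α : ι → Fin 2) : ℝ :=
  if ∑ x, (α x : ℕ) = n then ∏ x, w x ^ (α x : ℕ) else 0

/-- The canonical partition function. -/
def canonPart (w : ι → ℝ) (n : ℕ) : ℝ := ∑ α, canonWeight w n α

/-- The canonical expectation. -/
noncomputable def canonAvg (w : ι → ℝ) (n : ℕ) (G : (ι → Fin 2) → ℝ) : ℝ :=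
  (∑ α, canonWeight w n α * G α) / canonPart w n

/-- The mean occupation of a site. -/
noncomputable def density (w : ι → ℝ) (n : ℕ) (x : ι) : ℝ := canonAvg w n fun α => occ α x

/-- The probability that `u` is occupied and `v` is empty. -/
noncomputable def pairProb (w : ι → ℝ) (n : ℕ) (u v : ι) : ℝ :=
  canonAvg w n fun α => occ α u * (1 - occ α v)

/-- Log-concavity of the coefficients, in the form stable under products with `1 + c X`. -/
def LogConcaveCoeff (P : ℝ[X]) : Prop :=
  (∀ k, 0 ≤ P.coeff k) ∧ ∀ j k, j ≤ k → P.coeff j * P.coeff (k + 2) ≤ P.coeff (j + 1) * P.coeff (k + 1)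

lemma occ_eq (α : ι → Fin 2) (x : ι) : occ α x = 0 ∨ occ α x = 1 := by
  unfold occ
  generalize α x = a
  fin_cases a <;> simp

/-! ### Log-concave coefficients and generating polynomials. -/

lemma logConcaveCoeff_X_pow (m : ℕ) : LogConcaveCoeff (X ^ m : ℝ[X]) := by
  constructor
  · intro k; rw [coeff_X_pow]; split_ifs <;> norm_num
  · intro j k hjk
    have : (X ^ m : ℝ[X]).coeff j * (X ^ m : ℝ[X]).coeff (k + 2) = 0 := by
      simp only [coeff_X_pow]
      split_ifs <;> first | omega | simp
    rw [this]
    apply mul_nonneg <;> (rw [coeff_X_pow]; split_ifs <;> norm_num)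

lemma LogConcaveCoeff.mul_one_add {P : ℝ[X]} (hP : LogConcaveCoeff P) {c : ℝ} (hc : 0 ≤ c) :
    LogConcaveCoeff (P * (1 + C c * X)) := by
  obtain ⟨h0, h1⟩ := hP
  have e0 : (P * (1 + C c * X)).coeff 0 = P.coeff 0 := by simp
  have e1 : ∀ k, (P * (1 + C c * X)).coeff (k + 1) = P.coeff (k + 1) + c * P.coeff k := by
    intro k
    rw [mul_add, mul_one, coeff_add, ← mul_assoc, coeff_mul_X, coeff_mul_C]; ring
  constructor
  · rintro (_ | k)
    · rw [e0]; exact h0 0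
    · rw [e1]; have := h0 k; have := h0 (k + 1); positivity
  · rintro (_ | j) k hjk
    · rw [e0, e1, e1]
      rcases k with _ | k
      · rw [e1]
        nlinarith [h1 0 0 le_rfl, mul_nonneg hc (h0 0), h0 1, h0 0,
          mul_nonneg (mul_nonneg hc (h0 0)) (mul_nonneg hc (h0 0)), mul_nonneg (mul_nonneg hc (h0 0)) (h0 1)]
      · rw [e1]
        have := h1 0 (k + 1) (by omega)
        have a1 := mul_nonneg (mul_nonneg hc (h0 1)) (h0 (k + 1))
        have a2 := mul_nonneg (mul_nonneg hc (h0 0)) (mul_nonneg hc (h0 (k + 1)))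
        simp only [zero_add, add_assoc, Nat.reduceAdd] at *
        nlinarith
    · rcases k with _ | k
      · omega
      · simp only [e1]
        have hjk' : j ≤ k := by omega
        have b1 := h1 (j + 1) (k + 1) hjk
        have b2 := h1 j k hjk'
        have b3 := h1 j (k + 1) (by omega)
        -- The terms of order `c` need two shifts of the indices towards each other. The second is
        -- trivial when `j = k`. Having the inequality for all `j ≤ k`, and not only for `j = k`, is
        -- what lets the first shift go through despite possible zero coefficients.
        have b4 : P.coeff (j + 1) * P.coeff (k + 2) ≤ P.coeff (j + 2) * P.coeff (k + 1) := by
          rcases hjk'.eq_or_lt with rfl | h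
          · exact le_of_eq (mul_comm _ _)
          · exact h1 (j + 1) k h
        simp only [add_assoc, Nat.reduceAdd] at *
        nlinarith [mul_le_mul_of_nonneg_left (b3.trans b4) hc,
          mul_le_mul_of_nonneg_left b2 (mul_nonneg hc hc)]

lemma LogConcaveCoeff.mul_prod {P : ℝ[X]} (hP : LogConcaveCoeff P) {w : ι → ℝ} (hw : ∀ x, 0 ≤ w x)
    (S : Finset ι) : LogConcaveCoeff (P * ∏ x ∈ S, (1 + C (w x) * X)) := by
  induction S using Finset.induction_on with
  | empty => simpa
  | insert a s ha ih =>
    rw [Finset.prod_insert ha, mul_comm (1 + _), ← mul_assoc]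
    exact ih.mul_one_add (hw a)

/-- A product observable factorizes over sites, so fixing the particle number is the extraction of
one coefficient from a product of linear polynomials. -/
lemma sum_canonWeight_mul_prod (w : ι → ℝ) (n : ℕ) (g : ι → Fin 2 → ℝ) :
    ∑ α, canonWeight w n α * ∏ x, g x (α x) =
      (∏ x, (C (g x 0) + C (g x 1 * w x) * X)).coeff n := by
  have h1 : ∀ x, (C (g x 0) + C (g x 1 * w x) * X : ℝ[X]) =
      ∑ c : Fin 2, C (g x c * w x ^ (c : ℕ)) * X ^ (c : ℕ) := by
    intro x; simp [Fin.sum_univ_two]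
  simp only [h1]
  rw [Finset.prod_univ_sum, Fintype.piFinset_univ, finsetSum_coeff]
  refine Finset.sum_congr rfl fun α _ => ?_
  rw [Finset.prod_mul_distrib, Finset.prod_pow_eq_pow_sum, ← map_prod, coeff_C_mul_X_pow,
    Finset.prod_mul_distrib]
  unfold canonWeight
  by_cases h : ∑ x, (α x : ℕ) = n
  · rw [if_pos h, if_pos h.symm, mul_comm]
  · rw [if_neg h, if_neg (Ne.symm h), zero_mul]

/-- The joint law of the occupations of two sites. -/
lemma exists_pair_law {w : ι → ℝ} (hw : ∀ x, 0 ≤ w x) (n : ℕ) {u v : ι} (huv : u ≠ v) :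
    ∃ A B D : ℝ, 0 ≤ A ∧ 0 ≤ B ∧ 0 ≤ D ∧ A * D ≤ B ^ 2 ∧ ∀ a b : Fin 2 → ℝ,
      ∑ α, canonWeight w n α * (a (α u) * b (α v)) =
        a 0 * b 0 * A + (a 1 * b 0 * w u + a 0 * b 1 * w v) * B + a 1 * b 1 * (w u * w v) * D := by
  set S : Finset ι := (Finset.univ.erase u).erase v
  -- The factor `X ^ 2` shifts indices so that the coefficients for `n`, `n - 1` and `n - 2`
  -- particles on the other sites exist, and vanish when they should, without natural subtraction.
  set Q : ℝ[X] := X ^ 2 * ∏ x ∈ S, (1 + C (w x) * X) with hQ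
  have hlc : LogConcaveCoeff Q := (logConcaveCoeff_X_pow 2).mul_prod hw S
  refine ⟨Q.coeff (n + 2), Q.coeff (n + 1), Q.coeff n, hlc.1 _, hlc.1 _, hlc.1 _, ?_, ?_⟩
  · have := hlc.2 n n le_rfl
    nlinarith
  · intro a b
    set g : ι → Fin 2 → ℝ := fun x c => (if x = u then a c else 1) * (if x = v then b c else 1) with hg
    have h1 : ∀ α : ι → Fin 2, a (α u) * b (α v) = ∏ x, g x (α x) := by
      intro α
      rw [hg, Finset.prod_mul_distrib, Finset.prod_ite_eq', Finset.prod_ite_eq']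
      simp
    simp only [h1]
    rw [sum_canonWeight_mul_prod, ← Finset.mul_prod_erase _ _ (Finset.mem_univ u),
      ← Finset.mul_prod_erase _ _ (Finset.mem_erase.2 ⟨huv.symm, Finset.mem_univ v⟩)]
    have h2 : ∏ x ∈ S, (C (g x 0) + C (g x 1 * w x) * X) = ∏ x ∈ S, (1 + C (w x) * X) := by
      refine Finset.prod_congr rfl fun x hx => ?_
      have hxv : x ≠ v := (Finset.mem_erase.1 hx).1
      have hxu : x ≠ u := (Finset.mem_erase.1 (Finset.mem_erase.1 hx).2).1
      simp [hg, hxv, hxu]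
    rw [h2, ← coeff_X_pow_mul _ 2]
    have h3 : X ^ 2 * ((C (g u 0) + C (g u 1 * w u) * X) * ((C (g v 0) + C (g v 1 * w v) * X) *
        ∏ x ∈ S, (1 + C (w x) * X))) = C (a 0 * b 0) * Q + C (a 1 * b 0 * w u + a 0 * b 1 * w v) * (Q * X)
          + C (a 1 * b 1 * (w u * w v)) * (Q * X ^ 2) := by
      have : g u 0 = a 0 ∧ g u 1 = a 1 ∧ g v 0 = b 0 ∧ g v 1 = b 1 := by simp [hg, huv, huv.symm]
      obtain ⟨e1, e2, e3, e4⟩ := this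
      rw [e1, e2, e3, e4, hQ]
      simp only [map_mul, map_add]
      ring
    rw [h3, coeff_add, coeff_add, coeff_C_mul, coeff_C_mul, coeff_C_mul, coeff_mul_X,
      coeff_mul_X_pow]

/-! ### Canonical averages, exchange symmetry and two-site correlations. -/

variable {w : ι → ℝ} {n : ℕ}

lemma canonWeight_nonneg (hw : ∀ x, 0 < w x) (α : ι → Fin 2) : 0 ≤ canonWeight w n α := by
  unfold canonWeight
  split_ifs
  · exact Finset.prod_nonneg fun x _ => pow_nonneg (hw x).le _
  · exact le_rfl

lemma exists_occupation (hn : n ≤ Fintype.card ι) : ∃ α : ι → Fin 2, ∑ x, (α x : ℕ) = n := by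
  obtain ⟨T, -, hT⟩ := Finset.exists_subset_card_eq (s := (Finset.univ : Finset ι)) (n := n) (by simpa)
  refine ⟨fun x => if x ∈ T then 1 else 0, ?_⟩
  have : ∀ x, (((if x ∈ T then 1 else 0 : Fin 2) : Fin 2) : ℕ) = if x ∈ T then 1 else 0 := by
    intro x; split_ifs <;> rfl
  simp only [this]
  rw [Finset.sum_boole]
  simp [hT]

lemma canonPart_pos (hw : ∀ x, 0 < w x) (hn : n ≤ Fintype.card ι) : 0 < canonPart w n := by
  obtain ⟨α, hα⟩ := exists_occupation hn
  refine Finset.sum_pos' (fun β _ => canonWeight_nonneg hw β) ⟨α, Finset.mem_univ _, ?_⟩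
  rw [canonWeight, if_pos hα]
  exact Finset.prod_pos fun x _ => pow_pos (hw x) _

lemma canonAvg_add (G H : (ι → Fin 2) → ℝ) :
    canonAvg w n (fun α => G α + H α) = canonAvg w n G + canonAvg w n H := by
  simp only [canonAvg, mul_add, Finset.sum_add_distrib, add_div]

lemma canonAvg_sub (G H : (ι → Fin 2) → ℝ) :
    canonAvg w n (fun α => G α - H α) = canonAvg w n G - canonAvg w n H := by
  simp only [canonAvg, mul_sub, Finset.sum_sub_distrib, sub_div]

lemma canonAvg_const_mul (c : ℝ) (G : (ι → Fin 2) → ℝ) :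
    canonAvg w n (fun α => c * G α) = c * canonAvg w n G := by
  simp only [canonAvg, mul_left_comm _ c, ← Finset.mul_sum, mul_div_assoc]

lemma canonAvg_sum {κ : Type*} (s : Finset κ) (G : κ → (ι → Fin 2) → ℝ) :
    canonAvg w n (fun α => ∑ i ∈ s, G i α) = ∑ i ∈ s, canonAvg w n (G i) := by
  simp only [canonAvg, Finset.mul_sum]
  rw [Finset.sum_comm, Finset.sum_div]

lemma canonAvg_one (hZ : 0 < canonPart w n) : canonAvg w n (fun _ => 1) = 1 := by
  simp only [canonAvg, mul_one]
  exact div_self hZ.ne'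

lemma canonAvg_congr {G H : (ι → Fin 2) → ℝ} (h : ∀ α, ∑ x, (α x : ℕ) = n → G α = H α) :
    canonAvg w n G = canonAvg w n H := by
  unfold canonAvg
  congr 1
  refine Finset.sum_congr rfl fun α _ => ?_
  by_cases hα : ∑ x, (α x : ℕ) = n
  · rw [h α hα]
  · simp [canonWeight, hα]

lemma canonAvg_mono (hw : ∀ x, 0 < w x) {G H : (ι → Fin 2) → ℝ}
    (h : ∀ α, ∑ x, (α x : ℕ) = n → G α ≤ H α) : canonAvg w n G ≤ canonAvg w n H := by
  unfold canonAvg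
  refine div_le_div_of_nonneg_right (Finset.sum_le_sum fun α _ => ?_)
    (Finset.sum_nonneg fun α _ => canonWeight_nonneg hw α)
  by_cases hα : ∑ x, (α x : ℕ) = n
  · exact mul_le_mul_of_nonneg_left (h α hα) (canonWeight_nonneg hw α)
  · simp [canonWeight, hα]

/-- Exchanging two sites of equal activity preserves the weights. -/
lemma canonWeight_comp_swap {u v : ι} (huv : w u = w v) (α : ι → Fin 2) :
    canonWeight w n (α ∘ Equiv.swap u v) = canonWeight w n α := by
  have hs : ∑ x, ((α ∘ Equiv.swap u v) x : ℕ) = ∑ x, (α x : ℕ) :=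
    Equiv.sum_comp (Equiv.swap u v) fun x => (α x : ℕ)
  have hwswap : ∀ x, w (Equiv.swap u v x) = w x := by
    intro x
    by_cases h1 : x = u
    · subst h1; simp [huv]
    · by_cases h2 : x = v
      · subst h2; simp [huv]
      · rw [Equiv.swap_apply_of_ne_of_ne h1 h2]
  have hp : ∏ x, w x ^ ((α ∘ Equiv.swap u v) x : ℕ) = ∏ x, w x ^ (α x : ℕ) := by
    rw [← Equiv.prod_comp (Equiv.swap u v) fun x => w x ^ (α x : ℕ)]
    simp only [hwswap, Function.comp]
  unfold canonWeight
  rw [hs, hp]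

lemma canonAvg_comp_swap {u v : ι} (huv : w u = w v) (G : (ι → Fin 2) → ℝ) :
    canonAvg w n (fun α => G (α ∘ Equiv.swap u v)) = canonAvg w n G := by
  unfold canonAvg
  congr 1
  have e := Equiv.sum_comp (Equiv.arrowCongr (Equiv.swap u v) (Equiv.refl (Fin 2)))
    fun α => canonWeight w n α * G α
  rw [← e]
  refine Finset.sum_congr rfl fun α _ => ?_
  have : (Equiv.arrowCongr (Equiv.swap u v) (Equiv.refl (Fin 2))) α = α ∘ Equiv.swap u v := by
    ext x; simp [Equiv.arrowCongr]
  rw [this, canonWeight_comp_swap huv]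

lemma density_eq_of_eq {u v : ι} (huv : w u = w v) : density w n u = density w n v := by
  unfold density
  rw [← canonAvg_comp_swap huv]
  simp [occ]

lemma sum_density (hZ : 0 < canonPart w n) : ∑ x, density w n x = n := by
  unfold density
  rw [← canonAvg_sum, canonAvg_congr (H := fun _ => (n : ℝ) * 1), canonAvg_const_mul,
    canonAvg_one hZ, mul_one]
  intro α hα
  rw [mul_one, ← hα]
  simp [occ]

lemma density_nonneg (hw : ∀ x, 0 < w x) (x : ι) : 0 ≤ density w n x := by
  have := canonAvg_mono (n := n) hw (G := fun _ => 0 * 1) (H := fun α => occ α x)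
    (fun α _ => by rcases occ_eq α x with h | h <;> simp [h])
  rwa [canonAvg_const_mul, zero_mul] at this

lemma density_le_one (hw : ∀ x, 0 < w x) (hZ : 0 < canonPart w n) (x : ι) : density w n x ≤ 1 := by
  have := canonAvg_mono (n := n) hw (H := fun _ => 1) (G := fun α => occ α x)
    (fun α _ => by rcases occ_eq α x with h | h <;> simp [h])
  rwa [canonAvg_one hZ] at this

lemma pairProb_nonneg (hw : ∀ x, 0 < w x) (u v : ι) : 0 ≤ pairProb w n u v := by
  have := canonAvg_mono (n := n) hw (G := fun _ => 0 * 1) (H := fun α => occ α u * (1 - occ α v))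
    (fun α _ => by rcases occ_eq α u with h | h <;> rcases occ_eq α v with h' | h' <;> simp [h, h'])
  rwa [canonAvg_const_mul, zero_mul] at this

lemma pairProb_sub (u v : ι) :
    pairProb w n u v - pairProb w n v u = density w n u - density w n v := by
  unfold pairProb density
  rw [← canonAvg_sub, ← canonAvg_sub]
  congr 1; ext α; ring

/-- Detailed balance. -/
lemma mul_pairProb (hw : ∀ x, 0 < w x) (u v : ι) :
    w v * pairProb w n u v = w u * pairProb w n v u := by
  rcases eq_or_ne u v with rfl | huv
  · rfl
  obtain ⟨A, B, D, -, -, -, -, h⟩ := exists_pair_law (fun x => (hw x).le) n huv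
  have h1 := h (fun c => ((c : ℕ) : ℝ)) (fun c => 1 - ((c : ℕ) : ℝ))
  have h2 := h (fun c => 1 - ((c : ℕ) : ℝ)) (fun c => ((c : ℕ) : ℝ))
  have e : ∀ α : ι → Fin 2, occ α v * (1 - occ α u) = (1 - ((α u : ℕ) : ℝ)) * ((α v : ℕ) : ℝ) := by
    intro α; unfold occ; ring
  unfold pairProb canonAvg
  simp only [e]
  unfold occ
  rw [h1, h2]
  simp
  ring

/-- Distinct sites are negatively correlated. -/
lemma density_mul_le_pairProb (hw : ∀ x, 0 < w x) (hZ : 0 < canonPart w n) {u v : ι}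
    (huv : u ≠ v) : density w n u * (1 - density w n v) ≤ pairProb w n u v := by
  obtain ⟨A, B, D, hA, hB, hD, hAD, h⟩ := exists_pair_law (fun x => (hw x).le) n huv
  have h1 := h (fun c => ((c : ℕ) : ℝ)) (fun c => 1 - ((c : ℕ) : ℝ))
  have h2 := h (fun c => ((c : ℕ) : ℝ)) (fun c => 1)
  have h3 := h (fun c => 1) (fun c => ((c : ℕ) : ℝ))
  have h4 := h (fun c => 1) (fun c => 1)
  simp at h1 h2 h3 h4
  unfold pairProb density canonAvg
  unfold occ
  have hZ' : canonPart w n = A + (w u + w v) * B + w u * w v * D := h4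
  rw [h1, h2, h3]
  rw [one_sub_div hZ.ne', div_mul_div_comm, div_le_div_iff₀ (by positivity) hZ, hZ']
  have hu := hw u
  have hv := hw v
  -- After clearing denominators this product is exactly the difference of the two sides.
  have : 0 ≤ w u * w v * (B ^ 2 - A * D) * (A + (w u + w v) * B + w u * w v * D) := by
    have := sub_nonneg.2 hAD
    positivity
  nlinarith [this]

/-- The number constraint bounds the correlations of `u` with a set of equivalent sites. -/
lemma card_mul_pairProb_le (hw : ∀ x, 0 < w x) (hZ : 0 < canonPart w n) {u v : ι}
    {S : Finset ι} (huS : u ∉ S) (hS : ∀ x ∈ S, w x = w v) (hvu : v ≠ u) :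
    (S.card : ℝ) * (pairProb w n u v - density w n u * (1 - density w n v)) ≤
      density w n u * (1 - density w n u) := by
  -- The total occupation is deterministic, so the truncated correlations of `u` with all sites add
  -- up to zero. The diagonal term is `-ρ_u (1 - ρ_u)` and all others are nonnegative, so the
  -- equivalent sites, which have equal terms, share at most `ρ_u (1 - ρ_u)`.
  have hsum : ∑ x, (pairProb w n u x - density w n u * (1 - density w n x)) = 0 := by
    have e1 : ∀ x, pairProb w n u x - density w n u * (1 - density w n x) =
        canonAvg w n (fun α => occ α u * (density w n x - occ α x)) := by
      intro x
      have : (fun α : ι → Fin 2 => occ α u * (density w n x - occ α x)) = fun α =>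
          occ α u * (1 - occ α x) - (1 - density w n x) * occ α u := by ext; ring
      rw [this, canonAvg_sub, canonAvg_const_mul]
      unfold pairProb density
      ring
    simp only [e1]
    rw [← canonAvg_sum, canonAvg_congr (H := fun _ => 0 * 1), canonAvg_const_mul, zero_mul]
    intro α hα
    rw [← Finset.mul_sum, Finset.sum_sub_distrib, sum_density hZ, ← hα]
    simp [occ]
  have huu : pairProb w n u u - density w n u * (1 - density w n u) =
      -(density w n u * (1 - density w n u)) := by
    have : pairProb w n u u = 0 := by
      unfold pairProb
      rw [canonAvg_congr (H := fun _ => 0 * 1), canonAvg_const_mul, zero_mul]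
      intro α _
      rcases occ_eq α u with h | h <;> simp [h]
    rw [this]; ring
  rw [← Finset.add_sum_erase _ _ (Finset.mem_univ u), huu] at hsum
  have hle : ∑ x ∈ S, (pairProb w n u x - density w n u * (1 - density w n x)) ≤
      ∑ x ∈ Finset.univ.erase u, (pairProb w n u x - density w n u * (1 - density w n x)) := by
    refine Finset.sum_le_sum_of_subset_of_nonneg (fun x hx => ?_) fun x hx _ => ?_
    · exact Finset.mem_erase.2 ⟨fun h => huS (h ▸ hx), Finset.mem_univ _⟩
    · exact sub_nonneg.2 (density_mul_le_pairProb hw hZ (Finset.mem_erase.1 hx).1.symm)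
  have hconst : ∑ x ∈ S, (pairProb w n u x - density w n u * (1 - density w n x)) =
      (S.card : ℝ) * (pairProb w n u v - density w n u * (1 - density w n v)) := by
    rw [← nsmul_eq_mul, ← Finset.sum_const]
    refine Finset.sum_congr rfl fun x hx => ?_
    rw [density_eq_of_eq (hS x hx)]
    congr 1
    unfold pairProb
    rw [← canonAvg_comp_swap (hS x hx)]
    have hux : u ≠ x := fun h => huS (h ▸ hx)
    congr 1
    ext α
    simp [occ, Equiv.swap_apply_of_ne_of_ne hux hvu.symm]
  linarith

end Canonical

end XXZ

namespace XXZ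

/-! ### Comparison with the grand canonical ensemble -/

section Fugacity

variable {ι : Type*} [Fintype ι] [DecidableEq ι] {w : ι → ℝ} {n : ℕ}

lemma pairProb_le_density (hw : ∀ x, 0 < w x) (u v : ι) : pairProb w n u v ≤ density w n u :=
  canonAvg_mono hw fun α _ => by
    rcases occ_eq α u with h | h <;> rcases occ_eq α v with h' | h' <;> simp [h, h']

lemma pairProb_le_one_sub_density (hw : ∀ x, 0 < w x) (hZ : 0 < canonPart w n) (u v : ι) :
    pairProb w n v u ≤ 1 - density w n u := by
  unfold density
  rw [← canonAvg_one hZ, ← canonAvg_sub]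
  exact canonAvg_mono hw fun α _ => by
    rcases occ_eq α u with h | h <;> rcases occ_eq α v with h' | h' <;> simp [h, h']

/-- Split according to the other site. By detailed balance the events with exactly one of the two
occupied contribute equally to both sides, and the event that both are occupied is weighted by `w v
≤ w u`. -/
lemma mul_density_le (hw : ∀ x, 0 < w x) {u v : ι} (huv : w v ≤ w u) :
    w v * density w n u ≤ w u * density w n v := by
  have h1 := mul_pairProb (n := n) hw u v
  have h2 := pairProb_sub (w := w) (n := n) u v
  have h3 := pairProb_le_density (n := n) hw u v
  have h4 : density w n v = density w n u - pairProb w n u v + pairProb w n v u := by linarith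
  rw [h4]
  linarith [mul_le_mul_of_nonneg_right huv (sub_nonneg.2 h3)]

/-- The same splitting as for densities, with the event that both sites are empty in place of both
occupied. -/
lemma mul_one_sub_density_le (hw : ∀ x, 0 < w x) (hZ : 0 < canonPart w n) {u v : ι}
    (huv : w v ≤ w u) : w v * (1 - density w n v) ≤ w u * (1 - density w n u) := by
  have h1 := mul_pairProb (n := n) hw u v
  have h2 := pairProb_sub (w := w) (n := n) u v
  have h3 := pairProb_le_one_sub_density hw hZ u v
  have h4 : density w n v = density w n u - pairProb w n u v + pairProb w n v u := by linarith
  rw [h4]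
  linarith [mul_le_mul_of_nonneg_right huv (sub_nonneg.2 h3)]

lemma density_mono (hw : ∀ x, 0 < w x) {u v : ι} (huv : w v ≤ w u) :
    density w n v ≤ density w n u := by
  have h1 := mul_pairProb (n := n) hw u v
  have h2 := pairProb_sub (w := w) (n := n) u v
  have h3 := pairProb_nonneg (n := n) hw v u
  have : w v * pairProb w n v u ≤ w v * pairProb w n u v := by
    rw [h1]; exact mul_le_mul_of_nonneg_right huv h3
  linarith [le_of_mul_le_mul_left this (hw v)]

lemma density_pos (hw : ∀ x, 0 < w x) (hZ : 0 < canonPart w n) (hn : 0 < n) (x : ι) :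
    0 < density w n x := by
  by_contra hx
  have hx0 : density w n x = 0 := le_antisymm (not_lt.1 hx) (density_nonneg hw x)
  have h0 : ∀ u, density w n u = 0 := by
    intro u
    refine le_antisymm ?_ (density_nonneg hw u)
    rcases le_total (w x) (w u) with h | h
    · have := mul_density_le (n := n) hw h
      rw [hx0, mul_zero] at this
      by_contra hu
      have := mul_pos (hw x) (not_le.1 hu)
      linarith
    · exact (density_mono hw h).trans hx0.le
  have := sum_density hZ
  rw [Finset.sum_congr rfl fun u _ => h0 u] at this
  rw [Finset.sum_const_zero] at this
  exact hn.ne (by exact_mod_cast this)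

lemma density_lt_one (hw : ∀ x, 0 < w x) (hZ : 0 < canonPart w n) (hn : n < Fintype.card ι)
    (x : ι) : density w n x < 1 := by
  by_contra hx
  have hx0 : density w n x = 1 := le_antisymm (density_le_one hw hZ x) (not_lt.1 hx)
  have h0 : ∀ u, density w n u = 1 := by
    intro u
    refine le_antisymm (density_le_one hw hZ u) ?_
    rcases le_total (w x) (w u) with h | h
    · exact hx0.symm.le.trans (density_mono hw h)
    · have := mul_one_sub_density_le hw hZ h
      rw [hx0, sub_self, mul_zero] at this
      by_contra hu
      have := mul_pos (hw u) (sub_pos.2 (not_le.1 hu))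
      linarith
  have := sum_density hZ
  rw [Finset.sum_congr rfl fun u _ => h0 u] at this
  simp at this
  have : Fintype.card ι = n := by exact_mod_cast this
  omega

/-- The effective fugacity of a site. -/
noncomputable def fugacity (w : ι → ℝ) (n : ℕ) (x : ι) : ℝ :=
  density w n x / ((1 - density w n x) * w x)

variable (hw : ∀ x, 0 < w x) (hn0 : 0 < n) (hn1 : n < Fintype.card ι)
include hw hn0 hn1

/-- Effective fugacities of two sites are close unless one is almost empty and the other almost
full; `m` is a lower bound on the number of sites of each activity. -/
lemma one_sub_mul_fugacity_le {m τ : ℝ} (hm : 0 < m) (hτ : 0 < τ) {u v : ι}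
    (hL : u ≠ v → m ≤ (Finset.univ.filter fun x => w x = w v ∧ x ≠ u).card)
    (hL' : u ≠ v → m ≤ (Finset.univ.filter fun x => w x = w u ∧ x ≠ v).card)
    (h : τ ≤ density w n u ∨ τ ≤ 1 - density w n v) :
    (1 - 1 / (m * τ)) * fugacity w n v ≤ fugacity w n u := by
  have hZ := canonPart_pos hw hn1.le
  have hu0 := density_pos hw hZ hn0 u
  have hv0 := density_pos hw hZ hn0 v
  have hu1 := density_lt_one hw hZ hn1 u
  have hv1 := density_lt_one hw hZ hn1 v
  have hwu := hw u
  have hwv := hw v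
  rcases eq_or_ne u v with rfl | huv
  · have : 0 ≤ fugacity w n u :=
      div_nonneg hu0.le (mul_nonneg (sub_pos.2 hu1).le (hw u).le)
    have h2 : 0 ≤ 1 / (m * τ) := by positivity
    nlinarith
  have hk := density_mul_le_pairProb hw hZ huv
  have hs := pairProb_sub (w := w) (n := n) u v
  have hb := mul_pairProb (n := n) hw u v
  have c1 := card_mul_pairProb_le hw hZ (u := u) (v := v)
    (S := Finset.univ.filter fun x => w x = w v ∧ x ≠ u) (by simp)
    (fun x hx => (Finset.mem_filter.1 hx).2.1) huv.symm
  have c2 := card_mul_pairProb_le hw hZ (u := v) (v := u)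
    (S := Finset.univ.filter fun x => w x = w u ∧ x ≠ v) (by simp)
    (fun x hx => (Finset.mem_filter.1 hx).2.1) huv
  have hk' := density_mul_le_pairProb hw hZ huv.symm
  have d1 := mul_le_mul_of_nonneg_right (hL huv) (sub_nonneg.2 hk) |>.trans c1
  have d2 := mul_le_mul_of_nonneg_right (hL' huv) (sub_nonneg.2 hk') |>.trans c2
  unfold fugacity
  set ρ := density w n u
  set σ := density w n v
  set P := pairProb w n u v
  set P' := pairProb w n v u
  -- The truncated correlation is symmetric in `u` and `v`, so either number constraint may be
  -- applied. The one for `v` gives a bound by `1 - σ`, useful if `ρ ≥ τ`; the one for `u` gives a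
  -- bound by `ρ`, useful if `1 - σ ≥ τ`.
  have hkey : m * τ * (P - ρ * (1 - σ)) ≤ ρ * (1 - σ) := by
    rcases h with h | h
    · have : m * (P - ρ * (1 - σ)) ≤ 1 - σ := by
        have : P' - σ * (1 - ρ) = P - ρ * (1 - σ) := by linarith
        rw [this] at d2
        nlinarith
      nlinarith
    · have : m * (P - ρ * (1 - σ)) ≤ ρ := by nlinarith
      nlinarith
  have hmt : 0 < m * τ := by positivity
  have hkey2 : P - ρ * (1 - σ) ≤ 1 / (m * τ) * P := by
    rw [one_div, inv_mul_eq_div, le_div_iff₀ hmt]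
    nlinarith
  rw [mul_div_assoc', div_le_div_iff₀ (mul_pos (sub_pos.2 hv1) hwv) (mul_pos (sub_pos.2 hu1) hwu)]
  have hP' : P' = P * w v / w u := by
    rw [eq_div_iff hwu.ne']; linarith
  -- If the prefactor is negative the claim is only a comparison of signs.
  by_cases hε : 0 ≤ 1 - 1 / (m * τ)
  · have e1 : σ * (1 - ρ) * w u ≤ P * w v := by
      have : P' * w u = P * w v := by rw [hP']; field_simp
      rw [← this]
      exact mul_le_mul_of_nonneg_right hk' hwu.le
    have e2 : (1 - 1 / (m * τ)) * P ≤ ρ * (1 - σ) := by linarith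
    calc (1 - 1 / (m * τ)) * σ * ((1 - ρ) * w u)
        = (1 - 1 / (m * τ)) * (σ * (1 - ρ) * w u) := by ring
      _ ≤ (1 - 1 / (m * τ)) * (P * w v) := mul_le_mul_of_nonneg_left e1 hε
      _ = ((1 - 1 / (m * τ)) * P) * w v := by ring
      _ ≤ ρ * (1 - σ) * w v := mul_le_mul_of_nonneg_right e2 hwv.le
      _ = _ := by ring
  · have e1 : 0 ≤ σ * ((1 - ρ) * w u) := mul_nonneg hv0.le (mul_nonneg (sub_pos.2 hu1).le hwu.le)
    have e2 : 0 ≤ ρ * ((1 - σ) * w v) := mul_nonneg hu0.le (mul_nonneg (sub_pos.2 hv1).le hwv.le)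
    rw [mul_assoc]
    exact (mul_nonpos_of_nonpos_of_nonneg (not_le.1 hε).le e1).trans e2

/-- A site that is neither almost empty nor almost full can be compared with every other site in
both directions, so any two sites are linked through it at the cost of two factors. If all densities
are bounded away from the same extreme, one direct comparison is enough. -/
lemma sq_mul_fugacity_le {m τ : ℝ} (hm : 0 < m) (hτ : 0 < τ) (hmτ : 1 ≤ m * τ)
    (hL : ∀ u v : ι, m ≤ (Finset.univ.filter fun x => w x = w v ∧ x ≠ u).card)
    (h : (∃ x, τ ≤ density w n x ∧ τ ≤ 1 - density w n x) ∨ (∀ x, τ ≤ density w n x) ∨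
      ∀ x, τ ≤ 1 - density w n x) (u v : ι) :
    (1 - 1 / (m * τ)) ^ 2 * fugacity w n v ≤ fugacity w n u := by
  have hZ := canonPart_pos hw hn1.le
  have hpos : ∀ x, 0 ≤ fugacity w n x := fun x => div_nonneg (density_nonneg hw x)
    (mul_nonneg (sub_pos.2 (density_lt_one hw hZ hn1 x)).le (hw x).le)
  have hmt : 0 < m * τ := by positivity
  have h0 : 0 ≤ 1 - 1 / (m * τ) := by
    rw [sub_nonneg, div_le_one hmt]; exact hmτ
  have h1 : 1 - 1 / (m * τ) ≤ 1 := by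
    have : 0 ≤ 1 / (m * τ) := by positivity
    linarith
  have one : (τ ≤ density w n u ∨ τ ≤ 1 - density w n v) →
      (1 - 1 / (m * τ)) ^ 2 * fugacity w n v ≤ fugacity w n u := by
    intro hh
    have := one_sub_mul_fugacity_le hw hn0 hn1 hm hτ (fun _ => hL u v) (fun _ => hL v u) hh
    refine le_trans (mul_le_mul_of_nonneg_right ?_ (hpos v)) this
    nlinarith
  rcases h with ⟨x, hx1, hx2⟩ | h | h
  · have a := one_sub_mul_fugacity_le hw hn0 hn1 hm hτ (fun _ => hL u x) (fun _ => hL x u) (Or.inr hx2)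
    have b := one_sub_mul_fugacity_le hw hn0 hn1 hm hτ (fun _ => hL x v) (fun _ => hL v x) (Or.inl hx1)
    calc _ = (1 - 1 / (m * τ)) * ((1 - 1 / (m * τ)) * fugacity w n v) := by ring
      _ ≤ (1 - 1 / (m * τ)) * fugacity w n x := mul_le_mul_of_nonneg_left b h0
      _ ≤ _ := a
  · exact one (Or.inl (h u))
  · exact one (Or.inr (h v))

/-- The canonical two-point function at equal activities is bounded below by the grand canonical
variance of a site. -/
lemma le_pairProb_of_sum_eq {m τ : ℝ} (hm : 0 < m) (hτ : 0 < τ) (hmτ : 1 < m * τ)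
    (hL : ∀ u v : ι, m ≤ (Finset.univ.filter fun x => w x = w v ∧ x ≠ u).card)
    (h : (∃ x, τ ≤ density w n x ∧ τ ≤ 1 - density w n x) ∨ (∀ x, τ ≤ density w n x) ∨
      ∀ x, τ ≤ 1 - density w n x) {z : ℝ} (hz : 0 < z)
    (hsum : ∑ x, z * w x / (1 + z * w x) = n) {u v : ι} (huv : u ≠ v) (hwuv : w u = w v) :
    (1 - 1 / (m * τ)) ^ 6 * (z * w u / (1 + z * w u) ^ 2) ≤ pairProb w n u v := by
  have hZ := canonPart_pos hw hn1.le
  have hfug := sq_mul_fugacity_le hw hn0 hn1 hm hτ hmτ.le hL h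
  have hne : (Finset.univ : Finset ι).Nonempty := ⟨u, Finset.mem_univ u⟩
  have hmt : 0 < m * τ := by positivity
  set t := (1 - 1 / (m * τ)) ^ 2 with ht
  have h1 : 0 < 1 - 1 / (m * τ) := by
    rw [sub_pos, div_lt_one hmt]; exact hmτ
  have ht0 : 0 < t := by positivity
  have ht1 : t ≤ 1 := by
    have : 0 ≤ 1 / (m * τ) := by positivity
    rw [ht]; nlinarith
  have hd0 := density_pos hw hZ hn0
  have hd1 := density_lt_one hw hZ hn1
  have hsum' : ∑ x, z * w x / (1 + z * w x) = ∑ x, density w n x := by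
    rw [hsum, sum_density hZ]
  -- Equal sums cannot be strictly ordered termwise. Hence one site has an effective fugacity at
  -- least `z` and another one at most `z`.
  obtain ⟨x, -, hx⟩ := Finset.exists_le_of_sum_le hne hsum'.le
  obtain ⟨y, -, hy⟩ := Finset.exists_le_of_sum_le hne hsum'.ge
  have hx' : z ≤ fugacity w n x := by
    have := hw x
    have := sub_pos.2 (hd1 x)
    unfold fugacity
    rw [div_le_iff₀ (by positivity)] at hx
    rw [le_div_iff₀ (by positivity)]
    nlinarith
  have hy' : fugacity w n y ≤ z := by
    have := hw y
    have := sub_pos.2 (hd1 y)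
    unfold fugacity
    rw [le_div_iff₀ (by positivity)] at hy
    rw [div_le_iff₀ (by positivity)]
    nlinarith
  have f1 : t * z ≤ fugacity w n u := (mul_le_mul_of_nonneg_left hx' ht0.le).trans (hfug u x)
  have f2 : t * fugacity w n u ≤ z := (hfug y u).trans hy'
  have hk := density_mul_le_pairProb hw hZ huv
  rw [← density_eq_of_eq hwuv] at hk
  refine le_trans ?_ hk
  have e : (1 - 1 / (m * τ)) ^ 6 = t ^ 3 := by rw [ht]; ring
  rw [e]
  have hwu := hw u
  have hr := sub_pos.2 (hd1 u)
  have hr0 := hd0 u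
  -- In terms of the odds `o = ρ / (1 - ρ)` the variance is `o / (1 + o)²`. Comparability of `o` and
  -- `z w_u` within a factor `t` then costs `t³`.
  set o := fugacity w n u * w u with ho
  have hor : o = density w n u / (1 - density w n u) := by
    rw [ho, fugacity]; field_simp
  have ho0 : 0 < o := by rw [hor]; positivity
  have hρ : density w n u * (1 - density w n u) = o / (1 + o) ^ 2 := by
    rw [hor]; field_simp; ring
  rw [hρ]
  set y0 := z * w u
  have hy0 : 0 < y0 := by positivity
  have g1 : t * y0 ≤ o := by
    calc t * (z * w u) = t * z * w u := by ring
      _ ≤ _ := mul_le_mul_of_nonneg_right f1 hwu.le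
  have g2 : t * o ≤ y0 := by
    calc t * (fugacity w n u * w u) = t * fugacity w n u * w u := by ring
      _ ≤ _ := mul_le_mul_of_nonneg_right f2 hwu.le
  have g3 : t * (1 + o) ≤ 1 + y0 := by linarith
  rw [← mul_div_assoc, div_le_div_iff₀ (by positivity) (by positivity)]
  have g4 : (t * (1 + o)) ^ 2 ≤ (1 + y0) ^ 2 := pow_le_pow_left₀ (by positivity) g3 2
  calc t ^ 3 * y0 * (1 + o) ^ 2 = (t * y0) * (t * (1 + o)) ^ 2 := by ring
    _ ≤ o * (1 + y0) ^ 2 := mul_le_mul g1 g4 (by positivity) ho0.le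

/-- For layered activities `q ^ (2 * level)` some layer is neither almost empty nor almost full,
unless all densities lie on the same side of `1/2`. -/
lemma exists_intermediate_density {q : ℝ} (hq0 : 0 < q) (hq1 : q < 1) (level : ι → ℤ)
    (hlev : ∀ x, w x = q ^ (2 * level x))
    (hnext : ∀ u x, level u < level x → ∃ v, level v = level u + 1) :
    (∃ x, q ^ 2 / 2 ≤ density w n x ∧ q ^ 2 / 2 ≤ 1 - density w n x) ∨
      (∀ x, q ^ 2 / 2 ≤ density w n x) ∨ ∀ x, q ^ 2 / 2 ≤ 1 - density w n x := by
  have hZ := canonPart_pos hw hn1.le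
  have hq2 : q ^ 2 < 1 := by nlinarith
  have hwle : ∀ u v, level u ≤ level v → w v ≤ w u := by
    intro u v huv
    rw [hlev, hlev]
    exact zpow_le_zpow_right_of_le_one₀ hq0 hq1.le (by linarith)
  by_contra hcon
  push Not at hcon
  obtain ⟨hA, ⟨x, hx⟩, ⟨y, hy⟩⟩ := hcon
  -- Take the highest site with density at least `1/2`. One level up the density is below `1/2`, and
  -- the activity ratio `q²` lets the empty fraction change by at most that factor. So `u` is empty
  -- with probability at least `q² / 2`.
  obtain ⟨u, hu, hmax⟩ := Finset.exists_max_image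
    (Finset.univ.filter fun a => 1 / 2 ≤ density w n a) level ⟨y, by simp; linarith⟩
  have hu' : 1 / 2 ≤ density w n u := (Finset.mem_filter.1 hu).2
  have hlt : level u < level x := by
    by_contra hle
    have := density_mono (n := n) hw (hwle x u (not_lt.1 hle))
    linarith
  obtain ⟨v, hv⟩ := hnext u x hlt
  have hv' : density w n v < 1 / 2 := by
    by_contra hge
    have := hmax v (by simpa using not_lt.1 hge)
    omega
  have h1 := mul_one_sub_density_le hw hZ (hwle u v (by omega))
  have hwv : w v = q ^ 2 * w u := by
    rw [hlev, hlev, hv, mul_add, zpow_add₀ hq0.ne', mul_comm]; norm_cast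
  rw [hwv] at h1
  have h2 : q ^ 2 * (1 - density w n v) ≤ 1 - density w n u := by
    refine le_of_mul_le_mul_left ?_ (hw u)
    linarith
  have := hA u (by linarith)
  have : 0 < q ^ 2 := by positivity
  nlinarith

end Fugacity

end XXZ

namespace XXZ

/-! ### The bond Hamiltonian in the configuration basis -/

lemma sum_comp_swap {ι E : Type*} [Fintype ι] [DecidableEq ι] [AddCommMonoid E] (u v : ι)
    (G : (ι → Fin 2) → E) : ∑ α, G (α ∘ Equiv.swap u v) = ∑ α, G α := by
  rw [← Equiv.sum_comp (Equiv.arrowCongr (Equiv.swap u v) (Equiv.refl (Fin 2))) G]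
  refine Finset.sum_congr rfl fun α _ => ?_
  congr 1

section Spin

variable {Λ : Finset Site}

lemma siteOp_mulVec (M : Matrix (Fin 2) (Fin 2) ℂ) (x : Λ) (ψ : Config Λ → ℂ) (α : Config Λ) :
    (siteOp M x).mulVec ψ α = ∑ b, M (α x) b * ψ (Function.update α x b) := by
  have hinj : Function.Injective fun b : Fin 2 => Function.update α x b :=
    Function.update_injective α x
  rw [Matrix.mulVec, dotProduct]
  have h1 := Finset.sum_image (f := fun β => siteOp M x α β * ψ β)
    (s := Finset.univ) (g := fun b : Fin 2 => Function.update α x b) hinj.injOn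
  have h2 : ∑ β ∈ Finset.univ.image (fun b : Fin 2 => Function.update α x b),
      siteOp M x α β * ψ β = ∑ β, siteOp M x α β * ψ β := by
    refine Finset.sum_subset (Finset.subset_univ _) fun β _ hβ => ?_
    have : ¬ ∀ y, y ≠ x → α y = β y := by
      intro h
      refine hβ (Finset.mem_image.2 ⟨β x, Finset.mem_univ _, ?_⟩)
      funext y
      by_cases hy : y = x
      · subst hy; simp
      · simp [hy, h y hy]
    rw [siteOp, Matrix.of_apply, if_neg this, zero_mul]
  rw [← h2, h1]
  refine Finset.sum_congr rfl fun b _ => ?_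
  rw [siteOp, Matrix.of_apply, if_pos]
  · simp
  · intro y hy; simp [hy]

lemma anisotropy_inv {q : ℝ} (hq : 0 < q) : (anisotropy q)⁻¹ = 2 * q / (1 + q ^ 2) := by
  unfold anisotropy
  field_simp
  ring

lemma boundaryCoeff_eq {q : ℝ} (hq : 0 < q) (hq1 : q < 1) :
    boundaryCoeff q = (1 - q ^ 2) / (2 * (1 + q ^ 2)) := by
  unfold boundaryCoeff
  have : 1 - 1 / anisotropy q ^ 2 = ((1 - q ^ 2) / (1 + q ^ 2)) ^ 2 := by
    rw [one_div, ← inv_pow, anisotropy_inv hq]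
    field_simp
    ring
  rw [this, Real.sqrt_sq]
  · field_simp
  · have : q ^ 2 < 1 := by nlinarith
    exact div_nonneg (by linarith) (by positivity)

/-- On parallel spins the Ising part and the constant cancel. On antiparallel spins the boundary
field turns the remaining two by two block into a rank-one projection. The four spin values are
checked one by one. -/
lemma bondHamiltonian_mulVec {q : ℝ} (hq : 0 < q) (hq1 : q < 1) {x y : Λ} (hxy : x ≠ y)
    (ψ : Config Λ → ℂ) (α : Config Λ) :
    (bondHamiltonian q x y).mulVec ψ α =
      (if α x = 1 ∧ α y = 0 then
        (q : ℂ) / (1 + q ^ 2) * (q * ψ α - ψ (α ∘ Equiv.swap x y)) else 0) +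
      if α x = 0 ∧ α y = 1 then
        1 / (1 + (q : ℂ) ^ 2) * (ψ α - q * ψ (α ∘ Equiv.swap x y)) else 0 := by
  have hq2 : (1 + (q : ℂ) ^ 2) ≠ 0 := by
    have : (1 + q ^ 2 : ℝ) ≠ 0 := by positivity
    exact_mod_cast this
  have e1 : ψ (Function.update (Function.update α x (α x)) y (α y)) = ψ α := by simp
  have e2 : ψ (Function.update (Function.update α x (α y)) y (α x)) = ψ (α ∘ Equiv.swap x y) := by
    congr 1
    funext z
    by_cases hzy : z = y
    · subst hzy; simp
    · by_cases hzx : z = x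
      · subst hzx; simp [hzy]
      · simp [hzx, hzy, Equiv.swap_apply_of_ne_of_ne]
  have e3 : ψ (Function.update α x (α x)) = ψ α := by simp
  have e4 : ψ (Function.update α y (α y)) = ψ α := by simp
  have hcase : ∀ c : Fin 2, c = 0 ∨ c = 1 := by decide
  unfold bondHamiltonian
  rw [← Complex.ofReal_inv, anisotropy_inv hq, boundaryCoeff_eq hq hq1]
  simp only [Matrix.sub_mulVec, Matrix.add_mulVec, Matrix.neg_mulVec, Matrix.smul_mulVec,
    ← Matrix.mulVec_mulVec, Matrix.one_mulVec, Pi.sub_apply, Pi.add_apply, Pi.neg_apply,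
    Pi.smul_apply, siteOp_mulVec, Fin.sum_univ_two, Function.update_of_ne hxy.symm, smul_eq_mul]
  generalize ha : α x = a at *
  generalize hb : α y = b at *
  push_cast
  rcases hcase a with rfl | rfl <;> rcases hcase b with rfl | rfl <;>
    simp [S1, S2, S3, e1, e2, e3, e4] <;> field_simp <;> ring_nf <;>
    simp only [Complex.I_sq] <;> ring

lemma inner_app (X : Op Λ) (ψ φ : State Λ) :
    inner ℂ φ (app X ψ) = ∑ α, (starRingEnd ℂ) (φ α) * X.mulVec ψ α := by
  rw [PiLp.inner_apply]
  refine Finset.sum_congr rfl fun α _ => ?_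
  rw [RCLike.inner_apply, mul_comm]
  rfl

/-- The energy of a bond. -/
noncomputable def bondEnergy (q : ℝ) (x y : Λ) (ψ : State Λ) : ℝ :=
  ∑ α : Config Λ, if α x = 1 ∧ α y = 0 then
    ‖(q : ℂ) * ψ α - ψ (α ∘ Equiv.swap x y)‖ ^ 2 / (1 + q ^ 2) else 0

lemma inner_bondHamiltonian {q : ℝ} (hq : 0 < q) (hq1 : q < 1) {x y : Λ} (hxy : x ≠ y)
    (ψ : State Λ) : inner ℂ ψ (app (bondHamiltonian q x y) ψ) = (bondEnergy q x y ψ : ℂ) := by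
  have hq2 : (1 + (q : ℂ) ^ 2) ≠ 0 := by
    have : (1 + q ^ 2 : ℝ) ≠ 0 := by positivity
    exact_mod_cast this
  rw [inner_app]
  simp only [bondHamiltonian_mulVec hq hq1 hxy, mul_add, Finset.sum_add_distrib]
  -- Exchanging the two spins moves the second half of the sum onto the configurations of the first
  -- half, where the two combine into a perfect square.
  rw [← sum_comp_swap x y fun α => (starRingEnd ℂ) (ψ α) * if α x = 0 ∧ α y = 1 then
        1 / (1 + (q : ℂ) ^ 2) * (ψ α - q * ψ (α ∘ Equiv.swap x y)) else 0,
    ← Finset.sum_add_distrib, bondEnergy, Complex.ofReal_sum]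
  refine Finset.sum_congr rfl fun α _ => ?_
  have hinv : (α ∘ Equiv.swap x y) ∘ Equiv.swap x y = α := by
    funext z; simp
  rw [hinv]
  simp only [Function.comp_apply, Equiv.swap_apply_left, Equiv.swap_apply_right]
  by_cases h : α x = 1 ∧ α y = 0
  · rw [if_pos h, if_pos h.symm, if_pos h]
    push_cast
    rw [← Complex.mul_conj']
    simp only [map_sub, map_mul, Complex.conj_ofReal]
    field_simp
    ring
  · rw [if_neg h, if_neg (fun h' => h h'.symm), if_neg h]
    simp

lemma bondEnergy_nonneg {q : ℝ} (x y : Λ) (ψ : State Λ) : 0 ≤ bondEnergy q x y ψ := by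
  refine Finset.sum_nonneg fun α _ => ?_
  split_ifs <;> positivity

lemma IsBond.ne {x y : Λ} (h : IsBond x y) : x ≠ y := by
  rintro rfl
  have := h.2
  omega

lemma inner_hamiltonian {q : ℝ} (hq : 0 < q) (hq1 : q < 1) (ψ : State Λ) :
    inner ℂ ψ (app (hamiltonian q Λ) ψ) =
      ((∑ b : Λ × Λ with IsBond b.1 b.2, bondEnergy q b.1 b.2 ψ : ℝ) : ℂ) := by
  unfold app hamiltonian
  rw [map_sum, LinearMap.sum_apply, inner_sum, Complex.ofReal_sum]
  refine Finset.sum_congr rfl fun b hb => ?_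
  exact inner_bondHamiltonian hq hq1 (Finset.mem_filter.1 hb).2.ne ψ

lemma expect_hamiltonian_nonneg {q : ℝ} (hq : 0 < q) (hq1 : q < 1) (ψ : State Λ) :
    0 ≤ expect (hamiltonian q Λ) ψ := by
  unfold expect
  rw [inner_hamiltonian hq hq1, Complex.ofReal_re]
  exact div_nonneg (Finset.sum_nonneg fun b _ => bondEnergy_nonneg _ _ _) (by positivity)

lemma inSector_iff {n : ℕ} {ψ : State Λ} : InSector n ψ ↔ ∀ α, particles α ≠ n → ψ α = 0 := by
  unfold InSector
  have hα : ∀ α, (app (numberOp Λ) ψ) α = (particles α : ℂ) * ψ α := by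
    intro α
    change (numberOp Λ).mulVec ψ α = _
    rw [numberOp, Matrix.mulVec_diagonal]
  constructor
  · intro h α hne
    have h1 := congrArg (fun φ : State Λ => φ α) h
    simp only [hα, PiLp.smul_apply, smul_eq_mul] at h1
    by_contra h0
    have := mul_right_cancel₀ h0 h1
    exact hne (Nat.cast_injective (R := ℂ) this)
  · intro h
    ext α
    rw [hα, PiLp.smul_apply, smul_eq_mul]
    by_cases hne : particles α = n
    · rw [hne]
    · rw [h α hne]; simp

end Spin

end XXZ

namespace XXZ

/-! ### Ground states and twisted states -/

section States

variable {Λ : Finset Site}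

/-- The activity `q ^ (2 l(x))` of a site. -/
noncomputable def activity (q : ℝ) (Λ : Finset Site) (x : Λ) : ℝ := q ^ (2 * height x)

/-- The amplitude of a configuration in the interface state. -/
noncomputable def amplitude (q : ℝ) (n : ℕ) (α : Config Λ) : ℝ :=
  if particles α = n then ∏ x : Λ, q ^ (height x * (α x : ℕ) : ℤ) else 0

/-- Phases cut off outside the cylinder of radius `R`. -/
noncomputable def cutPhase (R : ℝ) (φ : Site → ℝ) (x : Site) : ℝ :=
  if axisDist x ≤ R then φ x else 0

/-- The total phase of a configuration in the twisted state. -/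
noncomputable def totalPhase (g : Site → ℝ) (α : Config Λ) : ℝ :=
  ∑ x : Λ, g x * (1 - 2 * occ α x)

variable {q : ℝ} {n : ℕ}

lemma activity_pos (hq : 0 < q) (x : Λ) : 0 < activity q Λ x := zpow_pos hq _

lemma amplitude_sq (α : Config Λ) :
    amplitude q n α ^ 2 = canonWeight (activity q Λ) n α := by
  unfold amplitude canonWeight particles activity
  split_ifs
  · rw [← Finset.prod_pow]
    refine Finset.prod_congr rfl fun x _ => ?_
    rw [← zpow_natCast, ← zpow_natCast, ← zpow_mul, ← zpow_mul]
    congr 1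
    push_cast; ring
  · simp

lemma interfaceState_apply (α : Config Λ) : interfaceState q Λ n α = (amplitude q n α : ℂ) := by
  unfold interfaceState amplitude
  change (if _ then _ else _) = _
  split_ifs <;> simp

/-- Moving a particle up by one level multiplies the amplitude by `q`. This is the relation that
makes every bond projection annihilate the interface state. -/
lemma amplitude_comp_swap (hq : 0 < q) {x y : Λ} (hh : height y = height x + 1) {α : Config Λ}
    (hx : α x = 1) (hy : α y = 0) :
    amplitude q n (α ∘ Equiv.swap x y) = q * amplitude q n α := by
  have hxy : x ≠ y := by rintro rfl; rw [hx] at hy; exact absurd hy (by decide)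
  have hp : particles (α ∘ Equiv.swap x y) = particles α :=
    Equiv.sum_comp (Equiv.swap x y) fun z => (α z : ℕ)
  unfold amplitude
  rw [hp]
  split_ifs
  · rw [← Finset.mul_prod_erase _ _ (Finset.mem_univ x),
      ← Finset.mul_prod_erase _ _ (Finset.mem_erase.2 ⟨hxy.symm, Finset.mem_univ y⟩),
      ← Finset.mul_prod_erase Finset.univ _ (Finset.mem_univ x),
      ← Finset.mul_prod_erase (Finset.univ.erase x) _
        (Finset.mem_erase.2 ⟨hxy.symm, Finset.mem_univ y⟩)]
    have : ∏ z ∈ (Finset.univ.erase x).erase y,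
        q ^ (height z * ((α ∘ Equiv.swap x y) z : ℕ) : ℤ) =
        ∏ z ∈ (Finset.univ.erase x).erase y, q ^ (height z * (α z : ℕ) : ℤ) := by
      refine Finset.prod_congr rfl fun z hz => ?_
      have h1 := (Finset.mem_erase.1 hz).1
      have h2 := (Finset.mem_erase.1 (Finset.mem_erase.1 hz).2).1
      rw [Function.comp_apply, Equiv.swap_apply_of_ne_of_ne h2 h1]
    rw [this]
    simp [hx, hy, hh, zpow_add₀ hq.ne']
    ring
  · simp

lemma norm_sq_interfaceState :
    ‖interfaceState q Λ n‖ ^ 2 = canonPart (activity q Λ) n := by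
  rw [EuclideanSpace.norm_sq_eq, canonPart]
  refine Finset.sum_congr rfl fun α _ => ?_
  rw [interfaceState_apply, Complex.norm_real, Real.norm_eq_abs, sq_abs, amplitude_sq]

lemma inSector_interfaceState : InSector n (interfaceState q Λ n) := by
  rw [inSector_iff]
  intro α hα
  rw [interfaceState_apply, amplitude, if_neg hα]; simp

lemma bond_kills_interfaceState (hq : 0 < q) {x y : Λ} (hh : height y = height x + 1)
    {α : Config Λ} (hα : α x = 1 ∧ α y = 0) :
    (q : ℂ) * interfaceState q Λ n α - interfaceState q Λ n (α ∘ Equiv.swap x y) = 0 := by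
  rw [interfaceState_apply, interfaceState_apply, amplitude_comp_swap hq hh hα.1 hα.2]
  push_cast; ring

/-- Adding a multiple of the interface state does not change bond energies. -/
lemma bondEnergy_sub_smul (hq : 0 < q) {x y : Λ} (hh : height y = height x + 1) (ψ : State Λ)
    (c : ℂ) : bondEnergy q x y (ψ - c • interfaceState q Λ n) = bondEnergy q x y ψ := by
  unfold bondEnergy
  refine Finset.sum_congr rfl fun α _ => ?_
  split_ifs with hα
  · have h := bond_kills_interfaceState (n := n) hq hh hα
    have : (q : ℂ) * (ψ - c • interfaceState q Λ n) α -
        (ψ - c • interfaceState q Λ n) (α ∘ Equiv.swap x y) =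
        (q : ℂ) * ψ α - ψ (α ∘ Equiv.swap x y) := by
      simp only [PiLp.sub_apply, PiLp.smul_apply, smul_eq_mul]
      linear_combination (-c) * h
    rw [this]
  · rfl

lemma expect_interfaceState (hq : 0 < q) (hq1 : q < 1) :
    expect (hamiltonian q Λ) (interfaceState q Λ n) = 0 := by
  unfold expect
  rw [inner_hamiltonian hq hq1, Complex.ofReal_re, Finset.sum_eq_zero, zero_div]
  intro b hb
  refine Finset.sum_eq_zero fun α _ => ?_
  split_ifs with hα
  · rw [bond_kills_interfaceState hq (Finset.mem_filter.1 hb).2.2 hα]; simp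
  · rfl

lemma interfaceState_ne_zero (hq : 0 < q) (hn : n ≤ Fintype.card Λ) :
    interfaceState q Λ n ≠ 0 := by
  intro h
  have := norm_sq_interfaceState (Λ := Λ) (q := q) (n := n)
  rw [h] at this
  have := canonPart_pos (activity_pos (Λ := Λ) hq) hn
  simp at *
  linarith

lemma groundEnergy_eq_zero (hq : 0 < q) (hq1 : q < 1) (hn : n ≤ Fintype.card Λ) :
    groundEnergy q Λ n = 0 := by
  have hmem : (0 : ℝ) ∈ {E | ∃ ψ : State Λ, ψ ≠ 0 ∧ InSector n ψ ∧ E = expect (hamiltonian q Λ) ψ} :=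
    ⟨_, interfaceState_ne_zero hq hn, inSector_interfaceState, (expect_interfaceState hq hq1).symm⟩
  refine le_antisymm (csInf_le ⟨0, ?_⟩ hmem) (le_csInf ⟨0, hmem⟩ ?_)
  all_goals
    rintro E ⟨ψ, -, -, rfl⟩
    exact expect_hamiltonian_nonneg hq hq1 ψ

lemma excitedEnergy_le (hq : 0 < q) (hq1 : q < 1) {ψ : State Λ} (h0 : ψ ≠ 0) (hs : InSector n ψ)
    (ho : inner ℂ (interfaceState q Λ n) ψ = 0) :
    excitedEnergy q Λ n ≤ expect (hamiltonian q Λ) ψ := by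
  refine csInf_le ⟨0, ?_⟩ ⟨ψ, h0, hs, ho, rfl⟩
  rintro E ⟨ψ, -, -, -, rfl⟩
  exact expect_hamiltonian_nonneg hq hq1 ψ

lemma siteOp_S3 (x : Λ) : siteOp S3 x = Matrix.diagonal fun α => (1 / 2 - (occ α x : ℂ)) := by
  ext α β
  rw [siteOp, Matrix.of_apply, Matrix.diagonal_apply]
  by_cases h : α = β
  · subst h
    simp only [occ, if_true, implies_true]
    generalize α x = a
    have hcase : ∀ c : Fin 2, c = 0 ∨ c = 1 := by decide
    rcases hcase a with rfl | rfl <;> norm_num [S3]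
  · rw [if_neg h]
    split_ifs with h'
    · have : α x ≠ β x := by
        intro hx
        refine h (funext fun y => ?_)
        by_cases hy : y = x
        · rw [hy, hx]
        · exact h' y hy
      have hcase : ∀ c d : Fin 2, c ≠ d → S3 c d = 0 := by
        intro c d hcd
        fin_cases c <;> fin_cases d <;> simp_all [S3]
      exact hcase _ _ this
    · rfl

lemma localTwist_eq (R : ℝ) (φ : Site → ℝ) : localTwist Λ R φ =
    Matrix.diagonal fun α => Complex.exp (Complex.I * totalPhase (cutPhase R φ) α) := by
  unfold localTwist
  have : ∑ x ∈ (Finset.univ : Finset Λ).filter (fun x : Λ => axisDist x ≤ R),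
      (2 * Complex.I * (φ x : ℂ)) • siteOp S3 x =
      Matrix.diagonal fun α => Complex.I * (totalPhase (cutPhase R φ) α : ℂ) := by
    ext α β
    rw [Matrix.sum_apply]
    simp only [siteOp_S3, Matrix.smul_apply, Matrix.diagonal_apply]
    split_ifs with h
    · rw [Finset.sum_filter, totalPhase, Complex.ofReal_sum, Finset.mul_sum]
      refine Finset.sum_congr rfl fun x _ => ?_
      unfold cutPhase
      split_ifs
      · push_cast; simp only [smul_eq_mul]; ring
      · simp
    · simp
  rw [this, Matrix.exp_diagonal]
  congr 1
  ext α
  rw [Pi.coe_exp, Complex.exp_eq_exp_ℂ]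

lemma perturbedState_apply (R s : ℝ) (α : Config Λ) : perturbedState q Λ n R s α =
    Complex.exp (Complex.I * totalPhase (cutPhase R (besselPhase R s)) α) * amplitude q n α := by
  unfold perturbedState
  change (localTwist Λ R (besselPhase R s)).mulVec (interfaceState q Λ n).ofLp α = _
  rw [localTwist_eq, Matrix.mulVec_diagonal, interfaceState_apply]

lemma norm_exp_sub_exp_le (a b : ℝ) :
    ‖Complex.exp (Complex.I * a) - Complex.exp (Complex.I * b)‖ ≤ |a - b| := by
  have : Complex.exp (Complex.I * a) - Complex.exp (Complex.I * b) =
      Complex.exp (b * Complex.I) * (Complex.exp (Complex.I * ((a - b : ℝ) : ℂ)) - 1) := by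
    rw [mul_sub, ← Complex.exp_add, mul_one]
    push_cast
    ring_nf
  rw [this, norm_mul, Complex.norm_exp_ofReal_mul_I, one_mul]
  exact Real.norm_exp_I_mul_ofReal_sub_one_le

/-- Only the two exchanged sites contribute, so the phase change across a bond is a discrete
gradient independent of the rest of the configuration. -/
lemma totalPhase_comp_swap (g : Site → ℝ) {x y : Λ} {α : Config Λ} (hx : α x = 1) (hy : α y = 0) :
    totalPhase g α - totalPhase g (α ∘ Equiv.swap x y) = 2 * (g y - g x) := by
  have hxy : x ≠ y := by rintro rfl; rw [hx] at hy; exact absurd hy (by decide)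
  unfold totalPhase
  rw [← Finset.sum_sub_distrib]
  rw [Fintype.sum_eq_add x y hxy]
  · simp [occ, hx, hy]; ring
  · rintro z ⟨h1, h2⟩
    simp [occ, Equiv.swap_apply_of_ne_of_ne h1 h2]

/-- The energy of a bond in the twisted state. -/
lemma bondEnergy_perturbedState_le (hq : 0 < q) (R s : ℝ) {x y : Λ}
    (hh : height y = height x + 1) :
    bondEnergy q x y (perturbedState q Λ n R s) ≤ q ^ 2 / (1 + q ^ 2) *
      (4 * (cutPhase R (besselPhase R s) x - cutPhase R (besselPhase R s) y) ^ 2) *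
      ∑ α, canonWeight (activity q Λ) n α * (occ α x * (1 - occ α y)) := by
  unfold bondEnergy
  rw [Finset.mul_sum]
  refine Finset.sum_le_sum fun α _ => ?_
  set g := cutPhase R (besselPhase R s)
  split_ifs with hα
  · rw [perturbedState_apply, perturbedState_apply, amplitude_comp_swap hq hh hα.1 hα.2]
    -- Both amplitudes have modulus `q` times the same canonical amplitude, so only the difference
    -- of two phases remains, and it is bounded by the difference of the angles.
    have e : (q : ℂ) * (Complex.exp (Complex.I * totalPhase g α) * amplitude q n α) -
        Complex.exp (Complex.I * totalPhase g (α ∘ Equiv.swap x y)) *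
          ((q * amplitude q n α : ℝ) : ℂ) = ((q * amplitude q n α : ℝ) : ℂ) *
        (Complex.exp (Complex.I * totalPhase g α) -
          Complex.exp (Complex.I * totalPhase g (α ∘ Equiv.swap x y))) := by
      push_cast; ring
    rw [e, norm_mul, mul_pow, Complex.norm_real, Real.norm_eq_abs, sq_abs, mul_pow, amplitude_sq]
    have hb := norm_exp_sub_exp_le (totalPhase g α) (totalPhase g (α ∘ Equiv.swap x y))
    rw [totalPhase_comp_swap g hα.1 hα.2] at hb
    have hb2 := pow_le_pow_left₀ (norm_nonneg _) hb 2
    rw [sq_abs] at hb2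
    have ho : occ α x * (1 - occ α y) = 1 := by simp [occ, hα.1, hα.2]
    rw [ho, mul_one]
    have hw := canonWeight_nonneg (n := n) (activity_pos (Λ := Λ) hq) α
    rw [div_le_iff₀ (by positivity)]
    have e2 : q ^ 2 / (1 + q ^ 2) * (4 * (g x - g y) ^ 2) * canonWeight (activity q Λ) n α *
        (1 + q ^ 2) = q ^ 2 * canonWeight (activity q Λ) n α * (2 * (g y - g x)) ^ 2 := by
      field_simp; ring
    rw [e2]
    exact mul_le_mul_of_nonneg_left hb2 (by positivity)
  · have hw := canonWeight_nonneg (n := n) (activity_pos (Λ := Λ) hq) α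
    have : 0 ≤ occ α x * (1 - occ α y) := by
      rcases occ_eq α x with h | h <;> rcases occ_eq α y with h' | h' <;> simp [h, h']
    positivity

lemma excitation_inSector (R s : ℝ) : InSector n (excitation q Λ n R s) := by
  rw [inSector_iff]
  intro α hα
  unfold excitation
  rw [PiLp.sub_apply, PiLp.smul_apply, perturbedState_apply, interfaceState_apply, amplitude,
    if_neg hα]
  simp

lemma inner_excitation (hq : 0 < q) (hn : n ≤ Fintype.card Λ) (R s : ℝ) :
    inner ℂ (interfaceState q Λ n) (excitation q Λ n R s) = 0 := by
  unfold excitation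
  rw [inner_sub_right, inner_smul_right, div_mul_cancel₀, sub_self]
  rw [inner_self_ne_zero]
  exact interfaceState_ne_zero hq hn

lemma inner_hamiltonian_excitation (hq : 0 < q) (hq1 : q < 1) (R s : ℝ) :
    (inner ℂ (excitation q Λ n R s) (app (hamiltonian q Λ) (excitation q Λ n R s))).re =
      ∑ b : Λ × Λ with IsBond b.1 b.2, bondEnergy q b.1 b.2 (perturbedState q Λ n R s) := by
  rw [inner_hamiltonian hq hq1, Complex.ofReal_re]
  refine Finset.sum_congr rfl fun b hb => ?_
  exact bondEnergy_sub_smul hq (Finset.mem_filter.1 hb).2.2 _ _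

end States

end XXZ

namespace XXZ

/-! ### Fluctuations within a layer -/

section Layer

variable {ι : Type*} [Fintype ι] [DecidableEq ι] {w : ι → ℝ} {n : ℕ}

lemma pairProb_swap {a b : ι} (hab : w a = w b) (u v : ι) :
    pairProb w n (Equiv.swap a b u) (Equiv.swap a b v) = pairProb w n u v := by
  unfold pairProb
  rw [← canonAvg_comp_swap hab]
  simp [occ]

/-- Sites of equal activity are exchangeable, and two transpositions carry any ordered pair of
distinct sites to any other. -/
lemma pairProb_congr {u v u' v' : ι} (huv : u ≠ v) (huv' : u' ≠ v') (h1 : w u = w v)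
    (h2 : w u = w u') (h3 : w u = w v') : pairProb w n u v = pairProb w n u' v' := by
  set v'' := Equiv.swap u u' v with hv''
  have hne : u' ≠ v'' := by
    intro h
    have : Equiv.swap u u' u = Equiv.swap u u' v := by rw [Equiv.swap_apply_left, ← hv'', h]
    exact huv ((Equiv.swap u u').injective this)
  have hw'' : w v'' = w u := by
    rw [hv'']
    by_cases hvu' : v = u'
    · rw [hvu', Equiv.swap_apply_right]
    · rw [Equiv.swap_apply_of_ne_of_ne huv.symm hvu', h1]
  rw [← pairProb_swap h2 u v, Equiv.swap_apply_left, ← hv'',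
    ← pairProb_swap (hw''.trans h3) u' v'', Equiv.swap_apply_of_ne_of_ne hne huv',
    Equiv.swap_apply_left]

lemma canonAvg_occ_mul_occ (u v : ι) : canonAvg w n (fun α => occ α u * occ α v) =
    density w n u - pairProb w n u v := by
  unfold density pairProb
  rw [← canonAvg_sub]
  congr 1; ext α; ring

lemma pairProb_self (u : ι) : pairProb w n u u = 0 := by
  unfold pairProb
  rw [canonAvg_congr (H := fun _ => 0 * 1), canonAvg_const_mul, zero_mul]
  intro α _
  rcases occ_eq α u with h | h <;> simp [h]

/-- Second moments of linear statistics of a layer. -/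
lemma canonAvg_linear_mul_linear {L : Finset ι} {c : ℝ} {ω : ℝ} (hL : ∀ x ∈ L, w x = ω)
    (hc : ∀ x ∈ L, ∀ y ∈ L, x ≠ y → pairProb w n x y = c) {a b : ι → ℝ} (ha : ∑ x ∈ L, a x = 0) :
    canonAvg w n (fun α => (∑ x ∈ L, a x * occ α x) * ∑ y ∈ L, b y * occ α y) =
      c * ∑ x ∈ L, a x * b x := by
  have e1 : ∀ α : ι → Fin 2, (∑ x ∈ L, a x * occ α x) * ∑ y ∈ L, b y * occ α y =
      ∑ x ∈ L, ∑ y ∈ L, (a x * b y) * (occ α x * occ α y) := by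
    intro α
    rw [Finset.sum_mul_sum]
    refine Finset.sum_congr rfl fun x _ => Finset.sum_congr rfl fun y _ => by ring
  simp only [e1]
  rw [canonAvg_sum]
  simp only [canonAvg_sum, canonAvg_const_mul, canonAvg_occ_mul_occ]
  rcases L.eq_empty_or_nonempty with rfl | ⟨z, hz⟩
  · simp
  -- Within the layer the matrix of second moments is a constant matrix with entries `ρ - c`, plus
  -- `c` times the identity. The constant part is killed by `∑ a = 0`.
  have e2 : ∀ x ∈ L, ∑ y ∈ L, a x * b y * (density w n x - pairProb w n x y) =
      a x * ((density w n z - c) * ∑ y ∈ L, b y) + c * (a x * b x) := by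
    intro x hx
    have : ∀ y ∈ L, a x * b y * (density w n x - pairProb w n x y) =
        a x * (density w n z - c) * b y + if y = x then c * (a x * b x) else 0 := by
      intro y hy
      rw [density_eq_of_eq ((hL x hx).trans (hL z hz).symm)]
      split_ifs with h
      · subst h; rw [pairProb_self]; ring
      · rw [hc x hx y hy (Ne.symm h)]; ring
    rw [Finset.sum_congr rfl this, Finset.sum_add_distrib, ← Finset.mul_sum, Finset.sum_ite_eq',
      if_pos hx]
    ring
  rw [Finset.sum_congr rfl e2, Finset.sum_add_distrib, ← Finset.sum_mul, ha, zero_mul, zero_add,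
    ← Finset.mul_sum]

lemma abs_canonAvg_le (hw : ∀ x, 0 < w x) (hZ : 0 < canonPart w n) {G : (ι → Fin 2) → ℝ} {C : ℝ}
    (hG : ∀ α, ∑ x, (α x : ℕ) = n → |G α| ≤ C) : |canonAvg w n G| ≤ C := by
  have hC : canonAvg w n (fun _ => C * 1) = C := by
    rw [canonAvg_const_mul, canonAvg_one hZ, mul_one]
  have hC' : canonAvg w n (fun _ => -C * 1) = -C := by
    rw [canonAvg_const_mul, canonAvg_one hZ, mul_one]
  rw [abs_le]
  constructor
  · rw [← hC']; exact canonAvg_mono hw fun α hα => by linarith [(abs_le.1 (hG α hα)).1]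
  · rw [← hC]; exact canonAvg_mono hw fun α hα => by linarith [(abs_le.1 (hG α hα)).2]

lemma abs_sum_mul_occ_le (L : Finset ι) (a : ι → ℝ) (α : ι → Fin 2) :
    |∑ x ∈ L, a x * occ α x| ≤ ∑ x ∈ L, |a x| := by
  refine (Finset.abs_sum_le_sum_abs _ _).trans (Finset.sum_le_sum fun x _ => ?_)
  rw [abs_mul]
  rcases occ_eq α x with h | h <;> simp [h]

/-- Lower bound for the correlation of a layer statistic with its sine. -/
lemma le_abs_canonAvg_mul_sin (hw : ∀ x, 0 < w x) (hZ : 0 < canonPart w n) {H F : (ι → Fin 2) → ℝ}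
    {A B V θ : ℝ} (hH : ∀ α, |H α| ≤ B) (hF : ∀ α, |F α| ≤ A)
    (hV : canonAvg w n (fun α => H α * F α) = V) :
    |θ| * V - |θ| ^ 3 * (B * A ^ 3) / 6 ≤ |canonAvg w n fun α => H α * Real.sin (θ * F α)| := by
  have h1 : canonAvg w n (fun α => H α * Real.sin (θ * F α)) =
      θ * V + canonAvg w n (fun α => H α * (Real.sin (θ * F α) - θ * F α)) := by
    rw [← hV, ← canonAvg_const_mul, ← canonAvg_add]
    congr 1; ext α; ring
  have h2 : |canonAvg w n (fun α => H α * (Real.sin (θ * F α) - θ * F α))| ≤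
      |θ| ^ 3 * (B * A ^ 3) / 6 := by
    refine abs_canonAvg_le hw hZ fun α _ => ?_
    have hB : 0 ≤ B := (abs_nonneg _).trans (hH α)
    have hle : |θ * F α| ≤ |θ| * A := by
      rw [abs_mul]; exact mul_le_mul_of_nonneg_left (hF α) (abs_nonneg _)
    rw [abs_mul]
    calc |H α| * |Real.sin (θ * F α) - θ * F α| ≤ B * ((|θ| * A) ^ 3 / 6) := by
          rw [abs_sub_comm]
          refine mul_le_mul (hH α) ((Real.abs_sub_sin_le _).trans ?_) (abs_nonneg _) hB
          have := pow_le_pow_left₀ (abs_nonneg _) hle 3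
          linarith
      _ = _ := by ring
  rw [h1]
  have h3 := abs_sub_abs_le_abs_add (θ * V) (canonAvg w n (fun α => H α * (Real.sin (θ * F α) - θ * F α)))
  have h4 : |θ| * V ≤ |θ * V| := by
    rw [abs_mul]; exact mul_le_mul_of_nonneg_left (le_abs_self V) (abs_nonneg _)
  linarith

end Layer

end XXZ

namespace XXZ

/-! ### Norm and energy of the excitation -/

section Excitation

variable {Λ : Finset Site} {q : ℝ} {n : ℕ}

/-- The phase collected outside a set of sites. -/
noncomputable def outerPhase (g : Site → ℝ) (L : Finset Λ) (α : Config Λ) : ℝ :=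
  ∑ x : Λ, g x * (1 - 2 * if x ∈ L then 0 else occ α x)

lemma totalPhase_sub_outerPhase (g : Site → ℝ) (L : Finset Λ) (α : Config Λ) :
    totalPhase g α - outerPhase g L α = -2 * ∑ x ∈ L, g x * occ α x := by
  unfold totalPhase outerPhase
  rw [← Finset.sum_sub_distrib, Finset.mul_sum, ← Finset.sum_filter_add_sum_filter_not _ (· ∈ L)]
  rw [Finset.sum_congr rfl (g := fun x : Λ => -2 * (g x * occ α x)),
    Finset.sum_eq_zero (s := Finset.univ.filter (¬ · ∈ L)), add_zero]
  · rw [Finset.filter_mem_eq_inter, Finset.univ_inter]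
  · intro x hx
    rw [if_neg (Finset.mem_filter.1 hx).2]; ring
  · intro x hx
    rw [if_pos (Finset.mem_filter.1 hx).2]; ring

lemma outerPhase_comp_swap (g : Site → ℝ) {L : Finset Λ} {u v : Λ} (hu : u ∈ L) (hv : v ∈ L)
    (α : Config Λ) : outerPhase g L (α ∘ Equiv.swap u v) = outerPhase g L α := by
  unfold outerPhase
  refine Finset.sum_congr rfl fun x _ => ?_
  by_cases hx : x ∈ L
  · rw [if_pos hx, if_pos hx]
  · have h1 : x ≠ u := fun h => hx (h ▸ hu)
    have h2 : x ≠ v := fun h => hx (h ▸ hv)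
    rw [if_neg hx, if_neg hx]
    simp [occ, Equiv.swap_apply_of_ne_of_ne h1 h2]

/-- A trial vector detecting the part of the twist inside the layer `L`. -/
noncomputable def trialState (q : ℝ) (n : ℕ) (g : Site → ℝ) (L : Finset Λ) (a : Λ → ℝ) : State Λ :=
  WithLp.toLp 2 fun α => Complex.exp (outerPhase g L α * Complex.I) *
    (((∑ x ∈ L, a x * occ α x) * amplitude q n α : ℝ) : ℂ)

lemma norm_sq_trialState (hZ : 0 < canonPart (activity q Λ) n) (g : Site → ℝ)
    (L : Finset Λ) (a : Λ → ℝ) : ‖trialState q n g L a‖ ^ 2 = canonPart (activity q Λ) n *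
      canonAvg (activity q Λ) n (fun α => (∑ x ∈ L, a x * occ α x) * ∑ x ∈ L, a x * occ α x) := by
  rw [canonAvg, mul_div_cancel₀ _ hZ.ne', EuclideanSpace.norm_sq_eq]
  refine Finset.sum_congr rfl fun α _ => ?_
  change ‖Complex.exp _ * _‖ ^ 2 = _
  rw [norm_mul, Complex.norm_exp_ofReal_mul_I, one_mul, Complex.norm_real, Real.norm_eq_abs,
    sq_abs, mul_pow, amplitude_sq]
  ring

lemma trialState_conj_apply (g : Site → ℝ) (L : Finset Λ) (a : Λ → ℝ) (α : Config Λ) :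
    (starRingEnd ℂ) (trialState q n g L a α) = Complex.exp (-(outerPhase g L α * Complex.I)) *
    (((∑ x ∈ L, a x * occ α x) * amplitude q n α : ℝ) : ℂ) := by
  change (starRingEnd ℂ) (Complex.exp _ * _) = _
  rw [map_mul, Complex.conj_ofReal, ← Complex.exp_conj, map_mul, Complex.conj_ofReal,
    Complex.conj_I, mul_neg]

/-- Both the outer phase and the canonical weight are unchanged by exchanging sites inside `L`.
Hence each site of `L` contributes the same number `K`, and the coefficients `a` sum to zero. -/
lemma inner_trialState_interfaceState (g : Site → ℝ) {L : Finset Λ} {ω : ℝ}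
    (hL : ∀ x ∈ L, activity q Λ x = ω) {a : Λ → ℝ} (ha : ∑ x ∈ L, a x = 0) :
    inner ℂ (trialState q n g L a) (interfaceState q Λ n) = 0 := by
  rcases L.eq_empty_or_nonempty with rfl | ⟨z, hz⟩
  · rw [PiLp.inner_apply]
    refine Finset.sum_eq_zero fun α _ => ?_
    rw [RCLike.inner_apply, trialState_conj_apply]; simp
  set K : Λ → ℂ := fun x => ∑ α : Config Λ, Complex.exp (-(outerPhase g L α * Complex.I)) *
    (occ α x : ℂ) * (canonWeight (activity q Λ) n α : ℂ) with hK
  have hconst : ∀ x ∈ L, K x = K z := by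
    intro x hx
    rw [hK]
    change ∑ α : Config Λ, _ = ∑ α : Config Λ, _
    rw [← sum_comp_swap x z]
    refine Finset.sum_congr rfl fun α _ => ?_
    rw [outerPhase_comp_swap g hx hz, canonWeight_comp_swap ((hL x hx).trans (hL z hz).symm)]
    simp [occ]
  have : inner ℂ (trialState q n g L a) (interfaceState q Λ n) = ∑ x ∈ L, (a x : ℂ) * K x := by
    rw [PiLp.inner_apply, hK]
    simp only [Finset.mul_sum]
    rw [Finset.sum_comm]
    refine Finset.sum_congr rfl fun α _ => ?_
    rw [RCLike.inner_apply, trialState_conj_apply, interfaceState_apply, ← amplitude_sq]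
    push_cast
    rw [Finset.sum_mul, Finset.mul_sum, Finset.mul_sum]
    refine Finset.sum_congr rfl fun x _ => by ring
  rw [this, Finset.sum_congr rfl fun x hx => by rw [hconst x hx], ← Finset.sum_mul,
    ← Complex.ofReal_sum, ha]
  simp

/-- The phase outside `L` cancels between the two vectors and leaves the twist of the layer alone.
The imaginary part isolates the odd, first-order response in `s`. -/
lemma inner_trialState_perturbedState_im (hZ : 0 < canonPart (activity q Λ) n) (R s : ℝ)
    {f : Site → ℝ} (hf : ∀ x, cutPhase R (besselPhase R s) x = s * f x) (L : Finset Λ) (a : Λ → ℝ) :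
    (inner ℂ (trialState q n (cutPhase R (besselPhase R s)) L a) (perturbedState q Λ n R s)).im =
      -(canonPart (activity q Λ) n * canonAvg (activity q Λ) n fun α =>
        (∑ x ∈ L, a x * occ α x) * Real.sin (2 * s * ∑ x ∈ L, f x * occ α x)) := by
  rw [canonAvg, mul_div_cancel₀ _ hZ.ne', PiLp.inner_apply, Complex.im_sum, ← Finset.sum_neg_distrib]
  refine Finset.sum_congr rfl fun α _ => ?_
  set g := cutPhase R (besselPhase R s)
  rw [RCLike.inner_apply, trialState_conj_apply, perturbedState_apply, ← amplitude_sq]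
  have e1 := totalPhase_sub_outerPhase g L α
  have e2 : ∑ x ∈ L, g x * occ α x = s * ∑ x ∈ L, f x * occ α x := by
    rw [Finset.mul_sum]
    refine Finset.sum_congr rfl fun x _ => by rw [hf]; ring
  rw [e2] at e1
  set F := ∑ x ∈ L, f x * occ α x
  set h := ∑ x ∈ L, a x * occ α x
  have e3 : Complex.exp (Complex.I * totalPhase g α) * (amplitude q n α : ℂ) *
      (Complex.exp (-(outerPhase g L α * Complex.I)) * ((h * amplitude q n α : ℝ) : ℂ)) =
      Complex.exp (((-(2 * s * F) : ℝ) : ℂ) * Complex.I) * ((amplitude q n α ^ 2 * h : ℝ) : ℂ) := by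
    have : ((-(2 * s * F) : ℝ) : ℂ) * Complex.I = Complex.I * totalPhase g α +
        -(outerPhase g L α * Complex.I) := by
      rw [show -(2 * s * F) = totalPhase g α - outerPhase g L α by rw [e1]; ring]
      push_cast; ring
    rw [this, Complex.exp_add]
    push_cast; ring
  rw [e3, Complex.im_mul_ofReal, Complex.exp_ofReal_mul_I_im, Real.sin_neg]
  ring

/-- The excitation is bounded below by the fluctuations of the twist in a single layer. -/
lemma le_norm_sq_excitation (hq : 0 < q) (hn : n ≤ Fintype.card Λ) (R s : ℝ) {f : Site → ℝ}
    (hf : ∀ x, cutPhase R (besselPhase R s) x = s * f x) {L : Finset Λ} (hL0 : L.Nonempty) {ω : ℝ}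
    (hL : ∀ x ∈ L, activity q Λ x = ω) {c : ℝ}
    (hc : ∀ x ∈ L, ∀ y ∈ L, x ≠ y → pairProb (activity q Λ) n x y = c) {A V : ℝ}
    (hA : ∑ x ∈ L, |f x| = A)
    (hV : V = c * (∑ x ∈ L, f x ^ 2 - (∑ x ∈ L, f x) ^ 2 / L.card))
    (hY : 0 ≤ |2 * s| * V - |2 * s| ^ 3 * (2 * A * A ^ 3) / 6) :
    canonPart (activity q Λ) n * (|2 * s| * V - |2 * s| ^ 3 * (2 * A * A ^ 3) / 6) ^ 2 ≤
      V * ‖excitation q Λ n R s‖ ^ 2 := by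
  have hw := activity_pos (Λ := Λ) hq
  have hZ := canonPart_pos hw hn
  have hM : (0 : ℝ) < L.card := by exact_mod_cast hL0.card_pos
  set S := ∑ x ∈ L, f x with hS
  -- Centring gives orthogonality to the interface state, and it makes the variance of the trial
  -- statistic equal to its covariance with the twist.
  set a : Λ → ℝ := fun x => f x - S / L.card with ha
  have ha0 : ∑ x ∈ L, a x = 0 := by
    rw [ha, Finset.sum_sub_distrib, Finset.sum_const, nsmul_eq_mul, mul_div_cancel₀ _ hM.ne',
      ← hS, sub_self]
  have haf : ∑ x ∈ L, a x * f x = ∑ x ∈ L, f x ^ 2 - S ^ 2 / L.card := by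
    have : ∀ x ∈ L, a x * f x = f x ^ 2 - S / L.card * f x := by
      intro x _; rw [ha]; ring
    rw [Finset.sum_congr rfl this, Finset.sum_sub_distrib, ← Finset.mul_sum, ← hS]; ring
  have haa : ∑ x ∈ L, a x * a x = ∑ x ∈ L, f x ^ 2 - S ^ 2 / L.card := by
    have : ∀ x ∈ L, a x * a x = a x * f x - a x * (S / L.card) := by
      intro x _; rw [ha]; ring
    rw [Finset.sum_congr rfl this, Finset.sum_sub_distrib, ← Finset.sum_mul, ha0, haf]; ring
  have hA0 : 0 ≤ A := hA ▸ Finset.sum_nonneg fun _ _ => abs_nonneg _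
  have haA : ∑ x ∈ L, |a x| ≤ 2 * A := by
    have h1 : ∀ x ∈ L, |a x| ≤ |f x| + A / L.card := by
      intro x _
      refine (abs_sub _ _).trans (add_le_add_right ?_ _)
      rw [abs_div, Nat.abs_cast]
      refine div_le_div_of_nonneg_right ?_ hM.le
      rw [← hA]
      exact Finset.abs_sum_le_sum_abs _ _
    refine (Finset.sum_le_sum h1).trans ?_
    rw [Finset.sum_add_distrib, hA, Finset.sum_const, nsmul_eq_mul, mul_div_cancel₀ _ hM.ne']
    linarith
  have hVf := canonAvg_linear_mul_linear hL hc (b := fun x : Λ => f x) ha0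
  have hVa := canonAvg_linear_mul_linear hL hc (b := a) ha0
  rw [haf, ← hV] at hVf
  rw [haa, ← hV] at hVa
  have key := le_abs_canonAvg_mul_sin hw hZ
    (H := fun α => ∑ x ∈ L, a x * occ α x) (F := fun α => ∑ x ∈ L, f x * occ α x)
    (A := A) (B := 2 * A) (θ := 2 * s)
    (fun α => (abs_sum_mul_occ_le L a α).trans haA)
    (fun α => (abs_sum_mul_occ_le L (fun x : Λ => f x) α).trans hA.le) hVf
  set g := cutPhase R (besselPhase R s)
  set η := trialState q n g L a
  have hη := norm_sq_trialState (q := q) (n := n) hZ g L a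
  rw [hVa] at hη
  have horth := inner_trialState_interfaceState (q := q) (n := n) g hL ha0
  have him := inner_trialState_perturbedState_im (n := n) hZ R s hf L a
  have hχ : inner ℂ η (excitation q Λ n R s) = inner ℂ η (perturbedState q Λ n R s) := by
    unfold excitation
    rw [inner_sub_right, inner_smul_right, horth, mul_zero, sub_zero]
  -- Cauchy-Schwarz against the trial vector, which does not see the subtracted multiple of `ψ₀`.
  have hcs := norm_inner_le_norm (𝕜 := ℂ) η (excitation q Λ n R s)
  rw [hχ] at hcs
  have h1 := (Complex.abs_im_le_norm _).trans hcs
  rw [him, abs_neg, abs_mul, abs_of_pos hZ] at h1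
  set Z := canonPart (activity q Λ) n
  have h2 := (mul_le_mul_of_nonneg_left key hZ.le).trans h1
  have h3 := pow_le_pow_left₀ (mul_nonneg hZ.le hY) h2 2
  rw [mul_pow (‖η‖), hη, mul_pow] at h3
  refine le_of_mul_le_mul_left ?_ hZ
  linarith

/-- The energy of the excitation, when the squared differences of the phases across the bonds
leaving any layer sum to at most `D`. -/
lemma energy_excitation_le (hq : 0 < q) (hq1 : q < 1) (hn : n ≤ Fintype.card Λ) (R s : ℝ)
    {f : Site → ℝ} (hf : ∀ x, cutPhase R (besselPhase R s) x = s * f x) {r : ℤ → ℝ}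
    (hr : Antitone r) (hr0 : ∀ l, 0 ≤ r l) (hr1 : ∀ l, r l ≤ 1)
    (hdens : ∀ x : Λ, density (activity q Λ) n x = r (height x)) {D : ℝ} (hD0 : 0 ≤ D)
    (hD : ∀ l : ℤ, ∑ b : Λ × Λ with IsBond b.1 b.2 ∧ height b.1 = l, (f b.1 - f b.2) ^ 2 ≤ D) :
    ∑ b : Λ × Λ with IsBond b.1 b.2, bondEnergy q b.1 b.2 (perturbedState q Λ n R s) ≤
      4 * s ^ 2 * (q ^ 2 / ((1 - q ^ 2) * (1 + q ^ 2))) * D * canonPart (activity q Λ) n := by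
  have hw := activity_pos (Λ := Λ) hq
  have hZ := canonPart_pos hw hn
  have hq2 : 0 < 1 - q ^ 2 := by nlinarith
  set Z := canonPart (activity q Λ) n
  set K := 4 * s ^ 2 * (q ^ 2 / ((1 - q ^ 2) * (1 + q ^ 2))) * Z with hK
  have hK0 : 0 ≤ K := by positivity
  have h1 : ∀ b ∈ (Finset.univ : Finset (Λ × Λ)).filter (fun b => IsBond b.1 b.2),
      bondEnergy q b.1 b.2 (perturbedState q Λ n R s) ≤
        K * ((f b.1 - f b.2) ^ 2 * (r (height b.1) - r (height b.1 + 1))) := by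
    intro b hb
    have hh := (Finset.mem_filter.1 hb).2.2
    refine (bondEnergy_perturbedState_le hq R s hh).trans (le_of_eq ?_)
    have e1 : ∑ α, canonWeight (activity q Λ) n α * (occ α b.1 * (1 - occ α b.2)) =
        Z * pairProb (activity q Λ) n b.1 b.2 := by
      rw [pairProb, canonAvg, mul_div_cancel₀ _ hZ.ne']
    -- Let `P` be the probability that the lower site is occupied and the upper one empty. The
    -- reversed event has probability `q² P` and the difference of the two is the density drop, so
    -- `P = (r l - r (l + 1)) / (1 - q²)`.
    have e2 := mul_pairProb (n := n) hw b.1 b.2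
    have e3 := pairProb_sub (w := activity q Λ) (n := n) b.1 b.2
    rw [hdens, hdens, hh] at e3
    have e4 : activity q Λ b.2 = q ^ 2 * activity q Λ b.1 := by
      unfold activity
      rw [hh, mul_add, zpow_add₀ hq.ne', mul_comm]; norm_cast
    rw [e4] at e2
    have e5 : pairProb (activity q Λ) n b.2 b.1 = q ^ 2 * pairProb (activity q Λ) n b.1 b.2 :=
      mul_left_cancel₀ (hw b.1).ne' (by linarith)
    rw [e1, hf, hf, ← e3, e5, hK]
    field_simp
  refine (Finset.sum_le_sum h1).trans ?_
  rw [← Finset.mul_sum]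
  have h2 : ∑ b : Λ × Λ with IsBond b.1 b.2,
      (f b.1 - f b.2) ^ 2 * (r (height b.1) - r (height b.1 + 1)) ≤ D := by
    obtain ⟨N, hN⟩ : ∃ N : ℕ, ∀ x : Λ, height x ∈ Finset.Ico (-(N : ℤ)) N := by
      refine ⟨(∑ x : Λ, (height x).natAbs) + 1, fun x => ?_⟩
      have := Finset.single_le_sum (f := fun x : Λ => (height x).natAbs) (fun _ _ => Nat.zero_le _)
        (Finset.mem_univ x)
      simp only [Finset.mem_Ico]
      push_cast
      zify at this
      constructor <;> rcases abs_cases (height (x : Site)) with h | h <;> omega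
    rw [← Finset.sum_fiberwise_of_maps_to (g := fun b : Λ × Λ => height b.1)
      (t := Finset.Ico (-(N : ℤ)) N) fun b _ => hN b.1]
    have h3 : ∀ l ∈ Finset.Ico (-(N : ℤ)) N,
        ∑ b ∈ (Finset.univ.filter fun b : Λ × Λ => IsBond b.1 b.2) with height b.1 = l,
          (f b.1 - f b.2) ^ 2 * (r (height b.1) - r (height b.1 + 1)) ≤
        D * (r l - r (l + 1)) := by
      intro l _
      rw [Finset.filter_filter]
      have : ∀ b ∈ (Finset.univ.filter fun b : Λ × Λ => IsBond b.1 b.2 ∧ height b.1 = l),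
          (f b.1 - f b.2) ^ 2 * (r (height b.1) - r (height b.1 + 1)) =
          (f b.1 - f b.2) ^ 2 * (r l - r (l + 1)) := by
        intro b hb
        rw [(Finset.mem_filter.1 hb).2.2]
      rw [Finset.sum_congr rfl this, ← Finset.sum_mul]
      exact mul_le_mul_of_nonneg_right (hD l) (sub_nonneg.2 (hr (by omega)))
    refine (Finset.sum_le_sum h3).trans ?_
    rw [← Finset.mul_sum]
    -- The density drops telescope over all heights, and their total is at most 1.
    have h4 : ∀ m : ℕ, ∑ l ∈ Finset.Ico (-(N : ℤ)) (-N + m), (r l - r (l + 1)) = r (-N) - r (-N + m) := by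
      intro m
      induction m with
      | zero => simp
      | succ m ih =>
        have : Finset.Ico (-(N : ℤ)) (-N + (m + 1 : ℕ)) =
            insert (-N + m : ℤ) (Finset.Ico (-(N : ℤ)) (-N + m)) := by
          ext z; simp only [Finset.mem_Ico, Finset.mem_insert]; push_cast; omega
        rw [this, Finset.sum_insert (by simp), ih]
        push_cast
        ring_nf
    have h5 := h4 (2 * N)
    rw [show (-(N : ℤ) + (2 * N : ℕ)) = N by push_cast; ring] at h5
    rw [h5]
    have := hr0 N
    have := hr1 (-N)
    nlinarith
  calc K * _ ≤ K * D := mul_le_mul_of_nonneg_left h2 hK0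
    _ = _ := by rw [hK]; ring

end Excitation

end XXZ

namespace XXZ

/-! ### The grand canonical mean and cylindrical volumes -/

section GrandCanonical

lemma sum_prod_pow {ι : Type*} [Fintype ι] [DecidableEq ι] (a : ι → ℝ) :
    ∑ α : ι → Fin 2, ∏ x, a x ^ (α x : ℕ) = ∏ x, (1 + a x) := by
  have h1 : ∀ x, 1 + a x = ∑ c : Fin 2, a x ^ (c : ℕ) := by intro x; simp [Fin.sum_univ_two]
  simp only [h1]
  rw [Finset.prod_univ_sum, Fintype.piFinset_univ]

lemma sum_occ_mul_prod_pow {ι : Type*} [Fintype ι] [DecidableEq ι] {a : ι → ℝ}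
    (ha : ∀ x, 0 < a x) (z : ι) :
    ∑ α : ι → Fin 2, occ α z * ∏ x, a x ^ (α x : ℕ) = a z / (1 + a z) * ∏ x, (1 + a x) := by
  have h1 : ∀ x, (if x = z then a x / (1 + a x) else 1) * (1 + a x) =
      ∑ c : Fin 2, (if x = z then ((c : ℕ) : ℝ) else 1) * a x ^ (c : ℕ) := by
    intro x
    have := ha x
    split_ifs
    · simp [Fin.sum_univ_two]; field_simp
    · simp [Fin.sum_univ_two]
  have h2 : a z / (1 + a z) * ∏ x, (1 + a x) =
      ∏ x, (if x = z then a x / (1 + a x) else 1) * (1 + a x) := by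
    rw [Finset.prod_mul_distrib, Finset.prod_ite_eq' Finset.univ z fun x => a x / (1 + a x)]
    simp
  rw [h2]
  simp only [h1]
  rw [Finset.prod_univ_sum, Fintype.piFinset_univ]
  refine Finset.sum_congr rfl fun α _ => ?_
  rw [Finset.prod_mul_distrib, Finset.prod_ite_eq' Finset.univ z fun x => ((α x : ℕ) : ℝ)]
  simp [occ]

variable {Λ : Finset Site} {q : ℝ}

/-- The squared amplitudes form a product measure with site activities `z w_x`, where `z = q ^ (-2
μ)`. This identifies the fugacity used in the comparison of ensembles. -/
lemma expect_numberOp_grandCanonicalState (hq : 0 < q) (μ : ℝ) :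
    expect (numberOp Λ) (grandCanonicalState q Λ μ) =
      ∑ x : Λ, q ^ (-2 * μ) * activity q Λ x / (1 + q ^ (-2 * μ) * activity q Λ x) := by
  set a : Λ → ℝ := fun x => q ^ (-2 * μ) * activity q Λ x with ha
  have ha0 : ∀ x, 0 < a x := fun x => mul_pos (Real.rpow_pos_of_pos hq _) (activity_pos hq x)
  have hsq : ∀ α : Config Λ, ‖grandCanonicalState q Λ μ α‖ ^ 2 = ∏ x, a x ^ (α x : ℕ) := by
    intro α
    change ‖((∏ x : Λ, q ^ (((height x : ℝ) - μ) * (α x : ℕ)) : ℝ) : ℂ)‖ ^ 2 = _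
    rw [Complex.norm_real, Real.norm_eq_abs, sq_abs, ← Finset.prod_pow]
    refine Finset.prod_congr rfl fun x _ => ?_
    simp only [ha, activity]
    rw [← Real.rpow_intCast, ← Real.rpow_add hq, ← Real.rpow_natCast, ← Real.rpow_natCast,
      ← Real.rpow_mul hq.le, ← Real.rpow_mul hq.le]
    congr 1
    push_cast; ring
  have hnum : (inner ℂ (grandCanonicalState q Λ μ) (app (numberOp Λ) (grandCanonicalState q Λ μ))).re
      = ∑ α : Config Λ, (∑ x, occ α x) * ∏ x, a x ^ (α x : ℕ) := by
    rw [inner_app, Complex.re_sum]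
    refine Finset.sum_congr rfl fun α _ => ?_
    rw [← hsq, numberOp, Matrix.mulVec_diagonal]
    have e : (starRingEnd ℂ) (grandCanonicalState q Λ μ α) *
        ((particles α : ℂ) * grandCanonicalState q Λ μ α) =
        (((∑ x, occ α x) * ‖grandCanonicalState q Λ μ α‖ ^ 2 : ℝ) : ℂ) := by
      push_cast
      rw [← Complex.conj_mul']
      unfold particles occ
      push_cast; ring
    have := congrArg Complex.re e
    rwa [Complex.ofReal_re] at this
  have hden : ‖grandCanonicalState q Λ μ‖ ^ 2 = ∏ x, (1 + a x) := by
    rw [EuclideanSpace.norm_sq_eq, ← sum_prod_pow]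
    exact Finset.sum_congr rfl fun α _ => hsq α
  unfold expect
  rw [hnum, hden]
  simp only [Finset.sum_mul]
  rw [Finset.sum_comm]
  simp only [sum_occ_mul_prod_pow ha0]
  rw [← Finset.sum_mul, mul_div_cancel_right₀]
  exact (Finset.prod_pos fun x _ => add_pos one_pos (ha0 x)).ne'

lemma particle_number_bounds (hq : 0 < q) (hΛ : Λ.Nonempty) {n : ℕ} {μ : ℝ}
    (hn : expect (numberOp Λ) (grandCanonicalState q Λ μ) = n) :
    0 < n ∧ n < Fintype.card Λ := by
  rw [expect_numberOp_grandCanonicalState hq] at hn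
  have ha0 : ∀ x : Λ, 0 < q ^ (-2 * μ) * activity q Λ x :=
    fun x => mul_pos (Real.rpow_pos_of_pos hq _) (activity_pos hq x)
  have hne : (Finset.univ : Finset Λ).Nonempty := by
    obtain ⟨x, hx⟩ := hΛ
    exact ⟨⟨x, hx⟩, Finset.mem_univ _⟩
  constructor
  · have : (0 : ℝ) < n := by
      rw [← hn]
      exact Finset.sum_pos (fun x _ => div_pos (ha0 x) (add_pos one_pos (ha0 x))) hne
    exact_mod_cast this
  · have : (n : ℝ) < Fintype.card Λ := by
      rw [← hn]
      calc _ < ∑ _x : Λ, (1 : ℝ) := Finset.sum_lt_sum_of_nonempty hne fun x _ => by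
            rw [div_lt_one (add_pos one_pos (ha0 x))]; linarith
        _ = _ := by simp
    exact_mod_cast this

end GrandCanonical

/-! ### Layers of a cylindrical volume. -/

section Cylinder

lemma height_add (x y : Site) : height (x + y) = height x + height y := by
  simp [height]; ring

lemma height_stick (l : ℤ) : height (stick l) = l := by
  simp only [height, stick, Matrix.cons_val_zero, Matrix.cons_val_one, Matrix.cons_val]
  split_ifs <;> omega

variable {Γ : Finset Site} {h : ℕ}

lemma mem_cylinder (hΓ : ∀ x ∈ Γ, height x = 0) {x : Site} : x ∈ cylinder Γ h ↔
    height x ∈ Finset.Icc (-(h : ℤ)) h ∧ ∃ g ∈ Γ, x = g + stick (height x) := by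
  unfold cylinder
  rw [Finset.mem_image]
  constructor
  · rintro ⟨⟨g, l⟩, hp, rfl⟩
    rw [Finset.mem_product] at hp
    have : height (g + stick l) = l := by rw [height_add, height_stick, hΓ g hp.1, zero_add]
    rw [this]
    exact ⟨hp.2, g, hp.1, rfl⟩
  · rintro ⟨hl, g, hg, hx⟩
    exact ⟨(g, height x), Finset.mem_product.2 ⟨hg, hl⟩, hx.symm⟩

lemma add_stick_mem_cylinder (hΓ : ∀ x ∈ Γ, height x = 0) {g : Site} (hg : g ∈ Γ) {l : ℤ}
    (hl : l ∈ Finset.Icc (-(h : ℤ)) h) : g + stick l ∈ cylinder Γ h := by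
  have : height (g + stick l) = l := by rw [height_add, height_stick, hΓ g hg, zero_add]
  rw [mem_cylinder hΓ, this]
  exact ⟨hl, g, hg, rfl⟩

lemma card_le_card_layer (hΓ : ∀ x ∈ Γ, height x = 0) {l : ℤ} (hl : l ∈ Finset.Icc (-(h : ℤ)) h) :
    Γ.card ≤ (Finset.univ.filter fun x : cylinder Γ h => height x = l).card := by
  rw [← Finset.card_image_of_injective Γ (add_left_injective (stick l)),
    ← Finset.card_image_of_injective (Finset.univ.filter fun x : cylinder Γ h => height x = l)
      Subtype.val_injective]
  refine Finset.card_le_card fun x hx => ?_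
  obtain ⟨g, hg, rfl⟩ := Finset.mem_image.1 hx
  refine Finset.mem_image.2 ⟨⟨g + stick l, add_stick_mem_cylinder hΓ hg hl⟩, ?_, rfl⟩
  simp [height_add, height_stick, hΓ g hg]

/-- Densities in a cylinder form a monotone profile of the height. -/
lemma exists_density_profile {q : ℝ} (hq : 0 < q) (hq1 : q < 1) (hΓ : ∀ x ∈ Γ, height x = 0)
    (hne : Γ.Nonempty) {n : ℕ} (hn : n ≤ Fintype.card (cylinder Γ h)) :
    ∃ r : ℤ → ℝ, Antitone r ∧ (∀ l, 0 ≤ r l) ∧ (∀ l, r l ≤ 1) ∧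
      ∀ x : cylinder Γ h, density (activity q (cylinder Γ h)) n x = r (height x) := by
  obtain ⟨g, hg⟩ := hne
  have hw := activity_pos (Λ := cylinder Γ h) hq
  have hZ := canonPart_pos hw hn
  have hcl : ∀ l : ℤ, max (-(h : ℤ)) (min h l) ∈ Finset.Icc (-(h : ℤ)) h := by
    intro l; rw [Finset.mem_Icc]; omega
  -- Clamping the height extends the profile constantly above and below the cylinder, so
  -- monotonicity holds on all of `ℤ`.
  set p : ℤ → cylinder Γ h := fun l =>
    ⟨g + stick (max (-(h : ℤ)) (min h l)), add_stick_mem_cylinder hΓ hg (hcl l)⟩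
  have hp : ∀ l, height (p l) = max (-(h : ℤ)) (min h l) := by
    intro l
    change height (g + stick _) = _
    rw [height_add, height_stick, hΓ g hg, zero_add]
  refine ⟨fun l => density (activity q (cylinder Γ h)) n (p l), ?_, fun l => density_nonneg hw _,
    fun l => density_le_one hw hZ _, ?_⟩
  · intro a b hab
    refine density_mono hw ?_
    unfold activity
    refine zpow_le_zpow_right_of_le_one₀ hq hq1.le ?_
    rw [hp, hp]
    omega
  · intro x
    refine density_eq_of_eq ?_
    unfold activity
    have := ((mem_cylinder hΓ).1 x.2).1
    rw [Finset.mem_Icc] at this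
    rw [hp]
    congr 2
    omega

/-- Two-point functions of a layer in a cylinder. -/
lemma le_pairProb_cylinder {q : ℝ} (hq : 0 < q) (hq1 : q < 1) (hΓ : ∀ x ∈ Γ, height x = 0)
    {n : ℕ} {μ : ℝ}
    (hn : expect (numberOp (cylinder Γ h)) (grandCanonicalState q (cylinder Γ h) μ) = n)
    (hcard : 1 < ((Γ.card : ℝ) - 1) * (q ^ 2 / 2)) {u v : cylinder Γ h} (huv : u ≠ v)
    (hh : height u = height v) :
    (1 - 1 / (((Γ.card : ℝ) - 1) * (q ^ 2 / 2))) ^ 6 *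
      (q ^ (2 * (height u - μ)) / (1 + q ^ (2 * (height u - μ))) ^ 2) ≤
      pairProb (activity q (cylinder Γ h)) n u v := by
  have hw := activity_pos (Λ := cylinder Γ h) hq
  obtain ⟨hn0, hn1⟩ := particle_number_bounds hq ⟨u, u.2⟩ hn
  have hq2 : 0 < q ^ 2 / 2 := by positivity
  have hm : 0 < (Γ.card : ℝ) - 1 := by
    by_contra hle
    nlinarith
  rw [expect_numberOp_grandCanonicalState hq] at hn
  have hact : ∀ x y : cylinder Γ h, height x = height y →
      activity q (cylinder Γ h) x = activity q (cylinder Γ h) y := by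
    intro x y hxy; unfold activity; rw [hxy]
  have hz : q ^ (-2 * μ) * activity q (cylinder Γ h) u = q ^ (2 * (height u - μ)) := by
    rw [activity, ← Real.rpow_intCast, ← Real.rpow_add hq]
    congr 1; push_cast; ring
  rw [← hz]
  -- Each layer has at least `Γ.card` sites, one of which may be excluded: hence `m = Γ.card - 1`.
  -- The threshold is `τ = q² / 2`.
  refine le_pairProb_of_sum_eq hw hn0 hn1 hm hq2 hcard ?_
    (exists_intermediate_density hw hn0 hn1 hq hq1 (fun x => height x) (fun x => rfl) ?_)
    (Real.rpow_pos_of_pos hq _) hn huv (hact u v hh)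
  · intro a b
    have h1 := card_le_card_layer hΓ ((mem_cylinder hΓ).1 b.2).1
    have h2 : ((Finset.univ.filter fun x : cylinder Γ h => height x = height b).erase a).card ≤
        (Finset.univ.filter fun x : cylinder Γ h =>
          activity q (cylinder Γ h) x = activity q (cylinder Γ h) b ∧ x ≠ a).card := by
      refine Finset.card_le_card fun x hx => ?_
      rw [Finset.mem_erase, Finset.mem_filter] at hx
      exact Finset.mem_filter.2 ⟨Finset.mem_univ _, hact _ _ hx.2.2, hx.1⟩
    have h3 := Finset.pred_card_le_card_erase
      (s := Finset.univ.filter fun x : cylinder Γ h => height x = height b) (a := a)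
    have h4 : Γ.card ≤ (Finset.univ.filter fun x : cylinder Γ h =>
          activity q (cylinder Γ h) x = activity q (cylinder Γ h) b ∧ x ≠ a).card + 1 := by omega
    have : (Γ.card : ℝ) ≤ (Finset.univ.filter fun x : cylinder Γ h =>
          activity q (cylinder Γ h) x = activity q (cylinder Γ h) b ∧ x ≠ a).card + 1 := by
      exact_mod_cast h4
    linarith
  · intro a b hab
    obtain ⟨hl, g, hg, -⟩ := (mem_cylinder hΓ).1 a.2
    have hb := ((mem_cylinder hΓ).1 b.2).1
    rw [Finset.mem_Icc] at hl hb
    refine ⟨⟨g + stick (height a + 1), add_stick_mem_cylinder hΓ hg ?_⟩, ?_⟩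
    · rw [Finset.mem_Icc]; omega
    · simp [height_add, height_stick, hΓ g hg]

/-- The stick passes through the origin at height 0, so the sites of the cylinder in the plane `l =
0` belong to the base. Exhaustion puts arbitrarily many of them there. -/
lemma eventually_card_ge {Γ : ℕ → Finset Site} (hΓ : ∀ k, ∀ x ∈ Γ k, height x = 0) {h : ℕ → ℕ}
    (hexh : ∀ x : Site, ∀ᶠ k in atTop, x ∈ cylinder (Γ k) (h k)) (N : ℕ) :
    ∀ᶠ k in atTop, N ≤ (Γ k).card := by
  set e : ℕ → Site := fun i => ![(i : ℤ), -i, 0]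
  have he : Function.Injective e := by
    intro i j hij
    have := congrFun hij 0
    simpa [e] using this
  have hall : ∀ᶠ k in atTop, ∀ i ∈ Finset.range N, e i ∈ cylinder (Γ k) (h k) :=
    (Filter.eventually_all_finset _).2 fun i _ => hexh (e i)
  filter_upwards [hall] with k hk
  have : (Finset.range N).image e ⊆ Γ k := by
    intro x hx
    obtain ⟨i, hi, rfl⟩ := Finset.mem_image.1 hx
    obtain ⟨-, g, hg, hgx⟩ := (mem_cylinder (hΓ k)).1 (hk i hi)
    have h0 : height (e i) = 0 := by simp [height, e]
    have hs : stick 0 = 0 := by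
      funext j; fin_cases j <;> simp [stick]
    rw [h0, hs, add_zero] at hgx
    rwa [hgx]
  calc N = ((Finset.range N).image e).card := by
        rw [Finset.card_image_of_injective _ he, Finset.card_range]
    _ ≤ _ := Finset.card_le_card this

end Cylinder

end XXZ

namespace XXZ

/-! ### The Bessel function up to its first zero -/

section Bessel

/-- The coefficients of the alternating series of `J₁`. -/
noncomputable def besselTerm (t : ℝ) (j : ℕ) : ℝ :=
  (t / 2) ^ (2 * j + 1) / ((j.factorial : ℝ) * (j + 1).factorial)

/-- The Bessel function `J₁`. -/
noncomputable def besselJ1 (t : ℝ) : ℝ := ∑' j : ℕ, (-1) ^ j * besselTerm t j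

lemma summable_besselTerm (t : ℝ) : Summable fun j : ℕ => (-1) ^ j * besselTerm t j := by
  have h := (Real.summable_pow_div_factorial ((t / 2) ^ 2)).mul_left |t / 2|
  refine Summable.of_norm_bounded h fun j => ?_
  have h1 : (1 : ℝ) ≤ (j + 1).factorial := by exact_mod_cast Nat.succ_le_of_lt (Nat.factorial_pos _)
  have h0 : (0 : ℝ) < j.factorial := by exact_mod_cast Nat.factorial_pos _
  rw [norm_mul, norm_pow, norm_neg, norm_one, one_pow, one_mul, besselTerm, norm_div, norm_pow,
    Real.norm_eq_abs, Real.norm_of_nonneg (by positivity), pow_succ, pow_mul, sq_abs,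
    mul_comm (_ ^ j), mul_div_assoc]
  gcongr
  nlinarith

lemma hasDerivAt_besselJ0 (t : ℝ) : HasDerivAt besselJ0 (-besselJ1 t) t := by
  set B := |t| + 1 with hB
  have hB0 : 0 < B := by positivity
  set g : ℕ → ℝ → ℝ := fun m y => (-1) ^ m / (m.factorial : ℝ) ^ 2 * (y / 2) ^ (2 * m) with hg
  set g' : ℕ → ℝ → ℝ := fun m y =>
    (-1) ^ m / (m.factorial : ℝ) ^ 2 * ((2 * m : ℕ) * (y / 2) ^ (2 * m - 1) * (1 / 2)) with hg'
  have e0 : ∀ y, g' 0 y = 0 := by intro y; simp [hg']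
  have e1 : ∀ j y, g' (j + 1) y = -((-1) ^ j * besselTerm y j) := by
    intro j y
    have h0 : (0 : ℝ) < j.factorial := by exact_mod_cast Nat.factorial_pos _
    simp only [hg', besselTerm]
    rw [show 2 * (j + 1) - 1 = 2 * j + 1 by omega, Nat.factorial_succ]
    push_cast
    field_simp
    ring
  have hder : ∀ m y, HasDerivAt (g m) (g' m y) y := by
    intro m y
    have := (((hasDerivAt_id y).div_const 2).pow (2 * m)).const_mul ((-1) ^ m / (m.factorial : ℝ) ^ 2)
    simpa [hg, hg', mul_assoc] using this
  -- Termwise differentiation on the ball of radius `|t| + 1`: the constant term drops out, and the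
  -- others are dominated by the `J₁` terms at the radius.
  set u : ℕ → ℝ := fun m => if m = 0 then 0 else besselTerm B (m - 1)
  have hsumm : Summable u := by
    rw [← summable_nat_add_iff 1]
    refine (summable_besselTerm B).abs.congr fun j => ?_
    have : 0 ≤ besselTerm B j := by unfold besselTerm; positivity
    simp [u, abs_mul, abs_of_nonneg this]
  have hbd : ∀ m y, y ∈ Metric.ball (0 : ℝ) B → ‖g' m y‖ ≤ u m := by
    intro m y hy
    rw [mem_ball_zero_iff, Real.norm_eq_abs] at hy
    rcases m with _ | j
    · rw [e0]; simp [u]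
    · rw [e1, norm_neg, norm_mul, norm_pow, norm_neg, norm_one, one_pow, one_mul]
      simp only [u, besselTerm]
      rw [norm_div, norm_pow, Real.norm_of_nonneg (r := (j.factorial : ℝ) * _) (by positivity)]
      simp only [Nat.add_eq_zero_iff, one_ne_zero, and_false, if_false, add_tsub_cancel_right]
      gcongr
      rw [norm_div, Real.norm_eq_abs, Real.norm_of_nonneg (r := (2 : ℝ)) (by norm_num)]
      linarith
  have hs0 : Summable fun m => g m 0 := by
    refine summable_of_ne_finset_zero (s := {0}) fun m hm => ?_
    have : m ≠ 0 := by simpa using hm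
    simp [hg, this]
  have main := hasDerivAt_tsum_of_isPreconnected hsumm Metric.isOpen_ball
    (convex_ball (0 : ℝ) B).isPreconnected (fun m y _ => hder m y) hbd
    (Metric.mem_ball_self hB0) hs0 (y := t) (by
      rw [mem_ball_zero_iff, Real.norm_eq_abs, hB]; linarith)
  have hsum' : Summable fun m => g' m t := Summable.of_norm_bounded hsumm fun m => hbd m t (by
      rw [mem_ball_zero_iff, Real.norm_eq_abs, hB]; linarith)
  rw [hsum'.tsum_eq_zero_add, e0, zero_add] at main
  simp only [e1] at main
  rw [tsum_neg] at main
  exact main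

lemma continuous_besselJ0 : Continuous besselJ0 :=
  continuous_iff_continuousAt.2 fun t => (hasDerivAt_besselJ0 t).continuousAt

/-- The ratio of consecutive terms is `(t/2)² / ((j+1)(j+2))`, already below 1 for `j = 0` on this
range. The endpoint `2.41` lies just above the first zero of `J₀`. -/
lemma antitone_besselTerm {t : ℝ} (h0 : 0 ≤ t) (h1 : t ≤ 241 / 100) : Antitone (besselTerm t) := by
  refine antitone_nat_of_succ_le fun j => ?_
  have hj : (0 : ℝ) < j.factorial := by exact_mod_cast Nat.factorial_pos _
  unfold besselTerm
  rw [Nat.factorial_succ (j + 1), Nat.factorial_succ j, div_le_div_iff₀ (by positivity) (by positivity)]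
  push_cast
  rw [show 2 * (j + 1) + 1 = 2 * j + 1 + 2 by ring, pow_add]
  have hv : (t / 2) ^ 2 ≤ 2 := by nlinarith
  have hp : 0 ≤ (t / 2) ^ (2 * j + 1) := by positivity
  have hjj : (2 : ℝ) ≤ ((j : ℝ) + 1) * (j + 1 + 1) := by
    have : (0 : ℝ) ≤ j := Nat.cast_nonneg j
    nlinarith
  have : (t / 2) ^ 2 ≤ ((j : ℝ) + 1) * (j + 1 + 1) := hv.trans hjj
  calc (t / 2) ^ (2 * j + 1) * (t / 2) ^ 2 * (j.factorial * ((j + 1) * j.factorial))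
      = (t / 2) ^ (2 * j + 1) * (j.factorial * ((j + 1) * j.factorial)) * (t / 2) ^ 2 := by ring
    _ ≤ (t / 2) ^ (2 * j + 1) * (j.factorial * ((j + 1) * j.factorial)) * ((j + 1) * (j + 1 + 1)) := by
        gcongr
    _ = _ := by ring

lemma tendsto_besselJ1 (t : ℝ) : Tendsto
    (fun n => ∑ i ∈ Finset.range n, (-1) ^ i * besselTerm t i) atTop (𝓝 (besselJ1 t)) :=
  (summable_besselTerm t).hasSum.tendsto_sum_nat

lemma besselJ1_bounds {t : ℝ} (h0 : 0 ≤ t) (h1 : t ≤ 241 / 100) :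
    0 ≤ besselJ1 t ∧ besselJ1 t ≤ t / 2 ∧ besselJ1 t ≤ 59 / 100 ∧
      t / 2 - t ^ 3 / 16 + t ^ 5 / 384 - t ^ 7 / 18432 ≤ besselJ1 t := by
  have ha := antitone_besselTerm h0 h1
  have hl := tendsto_besselJ1 t
  have b0 := ha.alternating_series_le_tendsto hl 0
  have b1 := ha.tendsto_le_alternating_series hl 0
  have b2 := ha.tendsto_le_alternating_series hl 1
  have b3 := ha.alternating_series_le_tendsto hl 2
  simp [Finset.sum_range_succ, besselTerm, Nat.factorial] at b0 b1 b2 b3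
  refine ⟨b0, b1, b2.trans ?_, le_trans (le_of_eq ?_) b3⟩
  · set x := t / 2
    have hx0 : 0 ≤ x := by positivity
    have hx1 : x ≤ 1205 / 1000 := by simp only [x]; linarith
    have hx2 : x ^ 2 ≤ 146 / 100 := by nlinarith
    have hx3 : x ^ 3 ≤ 177 / 100 := by nlinarith
    have hp : 0 ≤ 66 / 100 + 279 / 1000 * x - 157 / 1000 * x ^ 2 - x ^ 3 / 12 := by nlinarith
    -- The quintic `x - x³/2 + x⁵/12` peaks near `x = 0.94`, just below `0.59`. The cubic in `hp` is
    -- an approximate cofactor of the nearly double root.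
    nlinarith [mul_nonneg (sq_nonneg (x - 94 / 100)) hp]
  · ring

lemma besselJ0_zero : besselJ0 0 = 1 := by
  unfold besselJ0
  rw [tsum_eq_single 0]
  · simp
  · intro m hm; simp [hm]

/-- Since `J₁ t ≤ t / 2`, the function `J₀ + t² / 4` increases from the value 1. -/
lemma one_sub_le_besselJ0 {t : ℝ} (h0 : 0 ≤ t) (h1 : t ≤ 241 / 100) :
    1 - t ^ 2 / 4 ≤ besselJ0 t := by
  have hd : ∀ y, HasDerivAt (fun y => besselJ0 y + y ^ 2 / 4) (-besselJ1 y + y / 2) y := by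
    intro y
    have := (hasDerivAt_besselJ0 y).add ((hasDerivAt_pow 2 y).div_const 4)
    exact this.congr_deriv (by norm_num; ring)
  have hm : MonotoneOn (fun y => besselJ0 y + y ^ 2 / 4) (Set.Icc 0 (241 / 100)) := by
    refine monotoneOn_of_deriv_nonneg (convex_Icc _ _)
      (fun y _ => (hd y).continuousAt.continuousWithinAt)
      (fun y _ => (hd y).differentiableAt.differentiableWithinAt) fun y hy => ?_
    rw [interior_Icc] at hy
    rw [(hd y).deriv]
    have := (besselJ1_bounds hy.1.le hy.2.le).2.1
    linarith
  have h := hm ⟨le_rfl, by norm_num⟩ ⟨h0, h1⟩ h0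
  simp only [besselJ0_zero] at h
  linarith

/-- Integrating the lower bound for `J₁` shows that the degree 8 Taylor polynomial dominates `J₀`,
and it is negative at `2.41`. -/
lemma besselJ0_neg : besselJ0 (241 / 100) < 0 := by
  have hd : ∀ y, HasDerivAt (fun y => besselJ0 y -
      (1 - y ^ 2 / 4 + y ^ 4 / 64 - y ^ 6 / 2304 + y ^ 8 / 147456))
      (-besselJ1 y - (0 - 2 * y / 4 + 4 * y ^ 3 / 64 - 6 * y ^ 5 / 2304 + 8 * y ^ 7 / 147456)) y := by
    intro y
    have p : ∀ k : ℕ, HasDerivAt (fun y : ℝ => y ^ (k + 1)) (((k + 1 : ℕ) : ℝ) * y ^ k) y := by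
      intro k; simpa using hasDerivAt_pow (k + 1) y
    have := (hasDerivAt_besselJ0 y).sub ((((((hasDerivAt_const y (1 : ℝ)).sub
      ((p 1).div_const 4)).add ((p 3).div_const 64)).sub ((p 5).div_const 2304)).add
      ((p 7).div_const 147456)))
    exact this.congr_deriv (by norm_num)
  have hm : AntitoneOn (fun y => besselJ0 y -
      (1 - y ^ 2 / 4 + y ^ 4 / 64 - y ^ 6 / 2304 + y ^ 8 / 147456)) (Set.Icc 0 (241 / 100)) := by
    refine antitoneOn_of_deriv_nonpos (convex_Icc _ _)
      (fun y _ => (hd y).continuousAt.continuousWithinAt)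
      (fun y _ => (hd y).differentiableAt.differentiableWithinAt) fun y hy => ?_
    rw [interior_Icc] at hy
    rw [(hd y).deriv]
    have := (besselJ1_bounds hy.1.le hy.2.le).2.2.2
    linarith
  have h := hm (a := 0) ⟨le_rfl, by norm_num⟩ ⟨by norm_num, le_rfl⟩ (by norm_num)
  simp only [besselJ0_zero] at h
  norm_num at h
  linarith

/-- The bound `1 - t² / 4` excludes zeros below 2. The set of positive zeros is therefore closed,
its infimum is attained, and the sign change places it below `2.41`. -/
lemma besselZero_spec : 2 ≤ besselZero ∧ besselZero ≤ 241 / 100 ∧ besselJ0 besselZero = 0 := by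
  set S := {t : ℝ | 0 < t ∧ besselJ0 t = 0} with hS
  have hS2 : S = Set.Ici 2 ∩ besselJ0 ⁻¹' {0} := by
    ext t
    constructor
    · rintro ⟨h0, hz⟩
      refine ⟨?_, hz⟩
      by_contra h2
      have h2' : t < 2 := not_le.1 h2
      have := one_sub_le_besselJ0 h0.le (by linarith)
      rw [hz] at this
      nlinarith
    · rintro ⟨h2, hz⟩
      exact ⟨lt_of_lt_of_le two_pos h2, hz⟩
  have hclosed : IsClosed S := by
    rw [hS2]
    exact isClosed_Ici.inter (isClosed_singleton.preimage continuous_besselJ0)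
  have hbdd : BddBelow S := ⟨0, fun t ht => ht.1.le⟩
  obtain ⟨t, ht, htz⟩ : ∃ t ∈ Set.Icc (0 : ℝ) (241 / 100), besselJ0 t = 0 := by
    have := intermediate_value_Icc' (a := (0 : ℝ)) (b := 241 / 100) (by norm_num)
      continuous_besselJ0.continuousOn
    have h0 := one_sub_le_besselJ0 (t := 0) le_rfl (by norm_num)
    exact this ⟨besselJ0_neg.le, by linarith⟩
  have htS : t ∈ S := by
    refine ⟨lt_of_le_of_ne ht.1 fun h => ?_, htz⟩
    have h0 := one_sub_le_besselJ0 (t := 0) le_rfl (by norm_num)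
    rw [h, htz] at h0
    have : t = 0 := h.symm
    norm_num [this] at h0
  have hmem : besselZero ∈ S := hclosed.csInf_mem ⟨t, htS⟩ hbdd
  refine ⟨?_, (csInf_le hbdd htS).trans ht.2, hmem.2⟩
  rw [hS2] at hmem
  exact hmem.1

lemma besselJ0_lipschitz {a b : ℝ} (ha : a ∈ Set.Icc (0 : ℝ) (241 / 100))
    (hb : b ∈ Set.Icc (0 : ℝ) (241 / 100)) :
    |besselJ0 a - besselJ0 b| ≤ 59 / 100 * |a - b| := by
  refine Convex.norm_image_sub_le_of_norm_hasDerivWithin_le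
    (fun y _ => (hasDerivAt_besselJ0 y).hasDerivWithinAt) (fun y hy => ?_) (convex_Icc _ _) hb ha
  have := besselJ1_bounds hy.1 hy.2
  rw [norm_neg, Real.norm_of_nonneg this.1]
  exact this.2.2.1

end Bessel

end XXZ

namespace XXZ

/-! ### Lattice points in a layer of the cylinder -/

section Lattice

open MeasureTheory
open scoped Pointwise

/-- The projection of a site along the 111 axis. -/
noncomputable def planeVec (x : Site) : ℂ :=
  ⟨(2 * x 0 - x 1 - x 2 : ℝ) / √6, (x 1 - x 2 : ℝ) / √2⟩

/-- The plane orthogonal to the 111 axis, in coordinates adapted to a layer. -/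
noncomputable def planar (p : ℝ × ℝ) : ℂ := ⟨3 * p.1 / √6, (p.1 + 2 * p.2) / √2⟩

lemma axisDist_eq_norm (x : Site) : axisDist x = ‖planeVec x‖ := by
  rw [Complex.norm_def, Complex.normSq_apply, axisDist, planeVec]
  simp only [← sq]

lemma planeVec_eq_planar (x : Site) : planeVec x =
    planar ((x 0 : ℝ) - height x / 3, (x 1 : ℝ) - height x / 3) := by
  have h : (height x : ℝ) = x 0 + x 1 + x 2 := by unfold height; push_cast; ring
  unfold planeVec planar
  rw [h]
  congr 1 <;> (congr 1; ring)

lemma norm_sq_planar (p : ℝ × ℝ) : ‖planar p‖ ^ 2 = 2 * (p.1 ^ 2 + p.1 * p.2 + p.2 ^ 2) := by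
  rw [← Complex.normSq_eq_norm_sq, Complex.normSq_apply, planar]
  simp only [← sq, div_pow]
  rw [Real.sq_sqrt (by norm_num), Real.sq_sqrt (by norm_num)]
  ring

lemma planar_add (p r : ℝ × ℝ) : planar (p + r) = planar p + planar r := by
  unfold planar
  apply Complex.ext <;> simp <;> ring

lemma planar_smul (c : ℝ) (p : ℝ × ℝ) : planar (c • p) = c • planar p := by
  unfold planar
  apply Complex.ext <;> simp <;> ring

lemma continuous_norm_planar : Continuous fun p : ℝ × ℝ => ‖planar p‖ := by
  have : (fun p : ℝ × ℝ => ‖planar p‖) = fun p => √(2 * (p.1 ^ 2 + p.1 * p.2 + p.2 ^ 2)) := by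
    ext p
    rw [← norm_sq_planar, Real.sqrt_sq (norm_nonneg _)]
  rw [this]
  fun_prop

/-- Discs in the plane, in layer coordinates. -/
def planeDisc (t : ℝ) : Set (ℝ × ℝ) := {p | ‖planar p‖ ≤ t}

/-- The area of the unit disc in layer coordinates. -/
noncomputable def discArea : ℝ := (volume (planeDisc 1)).toReal

lemma volume_planeDisc_one_lt_top : volume (planeDisc 1) < ⊤ := by
  refine (measure_mono (t := Set.Icc (-1 : ℝ) 1 ×ˢ Set.Icc (-1 : ℝ) 1) ?_).trans_lt ?_
  · intro p hp
    have h1 : ‖planar p‖ ^ 2 ≤ 1 := by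
      have : ‖planar p‖ ≤ 1 := hp
      nlinarith [norm_nonneg (planar p)]
    rw [norm_sq_planar] at h1
    refine ⟨⟨?_, ?_⟩, ⟨?_, ?_⟩⟩ <;>
      nlinarith [sq_nonneg (p.1 + p.2), sq_nonneg (p.1 + 1), sq_nonneg (p.1 - 1),
        sq_nonneg (p.2 + 1), sq_nonneg (p.2 - 1), sq_nonneg p.1, sq_nonneg p.2]
  · exact (isCompact_Icc.prod isCompact_Icc).measure_lt_top

lemma discArea_pos : 0 < discArea := by
  refine ENNReal.toReal_pos ?_ volume_planeDisc_one_lt_top.ne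
  have hopen : IsOpen {p : ℝ × ℝ | ‖planar p‖ < 1} := isOpen_lt continuous_norm_planar continuous_const
  have hne : {p : ℝ × ℝ | ‖planar p‖ < 1}.Nonempty := by
    refine ⟨0, ?_⟩
    have : planar 0 = 0 := by unfold planar; apply Complex.ext <;> simp
    simp [this]
  have := hopen.measure_pos volume hne
  exact (this.trans_le (measure_mono fun p (hp : ‖planar p‖ < 1) => hp.le)).ne'

lemma volume_planeDisc {t : ℝ} (ht : 0 < t) :
    volume (planeDisc t) = ENNReal.ofReal (discArea * t ^ 2) := by
  have : planeDisc t = t • planeDisc 1 := by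
    ext p
    rw [Set.mem_smul_set_iff_inv_smul_mem₀ ht.ne']
    change ‖planar p‖ ≤ t ↔ ‖planar (t⁻¹ • p)‖ ≤ 1
    rw [planar_smul, norm_smul, Real.norm_of_nonneg (inv_nonneg.2 ht.le), inv_mul_le_iff₀ ht, mul_one]
  rw [this, Measure.addHaar_smul_of_nonneg _ ht.le]
  have hr : Module.finrank ℝ (ℝ × ℝ) = 2 := by simp
  rw [hr, mul_comm discArea, ENNReal.ofReal_mul (by positivity), discArea,
    ENNReal.ofReal_toReal volume_planeDisc_one_lt_top.ne]

lemma finite_layerDisc (l : ℤ) (t : ℝ) : {x : Site | height x = l ∧ axisDist x ≤ t}.Finite := by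
  obtain ⟨B, hB⟩ := exists_nat_gt (t + |(l : ℝ)|)
  refine (Set.finite_Icc (fun _ : Fin 3 => -(B : ℤ)) (fun _ => (B : ℤ))).subset ?_
  rintro x ⟨hl, hx⟩
  have ht : 0 ≤ t := (Real.sqrt_nonneg _).trans hx
  have h1 : ‖planeVec x‖ ^ 2 ≤ t ^ 2 := by
    rw [← axisDist_eq_norm]
    exact pow_le_pow_left₀ (Real.sqrt_nonneg _) hx 2
  rw [planeVec_eq_planar, norm_sq_planar, hl] at h1
  have h2 : (x 2 : ℝ) = l - x 0 - x 1 := by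
    rw [← hl]; unfold height; push_cast; ring
  simp only at h1
  set a := (x 0 : ℝ) - l / 3 with ha
  set b := (x 1 : ℝ) - l / 3 with hb
  have k1 : |a| ≤ t := abs_le_of_sq_le_sq (by nlinarith [sq_nonneg (a + b), sq_nonneg b]) ht
  have k2 : |b| ≤ t := abs_le_of_sq_le_sq (by nlinarith [sq_nonneg (a + b), sq_nonneg a]) ht
  have k3 : |a + b| ≤ t := abs_le_of_sq_le_sq (by nlinarith [sq_nonneg a, sq_nonneg b]) ht
  rw [abs_le] at k1 k2 k3
  have hl1 := le_abs_self (l : ℝ)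
  have hl2 := neg_abs_le (l : ℝ)
  have key : ∀ i, (-(B : ℝ)) ≤ x i ∧ (x i : ℝ) ≤ B := by
    intro i
    fin_cases i
    · change -(B : ℝ) ≤ x 0 ∧ (x 0 : ℝ) ≤ B
      constructor <;> linarith
    · change -(B : ℝ) ≤ x 1 ∧ (x 1 : ℝ) ≤ B
      constructor <;> linarith
    · change -(B : ℝ) ≤ x 2 ∧ (x 2 : ℝ) ≤ B
      constructor <;> linarith
  exact ⟨fun i => by exact_mod_cast (key i).1, fun i => by exact_mod_cast (key i).2⟩

/-- The sites of height `l` within distance `t` of the axis. -/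
noncomputable def layerDisc (l : ℤ) (t : ℝ) : Finset Site := (finite_layerDisc l t).toFinset

lemma mem_layerDisc {l : ℤ} {t : ℝ} {x : Site} :
    x ∈ layerDisc l t ↔ height x = l ∧ axisDist x ≤ t := by
  simp [layerDisc]

/-- The unit cell around a site of the layer `l`. -/
def cell (l : ℤ) (x : Site) : Set (ℝ × ℝ) :=
  Set.Ico ((x 0 : ℝ) - l / 3 - 1 / 2) ((x 0 : ℝ) - l / 3 + 1 / 2) ×ˢ
    Set.Ico ((x 1 : ℝ) - l / 3 - 1 / 2) ((x 1 : ℝ) - l / 3 + 1 / 2)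

lemma volume_cell (l : ℤ) (x : Site) : volume (cell l x) = 1 := by
  unfold cell
  rw [Measure.volume_eq_prod, Measure.prod_prod, Real.volume_Ico, Real.volume_Ico]
  norm_num

/-- Within a cell the offsets satisfy `|a|, |b| ≤ 1/2`, so `2 (a² + ab + b²) ≤ 3/2`, and `√(3/2) <
49/40`. -/
lemma norm_planar_sub_le {l : ℤ} {x : Site} (hx : height x = l) {p : ℝ × ℝ} (hp : p ∈ cell l x) :
    |‖planar p‖ - axisDist x| ≤ 49 / 40 := by
  set c : ℝ × ℝ := ((x 0 : ℝ) - l / 3, (x 1 : ℝ) - l / 3) with hc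
  have h1 : axisDist x = ‖planar c‖ := by rw [axisDist_eq_norm, planeVec_eq_planar, hx]
  have h2 : planar p - planar c = planar (p - c) := by
    rw [sub_eq_iff_eq_add, ← planar_add, sub_add_cancel]
  rw [h1]
  refine (abs_norm_sub_norm_le _ _).trans ?_
  rw [h2]
  refine abs_le_of_sq_le_sq' ?_ (by norm_num) |>.2
  rw [norm_sq_planar]
  obtain ⟨⟨a1, a2⟩, ⟨b1, b2⟩⟩ := hp
  simp only [hc, Prod.fst_sub, Prod.snd_sub]
  set a := p.1 - ((x 0 : ℝ) - l / 3)
  set b := p.2 - ((x 1 : ℝ) - l / 3)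
  have ha1 : -(1 / 2) ≤ a := by simp only [a]; linarith
  have ha2 : a ≤ 1 / 2 := by simp only [a]; linarith
  have hb1 : -(1 / 2) ≤ b := by simp only [b]; linarith
  have hb2 : b ≤ 1 / 2 := by simp only [b]; linarith
  nlinarith [mul_nonneg (sub_nonneg.2 ha2) (sub_nonneg.2 hb2),
    mul_nonneg (by linarith : 0 ≤ a + 1 / 2) (by linarith : 0 ≤ b + 1 / 2),
    mul_nonneg (by linarith : 0 ≤ a + 1 / 2) (sub_nonneg.2 ha2),
    mul_nonneg (by linarith : 0 ≤ b + 1 / 2) (sub_nonneg.2 hb2)]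

/-- The unit cells of the sites are disjoint and lie in the disc enlarged by the cell radius. -/
lemma card_layerDisc_le (l : ℤ) {t : ℝ} (ht : 0 ≤ t) :
    ((layerDisc l t).card : ℝ) ≤ discArea * (t + 49 / 40) ^ 2 := by
  have hdisj : Set.PairwiseDisjoint (↑(layerDisc l t)) (cell l) := by
    intro x hx y hy hxy
    rw [Function.onFun, Set.disjoint_left]
    rintro p ⟨⟨a1, a2⟩, ⟨b1, b2⟩⟩ ⟨⟨c1, c2⟩, ⟨d1, d2⟩⟩
    have hxl := (mem_layerDisc.1 hx).1
    have hyl := (mem_layerDisc.1 hy).1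
    have e0 : x 0 = y 0 := by
      have h1 : (x 0 : ℝ) < y 0 + 1 := by linarith
      have h2 : (y 0 : ℝ) < x 0 + 1 := by linarith
      have h1' : x 0 < y 0 + 1 := by exact_mod_cast h1
      have h2' : y 0 < x 0 + 1 := by exact_mod_cast h2
      omega
    have e1 : x 1 = y 1 := by
      have h1 : (x 1 : ℝ) < y 1 + 1 := by linarith
      have h2 : (y 1 : ℝ) < x 1 + 1 := by linarith
      have h1' : x 1 < y 1 + 1 := by exact_mod_cast h1
      have h2' : y 1 < x 1 + 1 := by exact_mod_cast h2
      omega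
    have e2 : x 2 = y 2 := by unfold height at hxl hyl; omega
    exact hxy (funext fun i => by fin_cases i <;> assumption)
  have hmeas : ∀ x ∈ layerDisc l t, MeasurableSet (cell l x) :=
    fun x _ => measurableSet_Ico.prod measurableSet_Ico
  have hsub : (⋃ x ∈ layerDisc l t, cell l x) ⊆ planeDisc (t + 49 / 40) := by
    refine Set.iUnion₂_subset fun x hx p hp => ?_
    have hx' := mem_layerDisc.1 hx
    have := (abs_le.1 (norm_planar_sub_le hx'.1 hp)).2
    change ‖planar p‖ ≤ _
    linarith [hx'.2]
  have h := measure_mono (μ := volume) hsub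
  rw [measure_biUnion_finset hdisj hmeas, volume_planeDisc (by linarith)] at h
  simp only [volume_cell, Finset.sum_const, nsmul_eq_mul, mul_one] at h
  rw [← ENNReal.ofReal_natCast] at h
  exact (ENNReal.ofReal_le_ofReal_iff (mul_nonneg discArea_pos.le (by positivity))).1 h

/-- Rounding both coordinates shows that the cells cover the disc shrunk by the cell radius. -/
lemma le_card_layerDisc (l : ℤ) {t : ℝ} (ht : 49 / 40 < t) :
    discArea * (t - 49 / 40) ^ 2 ≤ (layerDisc l t).card := by
  have hsub : planeDisc (t - 49 / 40) ⊆ ⋃ x ∈ layerDisc l t, cell l x := by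
    intro p hp
    set a := ⌊p.1 + l / 3 + 1 / 2⌋ with ha
    set b := ⌊p.2 + l / 3 + 1 / 2⌋ with hb
    set x : Site := ![a, b, l - a - b] with hx
    have hxl : height x = l := by simp [height, hx]
    have a1 := Int.floor_le (p.1 + l / 3 + 1 / 2)
    have a2 := Int.lt_floor_add_one (p.1 + l / 3 + 1 / 2)
    have b1 := Int.floor_le (p.2 + l / 3 + 1 / 2)
    have b2 := Int.lt_floor_add_one (p.2 + l / 3 + 1 / 2)
    rw [← ha] at a1 a2
    rw [← hb] at b1 b2
    have hpc : p ∈ cell l x := by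
      refine ⟨⟨?_, ?_⟩, ⟨?_, ?_⟩⟩ <;> simp [hx] <;> linarith
    have := (abs_le.1 (norm_planar_sub_le hxl hpc)).1
    have hp' : ‖planar p‖ ≤ t - 49 / 40 := hp
    exact Set.mem_iUnion₂.2 ⟨x, mem_layerDisc.2 ⟨hxl, by linarith⟩, hpc⟩
  have h := (measure_mono (μ := volume) hsub).trans (measure_biUnion_finset_le _ _)
  rw [volume_planeDisc (by linarith)] at h
  simp only [volume_cell, Finset.sum_const, nsmul_eq_mul, mul_one] at h
  rw [← ENNReal.ofReal_natCast] at h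
  exact (ENNReal.ofReal_le_ofReal_iff (Nat.cast_nonneg _)).1 h

end Lattice

end XXZ

namespace XXZ

/-! ### The Bessel profile -/

section Profile

/-- The phase profile of unit amplitude. -/
noncomputable def besselProfile (R : ℝ) (x : Site) : ℝ :=
  if axisDist x ≤ R then besselJ0 (besselZero * (axisDist x / R)) else 0

lemma cutPhase_besselPhase (R s : ℝ) (x : Site) :
    cutPhase R (besselPhase R s) x = s * besselProfile R x := by
  unfold cutPhase besselPhase besselProfile
  split_ifs <;> simp

lemma axisDist_nonneg (x : Site) : 0 ≤ axisDist x := Real.sqrt_nonneg _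

/-- Because `J₀` vanishes at `z₀`, cutting off at radius `R` amounts to clamping the argument. The
Lipschitz bound therefore also holds for bonds crossing the boundary. -/
lemma besselProfile_eq {R : ℝ} (hR : 0 < R) (x : Site) :
    besselProfile R x = besselJ0 (besselZero * min (axisDist x / R) 1) := by
  unfold besselProfile
  split_ifs with h
  · rw [min_eq_left ((div_le_one hR).2 h)]
  · rw [min_eq_right ((one_le_div hR).2 (not_le.1 h).le), mul_one, besselZero_spec.2.2]

/-- A unit step with height change 1 projects to a vector of squared length `1 - 1/3`, and `√(2/3) <
0.8165`. -/
lemma abs_axisDist_sub_le {x y : Site} (h : IsBond x y) :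
    |axisDist x - axisDist y| ≤ 8165 / 10000 := by
  rw [axisDist_eq_norm, axisDist_eq_norm]
  refine (abs_norm_sub_norm_le _ _).trans (abs_le_of_sq_le_sq' ?_ (by norm_num)).2
  obtain ⟨h1, h2⟩ := h
  rw [Fin.sum_univ_three] at h1
  unfold height at h2
  have h1' : ((x 0 : ℝ) - y 0) ^ 2 + ((x 1 : ℝ) - y 1) ^ 2 + ((x 2 : ℝ) - y 2) ^ 2 = 1 := by
    exact_mod_cast h1
  have h2' : (y 0 : ℝ) + y 1 + y 2 = x 0 + x 1 + x 2 + 1 := by exact_mod_cast h2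
  have e : ‖planeVec x - planeVec y‖ ^ 2 =
      (2 * ((x 0 : ℝ) - y 0) - (x 1 - y 1) - (x 2 - y 2)) ^ 2 / 6 +
        (((x 1 : ℝ) - y 1) - (x 2 - y 2)) ^ 2 / 2 := by
    rw [← Complex.normSq_eq_norm_sq, Complex.normSq_apply]
    simp only [planeVec, Complex.sub_re, Complex.sub_im, ← sub_div, ← sq, div_pow]
    rw [Real.sq_sqrt (by norm_num), Real.sq_sqrt (by norm_num)]
    ring
  rw [e]
  set a := (x 0 : ℝ) - y 0
  set b := (x 1 : ℝ) - y 1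
  set c := (x 2 : ℝ) - y 2
  have h3 : a + b + c = -1 := by simp only [a, b, c]; linarith
  have h4 : (2 * a - b - c) ^ 2 / 6 + (b - c) ^ 2 / 2 =
      (a ^ 2 + b ^ 2 + c ^ 2) - (a + b + c) ^ 2 / 3 := by ring
  rw [h4, h1', h3]
  norm_num

lemma sq_besselProfile_sub_le {R : ℝ} (hR : 0 < R) {x y : Site} (h : IsBond x y) :
    (besselProfile R x - besselProfile R y) ^ 2 ≤ 1348 / 1000 / R ^ 2 := by
  obtain ⟨z1, z2, -⟩ := besselZero_spec
  rw [besselProfile_eq hR, besselProfile_eq hR]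
  have hmem : ∀ x : Site, besselZero * min (axisDist x / R) 1 ∈ Set.Icc (0 : ℝ) (241 / 100) := by
    intro x
    have h0 : 0 ≤ min (axisDist x / R) 1 := le_min (div_nonneg (axisDist_nonneg x) hR.le) zero_le_one
    have h1 : min (axisDist x / R) 1 ≤ 1 := min_le_right _ _
    constructor
    · positivity
    · nlinarith
  have hlip := besselJ0_lipschitz (hmem x) (hmem y)
  have hmin : |min (axisDist x / R) 1 - min (axisDist y / R) 1| ≤ 8165 / 10000 / R := by
    have h1 := abs_min_sub_min_le_max (axisDist x / R) 1 (axisDist y / R) 1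
    rw [sub_self, abs_zero, max_eq_left (abs_nonneg _), ← sub_div, abs_div, abs_of_pos hR] at h1
    exact h1.trans (div_le_div_of_nonneg_right (abs_axisDist_sub_le h) hR.le)
  rw [← mul_sub, abs_mul, abs_of_nonneg (by linarith : 0 ≤ besselZero)] at hlip
  have h2 : |besselJ0 (besselZero * min (axisDist x / R) 1) -
      besselJ0 (besselZero * min (axisDist y / R) 1)| ≤
      59 / 100 * (241 / 100 * (8165 / 10000 / R)) := by
    refine hlip.trans ?_
    gcongr
  rw [← sq_abs]
  refine (pow_le_pow_left₀ (abs_nonneg _) h2 2).trans ?_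
  rw [show (59 / 100 * (241 / 100 * (8165 / 10000 / R))) ^ 2 =
    (59 / 100 * (241 / 100 * (8165 / 10000))) ^ 2 / R ^ 2 by ring]
  gcongr
  norm_num

lemma eq_of_sq_add_sq_add_sq_eq_one {a b c : ℤ} (h1 : a ^ 2 + b ^ 2 + c ^ 2 = 1)
    (h2 : a + b + c = -1) :
    (a = -1 ∧ b = 0 ∧ c = 0) ∨ (a = 0 ∧ b = -1 ∧ c = 0) ∨ (a = 0 ∧ b = 0 ∧ c = -1) := by
  have a1 : a ≤ 1 := by nlinarith
  have a2 : -1 ≤ a := by nlinarith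
  have b1 : b ≤ 1 := by nlinarith
  have b2 : -1 ≤ b := by nlinarith
  obtain rfl : c = -1 - a - b := by linarith
  interval_cases a <;> interval_cases b <;> simp_all

lemma exists_eq_of_isBond {x y : Site} (h : IsBond x y) : ∃ i : Fin 3, y = x + Pi.single i 1 := by
  obtain ⟨h1, h2⟩ := h
  rw [Fin.sum_univ_three] at h1
  unfold height at h2
  rcases eq_of_sq_add_sq_add_sq_eq_one h1 (by omega) with ⟨k1, k2, k3⟩ | ⟨k1, k2, k3⟩ | ⟨k1, k2, k3⟩
  · refine ⟨0, funext fun j => ?_⟩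
    fin_cases j <;> simp <;> omega
  · refine ⟨1, funext fun j => ?_⟩
    fin_cases j <;> simp <;> omega
  · refine ⟨2, funext fun j => ?_⟩
    fin_cases j <;> simp <;> omega

/-- The squared differences of the profile across the bonds leaving a layer. -/
lemma sum_sq_besselProfile_sub_le {R : ℝ} (hR : 70 < R) (Λ : Finset Site) (l : ℤ) :
    ∑ b : Λ × Λ with IsBond b.1 b.2 ∧ height b.1 = l,
      (besselProfile R b.1 - besselProfile R b.2) ^ 2 ≤ 429 / 100 * discArea := by
  have hR0 : 0 < R := by linarith
  set T := layerDisc l (R + 8165 / 10000)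
  set F := (Finset.univ : Finset (Λ × Λ)).filter fun b => IsBond b.1 b.2 ∧ height b.1 = l
  set F' := F.filter fun b => axisDist b.1 ≤ R + 8165 / 10000
  have h1 : ∑ b ∈ F, (besselProfile R b.1 - besselProfile R b.2) ^ 2 =
      ∑ b ∈ F', (besselProfile R b.1 - besselProfile R b.2) ^ 2 := by
    refine (Finset.sum_subset (Finset.filter_subset _ _) fun b hb hb' => ?_).symm
    have hbond := (Finset.mem_filter.1 hb).2.1
    have hfar : R + 8165 / 10000 < axisDist b.1 := by
      by_contra hle
      exact hb' (Finset.mem_filter.2 ⟨hb, not_lt.1 hle⟩)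
    have := (abs_le.1 (abs_axisDist_sub_le hbond)).2
    unfold besselProfile
    rw [if_neg (by linarith), if_neg (by linarith), sub_self]
    norm_num
  have h2 : ∑ b ∈ F', (besselProfile R b.1 - besselProfile R b.2) ^ 2 ≤
      F'.card * (1348 / 1000 / R ^ 2) := by
    rw [← nsmul_eq_mul]
    refine Finset.sum_le_card_nsmul _ _ _ fun b hb => ?_
    exact sq_besselProfile_sub_le hR0 (Finset.mem_filter.1 (Finset.mem_filter.1 hb).1).2.1
  -- Each site has exactly three upward neighbours in the lattice.
  have h3 : F'.card ≤ T.card * 3 := by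
    have hinj : Function.Injective fun b : Λ × Λ => ((b.1 : Site), (b.2 : Site)) := by
      rintro ⟨a, b⟩ ⟨c, d⟩ h
      simp only [Prod.mk.injEq] at h
      exact Prod.ext (Subtype.ext h.1) (Subtype.ext h.2)
    rw [← Finset.card_image_of_injective F' hinj]
    have hsub : F'.image (fun b : Λ × Λ => ((b.1 : Site), (b.2 : Site))) ⊆
        (T ×ˢ (Finset.univ : Finset (Fin 3))).image fun p => (p.1, p.1 + Pi.single p.2 1) := by
      intro p hp
      obtain ⟨b, hb, rfl⟩ := Finset.mem_image.1 hp
      obtain ⟨hbF, hbd⟩ := Finset.mem_filter.1 hb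
      obtain ⟨-, hbond, hl⟩ := Finset.mem_filter.1 hbF
      obtain ⟨i, hi⟩ := exists_eq_of_isBond hbond
      exact Finset.mem_image.2 ⟨(b.1, i), Finset.mem_product.2
        ⟨mem_layerDisc.2 ⟨hl, hbd⟩, Finset.mem_univ _⟩, by rw [hi]⟩
    refine (Finset.card_le_card hsub).trans (Finset.card_image_le.trans ?_)
    rw [Finset.card_product]; simp
  have h4 : (F'.card : ℝ) ≤ T.card * 3 := by exact_mod_cast h3
  have h5 : (T.card : ℝ) ≤ _ := card_layerDisc_le l (t := R + 8165 / 10000) (by linarith)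
  rw [h1]
  refine h2.trans ?_
  have hκ := discArea_pos
  -- The boundary effects of the bond length and the cell radius are absorbed using `R > 70`.
  have h6 : (R + 8165 / 10000 + 49 / 40) ^ 2 ≤ (10592 / 10000) * R ^ 2 := by nlinarith
  have h7 : (F'.card : ℝ) ≤ 3 * (discArea * (10592 / 10000 * R ^ 2)) := by
    have := mul_le_mul_of_nonneg_left h6 hκ.le
    linarith
  calc (F'.card : ℝ) * (1348 / 1000 / R ^ 2)
      ≤ 3 * (discArea * (10592 / 10000 * R ^ 2)) * (1348 / 1000 / R ^ 2) := by gcongr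
    _ = 3 * (10592 / 10000) * (1348 / 1000) * discArea := by field_simp
    _ ≤ _ := by nlinarith

/-- Values at the grid points `j / 20` of the lower bound for the squared profile. -/
noncomputable def stepValue (j : ℕ) : ℝ :=
  if j ≤ 16 then (1 - 14521 / 10000 * ((j : ℝ) / 20) ^ 2) ^ 2 else 0

/-- A layer-cake bound: the steps telescope to the value at the first grid point beyond `|x_⊥| / R`,
where `1 - z₀² u² / 4` bounds the profile from below. The coefficient `1.4521` exceeds `2.41² / 4`,
and `16/20` is the last grid point at which the bound is positive. -/
lemma sum_steps_le_sq {R : ℝ} (hR : 0 < R) (x : Site) :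
    ∑ j ∈ Finset.Ico (1 : ℕ) 17, (if axisDist x ≤ (j : ℝ) / 20 * R then
      stepValue j - stepValue (j + 1) else 0) ≤ besselProfile R x ^ 2 := by
  obtain ⟨z1, z2, -⟩ := besselZero_spec
  set u := axisDist x / R with hu
  have hu0 : 0 ≤ u := div_nonneg (axisDist_nonneg x) hR.le
  have hiff : ∀ j : ℕ, axisDist x ≤ (j : ℝ) / 20 * R ↔ ⌈20 * u⌉₊ ≤ j := by
    intro j
    rw [Nat.ceil_le, hu, ← div_le_iff₀ hR]
    constructor <;> intro h <;> linarith
  simp only [hiff]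
  rw [← Finset.sum_filter]
  have hfil : (Finset.Ico 1 17).filter (fun j => ⌈20 * u⌉₊ ≤ j) = Finset.Ico (max 1 ⌈20 * u⌉₊) 17 := by
    ext j; simp only [Finset.mem_filter, Finset.mem_Ico]; omega
  rw [hfil]
  rcases le_or_gt (max 1 ⌈20 * u⌉₊) 16 with hle | hgt
  · set m := max 1 ⌈20 * u⌉₊ with hm
    have htel : ∑ j ∈ Finset.Ico m 17, (stepValue j - stepValue (j + 1)) = stepValue m := by
      have := Finset.sum_Ico_sub stepValue (m := m) (n := 17) (by omega)
      rw [← neg_inj, ← Finset.sum_neg_distrib]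
      simp only [neg_sub]
      rw [this]
      simp [stepValue]
    rw [htel, stepValue, if_pos hle]
    have hmu : u ≤ (m : ℝ) / 20 := by
      have h1 : (⌈20 * u⌉₊ : ℝ) ≤ m := by exact_mod_cast le_max_right _ _
      have h2 := Nat.le_ceil (20 * u)
      linarith
    have hm16 : (m : ℝ) / 20 ≤ 4 / 5 := by
      have : (m : ℝ) ≤ 16 := by exact_mod_cast hle
      linarith
    have hx : axisDist x ≤ R := by
      rw [← div_le_one hR]; linarith
    unfold besselProfile
    rw [if_pos hx, ← hu]
    have hz : besselZero * u ≤ 241 / 100 := by nlinarith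
    have hJ := one_sub_le_besselJ0 (mul_nonneg (by linarith) hu0) hz
    have hz2 : besselZero ^ 2 ≤ (241 / 100) ^ 2 := pow_le_pow_left₀ (by linarith) z2 2
    have hu2 : u ^ 2 ≤ ((m : ℝ) / 20) ^ 2 := pow_le_pow_left₀ hu0 hmu 2
    have hmm : ((m : ℝ) / 20) ^ 2 ≤ (4 / 5) ^ 2 := pow_le_pow_left₀ (by positivity) hm16 2
    refine pow_le_pow_left₀ (by nlinarith) (le_trans ?_ hJ) 2
    rw [mul_pow]
    have := mul_le_mul hz2 hu2 (sq_nonneg u) (by norm_num)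
    linarith [sq_nonneg ((m : ℝ) / 20)]
  · rw [Finset.Ico_eq_empty (by omega), Finset.sum_empty]
    positivity

/-- The profile carries a fixed fraction of the area of each layer. -/
lemma le_sum_sq_besselProfile {R : ℝ} (hR : 70 < R) (l : ℤ) :
    19 / 100 * discArea * R ^ 2 ≤ ∑ x ∈ layerDisc l R, besselProfile R x ^ 2 := by
  have hR0 : 0 < R := by linarith
  have hκ := discArea_pos
  refine le_trans ?_ (Finset.sum_le_sum fun x _ => sum_steps_le_sq hR0 x)
  rw [Finset.sum_comm]
  have h1 : ∀ j ∈ Finset.Ico (1 : ℕ) 17, (stepValue j - stepValue (j + 1)) *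
      (discArea * (((j : ℝ) / 20 - 7 / 400) ^ 2 * R ^ 2)) ≤
      ∑ x ∈ layerDisc l R, if axisDist x ≤ (j : ℝ) / 20 * R then
        stepValue j - stepValue (j + 1) else 0 := by
    intro j hj
    rw [Finset.mem_Ico] at hj
    have hj1 : (1 : ℝ) ≤ j := by exact_mod_cast hj.1
    have hj2 : (j : ℝ) ≤ 16 := by exact_mod_cast (by omega : j ≤ 16)
    have hs : 0 ≤ stepValue j - stepValue (j + 1) := by
      unfold stepValue
      rw [if_pos (by omega)]
      split_ifs with hj'
      · push_cast
        have hj3 : (j : ℝ) + 1 ≤ 16 := by exact_mod_cast hj'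
        rw [sub_nonneg]
        refine pow_le_pow_left₀ (by nlinarith) ?_ 2
        nlinarith
      · rw [sub_zero]; positivity
    have hsub : layerDisc l ((j : ℝ) / 20 * R) ⊆ (layerDisc l R).filter
        fun x => axisDist x ≤ (j : ℝ) / 20 * R := by
      intro x hx
      obtain ⟨hxl, hxd⟩ := mem_layerDisc.1 hx
      refine Finset.mem_filter.2 ⟨mem_layerDisc.2 ⟨hxl, hxd.trans ?_⟩, hxd⟩
      nlinarith
    have hcard : ((layerDisc l ((j : ℝ) / 20 * R)).card : ℝ) ≤
        ((layerDisc l R).filter fun x => axisDist x ≤ (j : ℝ) / 20 * R).card := by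
      exact_mod_cast Finset.card_le_card hsub
    have hlow := le_card_layerDisc l (t := (j : ℝ) / 20 * R) (by nlinarith)
    -- Here `7/400 = (49/40) / 70`, so the cell radius is at most `7/400 * R`.
    have hpt : ((j : ℝ) / 20 - 7 / 400) ^ 2 * R ^ 2 ≤ ((j : ℝ) / 20 * R - 49 / 40) ^ 2 := by
      rw [← mul_pow]
      refine pow_le_pow_left₀ ?_ ?_ 2
      · exact mul_nonneg (by linarith) hR0.le
      · nlinarith
    rw [← Finset.sum_filter, Finset.sum_const, nsmul_eq_mul, mul_comm]
    refine mul_le_mul_of_nonneg_right ?_ hs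
    exact (mul_le_mul_of_nonneg_left hpt hκ.le).trans (hlow.trans hcard)
  refine le_trans ?_ (Finset.sum_le_sum h1)
  have h2 : ∑ j ∈ Finset.Ico (1 : ℕ) 17, (stepValue j - stepValue (j + 1)) *
      (discArea * (((j : ℝ) / 20 - 7 / 400) ^ 2 * R ^ 2)) =
      (∑ j ∈ Finset.Ico (1 : ℕ) 17, (stepValue j - stepValue (j + 1)) * ((j : ℝ) / 20 - 7 / 400) ^ 2) *
        (discArea * R ^ 2) := by
    rw [Finset.sum_mul]
    refine Finset.sum_congr rfl fun j _ => by ring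
  rw [h2, mul_assoc]
  refine mul_le_mul_of_nonneg_right ?_ (by positivity)
  simp only [Finset.sum_Ico_eq_sum_range, Finset.sum_range_succ, Finset.sum_range_zero, stepValue]
  norm_num

end Profile

end XXZ

namespace XXZ

/-! ### The gap estimate -/

section Gap

lemma intDist_nonneg (μ : ℝ) : 0 ≤ intDist μ := le_min (abs_nonneg _) (abs_nonneg _)

lemma exists_nearest_int (μ : ℝ) : ∃ l : ℤ, (l : ℝ) - μ = intDist μ ∨ (l : ℝ) - μ = -intDist μ := by
  have h1 := Int.floor_le μ
  have h2 := Int.lt_floor_add_one μ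
  unfold intDist
  rw [abs_of_nonneg (by linarith : 0 ≤ μ - ⌊μ⌋), abs_of_nonneg (by linarith : 0 ≤ 1 - μ + ⌊μ⌋)]
  rcases min_choice (μ - ⌊μ⌋) (1 - μ + ⌊μ⌋) with h | h <;> rw [h]
  · exact ⟨⌊μ⌋, Or.inr (by ring)⟩
  · exact ⟨⌊μ⌋ + 1, Or.inl (by push_cast; ring)⟩

/-- The variance of a site in the layer nearest to the interface. -/
lemma quarter_rpow_intDist_le {q : ℝ} (hq : 0 < q) (hq1 : q < 1) {μ : ℝ} {l : ℤ}
    (hl : (l : ℝ) - μ = intDist μ ∨ (l : ℝ) - μ = -intDist μ) :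
    q ^ (2 * intDist μ) / 4 ≤ q ^ (2 * ((l : ℝ) - μ)) / (1 + q ^ (2 * ((l : ℝ) - μ))) ^ 2 := by
  set t := q ^ (2 * intDist μ) with ht
  have ht0 : 0 < t := Real.rpow_pos_of_pos hq _
  have ht1 : t ≤ 1 := Real.rpow_le_one hq.le hq1.le (by linarith [intDist_nonneg μ])
  have key : t / 4 ≤ t / (1 + t) ^ 2 := by
    refine div_le_div_of_nonneg_left ht0.le (by positivity) ?_
    nlinarith
  -- The function `y / (1 + y)²` is invariant under `y ↦ 1 / y`, so the side on which the nearest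
  -- layer lies does not matter.
  rcases hl with hl | hl
  · rw [hl]; exact key
  · rw [hl, mul_neg, Real.rpow_neg hq.le, ← ht]
    refine key.trans (le_of_eq ?_)
    field_simp
    ring

lemma sum_layer_eq {Λ : Finset Site} {l : ℤ} {R : ℝ} (hsub : layerDisc l R ⊆ Λ) {g : Site → ℝ}
    (hg : ∀ x, R < axisDist x → g x = 0) :
    ∑ x ∈ Finset.univ.filter (fun x : Λ => height x = l), g x = ∑ x ∈ layerDisc l R, g x := by
  rw [Finset.sum_filter, Finset.sum_coe_sort Λ fun x => if height x = l then g x else 0,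
    ← Finset.sum_filter]
  refine (Finset.sum_subset (fun x hx => ?_) fun x hx hx' => ?_).symm
  · exact Finset.mem_filter.2 ⟨hsub hx, (mem_layerDisc.1 hx).1⟩
  · refine hg x ?_
    by_contra hle
    exact hx' (mem_layerDisc.2 ⟨(Finset.mem_filter.1 hx).2, not_lt.1 hle⟩)

lemma besselProfile_eq_zero {R : ℝ} {x : Site} (h : R < axisDist x) : besselProfile R x = 0 := by
  unfold besselProfile
  rw [if_neg (not_le.2 h)]

/-- The norm of the excitation in a finite volume, once the layer `l` is large enough. -/
lemma norm_sq_excitation_ge {Λ : Finset Site} {q : ℝ} (hq : 0 < q) {n : ℕ}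
    (hn : n ≤ Fintype.card Λ) {R s : ℝ} {l : ℤ} (hsub : layerDisc l R ⊆ Λ) {c₀ : ℝ} (hc₀ : 0 < c₀)
    (hc : ∀ u v : Λ, u ≠ v → height u = l → height v = l → c₀ ≤ pairProb (activity q Λ) n u v)
    (hM : 1 < (Finset.univ.filter fun x : Λ => height x = l).card)
    (hM' : (∑ x ∈ layerDisc l R, besselProfile R x) ^ 2 /
        (Finset.univ.filter fun x : Λ => height x = l).card ≤
      2 / 100 * ∑ x ∈ layerDisc l R, besselProfile R x ^ 2)
    (hs : 4 * s ^ 2 * (∑ x ∈ layerDisc l R, |besselProfile R x|) ^ 4 / 3 ≤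
      2 / 100 * (c₀ * (98 / 100 * ∑ x ∈ layerDisc l R, besselProfile R x ^ 2))) :
    canonPart (activity q Λ) n * (4 * s ^ 2) * ((98 / 100) ^ 3 * c₀ *
      ∑ x ∈ layerDisc l R, besselProfile R x ^ 2) ≤ ‖excitation q Λ n R s‖ ^ 2 := by
  have hZ := canonPart_pos (activity_pos (Λ := Λ) hq) hn
  set L := Finset.univ.filter fun x : Λ => height x = l with hL
  have hmem : ∀ x ∈ L, height x = l := fun x hx => (Finset.mem_filter.1 hx).2
  have hact : ∀ x ∈ L, activity q Λ x = q ^ (2 * l) := by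
    intro x hx; unfold activity; rw [hmem x hx]
  obtain ⟨u, hu, v, hv, huv⟩ := Finset.one_lt_card.1 hM
  set N := ∑ x ∈ layerDisc l R, besselProfile R x ^ 2
  set A := ∑ x ∈ layerDisc l R, |besselProfile R x|
  set S := ∑ x ∈ layerDisc l R, besselProfile R x
  have hN : ∑ x ∈ L, besselProfile R x ^ 2 = N :=
    sum_layer_eq hsub (g := fun x => besselProfile R x ^ 2) fun x hx => by
      simp [besselProfile_eq_zero hx]
  have hA : ∑ x ∈ L, |besselProfile R x| = A :=
    sum_layer_eq hsub (g := fun x => |besselProfile R x|) fun x hx => by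
      simp [besselProfile_eq_zero hx]
  have hS : ∑ x ∈ L, besselProfile R x = S :=
    sum_layer_eq hsub (g := fun x => besselProfile R x) fun x hx => besselProfile_eq_zero hx
  have hN0 : 0 ≤ N := Finset.sum_nonneg fun _ _ => sq_nonneg _
  set c := pairProb (activity q Λ) n u v
  have hcc : c₀ ≤ c := hc u v huv (hmem u hu) (hmem v hv)
  have hpair : ∀ x ∈ L, ∀ y ∈ L, x ≠ y → pairProb (activity q Λ) n x y = c := by
    intro x hx y hy hxy
    exact pairProb_congr hxy huv ((hact x hx).trans (hact y hy).symm)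
      ((hact x hx).trans (hact u hu).symm) ((hact x hx).trans (hact v hv).symm)
  set V := c * (N - S ^ 2 / L.card) with hV
  have hV0 : c₀ * (98 / 100 * N) ≤ V := by
    rw [hV]
    refine mul_le_mul hcc (by linarith) (by positivity) (hc₀.le.trans hcc)
  have hVnn : 0 ≤ V := le_trans (by positivity) hV0
  have hinner : 98 / 100 * |2 * s| * V ≤ |2 * s| * V - |2 * s| ^ 3 * (2 * A * A ^ 3) / 6 := by
    have e : |2 * s| ^ 3 * (2 * A * A ^ 3) / 6 = |2 * s| * (4 * s ^ 2 * A ^ 4 / 3) := by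
      have : |2 * s| ^ 2 = 4 * s ^ 2 := by rw [sq_abs]; ring
      rw [show |2 * s| ^ 3 = |2 * s| * |2 * s| ^ 2 by ring, this]; ring
    rw [e]
    have : |2 * s| * (4 * s ^ 2 * A ^ 4 / 3) ≤ |2 * s| * (2 / 100 * V) :=
      mul_le_mul_of_nonneg_left (by linarith) (abs_nonneg _)
    linarith
  have hY : 0 ≤ 98 / 100 * |2 * s| * V := by positivity
  have main := le_norm_sq_excitation hq hn R s (cutPhase_besselPhase R s) ⟨u, hu⟩ hact hpair hA
    (V := V) (by rw [hN, hS]) (hY.trans hinner)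
  have h1 : canonPart (activity q Λ) n * (98 / 100 * |2 * s| * V) ^ 2 ≤
      V * ‖excitation q Λ n R s‖ ^ 2 :=
    (mul_le_mul_of_nonneg_left (pow_le_pow_left₀ hY hinner 2) hZ.le).trans main
  have e2 : (98 / 100 * |2 * s| * V) ^ 2 = V * ((98 / 100) ^ 2 * (4 * s ^ 2) * V) := by
    rw [mul_pow, mul_pow, sq_abs]; ring
  rcases hVnn.eq_or_lt with h0 | hVpos
  · have : c₀ * (98 / 100 * N) ≤ 0 := by linarith
    have hz : c₀ * N ≤ 0 := by linarith
    have hz' : c₀ * N = 0 := le_antisymm hz (by positivity)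
    rw [show canonPart (activity q Λ) n * (4 * s ^ 2) * ((98 / 100) ^ 3 * c₀ * N) =
      canonPart (activity q Λ) n * (4 * s ^ 2) * (98 / 100) ^ 3 * (c₀ * N) by ring, hz', mul_zero]
    positivity
  · rw [e2] at h1
    have h2 : canonPart (activity q Λ) n * ((98 / 100) ^ 2 * (4 * s ^ 2) * V) ≤
        ‖excitation q Λ n R s‖ ^ 2 := by
      refine le_of_mul_le_mul_left ?_ hVpos
      linarith
    refine le_trans ?_ h2
    calc canonPart (activity q Λ) n * (4 * s ^ 2) * ((98 / 100) ^ 3 * c₀ * N)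
        -- Two factors `0.98` come from squaring the loss in the sine expansion, the third from
        -- centring the profile.
        = canonPart (activity q Λ) n * ((98 / 100) ^ 2 * (4 * s ^ 2) * (c₀ * (98 / 100 * N))) := by ring
      _ ≤ _ := by gcongr

/-- Two-point functions of the layer `l` along an exhausting sequence of cylinders. -/
lemma eventually_le_pairProb {q : ℝ} (hq : 0 < q) (hq1 : q < 1) {Γ : ℕ → Finset Site}
    (hΓ : ∀ k, ∀ x ∈ Γ k, height x = 0) {h : ℕ → ℕ}
    (hexh : ∀ x : Site, ∀ᶠ k in atTop, x ∈ cylinder (Γ k) (h k)) {n : ℕ → ℕ} {μk : ℕ → ℝ} {μ : ℝ}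
    (hn : ∀ k, expect (numberOp (cylinder (Γ k) (h k)))
      (grandCanonicalState q (cylinder (Γ k) (h k)) (μk k)) = n k)
    (hμ : Tendsto μk atTop (𝓝 μ)) (l : ℤ) {c₀ : ℝ}
    (hc₀ : c₀ < q ^ (2 * ((l : ℝ) - μ)) / (1 + q ^ (2 * ((l : ℝ) - μ))) ^ 2) :
    ∀ᶠ k in atTop, ∀ u v : cylinder (Γ k) (h k), u ≠ v → height u = l → height v = l →
      c₀ ≤ pairProb (activity q (cylinder (Γ k) (h k))) (n k) u v := by
  have hcard : Tendsto (fun k => ((Γ k).card : ℝ)) atTop atTop :=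
    tendsto_natCast_atTop_atTop.comp
      (tendsto_atTop.2 fun N => eventually_card_ge hΓ hexh N)
  have hq2 : 0 < q ^ 2 / 2 := by positivity
  have hm : Tendsto (fun k => (((Γ k).card : ℝ) - 1) * (q ^ 2 / 2)) atTop atTop :=
    (tendsto_atTop_add_const_right _ (-1) hcard).atTop_mul_const hq2
  have ht1 : Tendsto (fun k => (1 - 1 / ((((Γ k).card : ℝ) - 1) * (q ^ 2 / 2))) ^ 6) atTop (𝓝 1) := by
    have h0 : Tendsto (fun k => 1 / ((((Γ k).card : ℝ) - 1) * (q ^ 2 / 2))) atTop (𝓝 0) := by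
      simp only [one_div]
      exact hm.inv_tendsto_atTop
    simpa using ((tendsto_const_nhds (x := (1 : ℝ))).sub h0).pow 6
  have hexp : Tendsto (fun k => q ^ (2 * ((l : ℝ) - μk k))) atTop (𝓝 (q ^ (2 * ((l : ℝ) - μ)))) :=
    (Real.continuousAt_const_rpow hq.ne').tendsto.comp
      ((tendsto_const_nhds.sub hμ).const_mul 2)
  have hy0 : 0 < q ^ (2 * ((l : ℝ) - μ)) := Real.rpow_pos_of_pos hq _
  have ht2 : Tendsto (fun k => q ^ (2 * ((l : ℝ) - μk k)) / (1 + q ^ (2 * ((l : ℝ) - μk k))) ^ 2)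
      atTop (𝓝 (q ^ (2 * ((l : ℝ) - μ)) / (1 + q ^ (2 * ((l : ℝ) - μ))) ^ 2)) :=
    hexp.div ((tendsto_const_nhds.add hexp).pow 2) (by positivity)
  have ht := ht1.mul ht2
  rw [one_mul] at ht
  filter_upwards [ht.eventually_const_lt hc₀, hm.eventually_gt_atTop 1] with k hk hk1 u v huv hu hv
  have := le_pairProb_cylinder hq hq1 (hΓ k) (hn k) hk1 huv (hu.trans hv.symm)
  rw [hu] at this
  exact hk.le.trans this

/-- The constant is `4 * 4.29 / (0.19 * 0.98 ^ 4) < 98`, after dropping the favourable factor `1 /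
(1 + q²)`. -/
lemma gap_arithmetic {q t R s Z κ N : ℝ} (hq : 0 < q) (hq1 : q < 1) (hR : 0 < R) (ht : 0 < t)
    (hZ : 0 ≤ Z) (hκ : 0 < κ) (hN : 19 / 100 * κ * R ^ 2 ≤ N) :
    4 * s ^ 2 * (q ^ 2 / ((1 - q ^ 2) * (1 + q ^ 2))) * (429 / 100 * κ) * Z ≤
      100 * (q ^ 2 / t) / ((1 - q ^ 2) * R ^ 2) *
        (Z * (4 * s ^ 2) * ((98 / 100) ^ 3 * (98 / 100 * (t / 4)) * N)) := by
  have hq2 : 0 < 1 - q ^ 2 := by nlinarith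
  have h1 : q ^ 2 / ((1 - q ^ 2) * (1 + q ^ 2)) ≤ q ^ 2 / (1 - q ^ 2) := by
    refine div_le_div_of_nonneg_left (by positivity) hq2 ?_
    nlinarith [sq_nonneg q]
  have h2 : 429 / 100 * κ ≤ 100 * ((98 / 100) ^ 4 / 4) * N / R ^ 2 := by
    rw [le_div_iff₀ (by positivity)]
    nlinarith [mul_pos hκ (pow_pos hR 2)]
  calc 4 * s ^ 2 * (q ^ 2 / ((1 - q ^ 2) * (1 + q ^ 2))) * (429 / 100 * κ) * Z
      ≤ 4 * s ^ 2 * (q ^ 2 / (1 - q ^ 2)) * (100 * ((98 / 100) ^ 4 / 4) * N / R ^ 2) * Z := by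
        refine mul_le_mul_of_nonneg_right (mul_le_mul ?_ h2 (by positivity) (by positivity)) hZ
        exact mul_le_mul_of_nonneg_left h1 (by positivity)
    _ = _ := by field_simp

end Gap

end XXZ

/-! ### Assembly: choice of layer, amplitude and volume. -/

theorem mainTheorem1 (q : ℝ) (hq0 : 0 < q) (hq1 : q < 1) (R : ℝ) (hR : 70 < R)
    -- a sequence of cylindrical volumes exhausting the lattice
    (Γ : ℕ → Finset XXZ.Site) (hΓ : ∀ k, ∀ x ∈ Γ k, XXZ.height x = 0) (h : ℕ → ℕ)
    (Λ : ℕ → Finset XXZ.Site) (hΛ : ∀ k, Λ k = XXZ.cylinder (Γ k) (h k))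
    (hexh : ∀ x : XXZ.Site, ∀ᶠ k in Filter.atTop, x ∈ Λ k)
    -- particle numbers whose chemical potentials converge
    (n : ℕ → ℕ) (μk : ℕ → ℝ) (μ : ℝ)
    (hn : ∀ k, XXZ.expect (XXZ.numberOp (Λ k)) (XXZ.grandCanonicalState q (Λ k) (μk k)) = n k)
    (hμ : Filter.Tendsto μk Filter.atTop (nhds μ)) :
    ∃ s₀ : ℝ, 0 < s₀ ∧ ∀ s : ℝ, s ≠ 0 → |s| < s₀ → ∀ᶠ k in Filter.atTop,
      -- `ψ₀(Λ, n)` is a ground state in its sector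
      (XXZ.interfaceState q (Λ k) (n k) ≠ 0 ∧
        XXZ.InSector (n k) (XXZ.interfaceState q (Λ k) (n k)) ∧
        XXZ.expect (XXZ.hamiltonian q (Λ k)) (XXZ.interfaceState q (Λ k) (n k)) =
          XXZ.groundEnergy q (Λ k) (n k)) ∧
      -- the excitation is an orthogonal state with the same magnetization
      (XXZ.excitation q (Λ k) (n k) R s ≠ 0 ∧
        XXZ.InSector (n k) (XXZ.excitation q (Λ k) (n k) R s) ∧
        inner ℂ (XXZ.interfaceState q (Λ k) (n k)) (XXZ.excitation q (Λ k) (n k) R s) = 0) ∧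
      -- its energy above the ground state dominates the spectral gap and obeys the bound
      XXZ.excitedEnergy q (Λ k) (n k) - XXZ.groundEnergy q (Λ k) (n k) ≤
        XXZ.expect (XXZ.hamiltonian q (Λ k)) (XXZ.excitation q (Λ k) (n k) R s) -
          XXZ.groundEnergy q (Λ k) (n k) ∧
      XXZ.expect (XXZ.hamiltonian q (Λ k)) (XXZ.excitation q (Λ k) (n k) R s) -
          XXZ.groundEnergy q (Λ k) (n k) ≤
        100 * q ^ (2 * (1 - XXZ.intDist μ)) / ((1 - q ^ 2) * R ^ 2) := by
  open XXZ in
  obtain rfl : Λ = fun k => cylinder (Γ k) (h k) := funext hΛ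
  simp only at hexh hn
  have hR0 : 0 < R := by linarith
  have hq2 : 0 < 1 - q ^ 2 := by nlinarith
  have hκ := discArea_pos
  obtain ⟨l, hl⟩ := exists_nearest_int μ
  set t := q ^ (2 * intDist μ) with ht
  have ht0 : 0 < t := Real.rpow_pos_of_pos hq0 _
  -- The factor `0.98` leaves strict room below the limiting variance, so that the bound holds for
  -- all large volumes.
  have hc₀ : 98 / 100 * (t / 4) < q ^ (2 * ((l : ℝ) - μ)) / (1 + q ^ (2 * ((l : ℝ) - μ))) ^ 2 :=
    lt_of_lt_of_le (by linarith) (quarter_rpow_intDist_le hq0 hq1 hl)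
  set N := ∑ x ∈ layerDisc l R, besselProfile R x ^ 2 with hNdef
  set A := ∑ x ∈ layerDisc l R, |besselProfile R x| with hAdef
  set S := ∑ x ∈ layerDisc l R, besselProfile R x with hSdef
  have hN : 19 / 100 * discArea * R ^ 2 ≤ N := le_sum_sq_besselProfile hR l
  have hN0 : 0 < N := lt_of_lt_of_le (by positivity) hN
  have hA0 : 0 ≤ A := Finset.sum_nonneg fun _ _ => abs_nonneg _
  set ε := 2 / 100 * (98 / 100 * (t / 4) * (98 / 100 * N)) with hε
  have hε0 : 0 < ε := by positivity
  -- For `|s| < 1` one has `s² ≤ |s|`, so a bound linear in `|s|` makes the cubic sine error at most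
  -- 2%. The added 1 keeps the denominator positive.
  refine ⟨min 1 (ε / (2 * A ^ 4 + 1)), lt_min one_pos (by positivity), fun s hs0 hs => ?_⟩
  have hs1 : |s| < 1 := hs.trans_le (min_le_left _ _)
  have hs2 : |s| < ε / (2 * A ^ 4 + 1) := hs.trans_le (min_le_right _ _)
  have hsA : 4 * s ^ 2 * A ^ 4 / 3 ≤ ε := by
    rw [lt_div_iff₀ (by positivity)] at hs2
    have h1 : s ^ 2 ≤ |s| := by rw [← sq_abs]; nlinarith [abs_nonneg s]
    have hA4 : 0 ≤ A ^ 4 := by positivity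
    nlinarith [mul_le_mul_of_nonneg_right h1 hA4, abs_nonneg s, mul_nonneg (abs_nonneg s) hA4]
  have hsub : ∀ᶠ k in atTop, layerDisc l R ⊆ cylinder (Γ k) (h k) := by
    have := (Filter.eventually_all_finset (layerDisc l R)).2 fun x _ => hexh x
    filter_upwards [this] with k hk x hx using hk x hx
  -- A layer with this many sites makes the centring correction `S² / |L|` at most 2% of `N`.
  obtain ⟨M₀, hM₀⟩ := exists_nat_gt (S ^ 2 / (2 / 100 * N))
  filter_upwards [hsub, hexh (stick l), eventually_card_ge hΓ hexh (M₀ + 2),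
    eventually_le_pairProb hq0 hq1 hΓ hexh hn hμ l hc₀] with k hkd hkl hkM hkc
  have hne : (Γ k).Nonempty := Finset.card_pos.1 (by omega)
  have hnk := (particle_number_bounds hq0 ⟨_, hkl⟩ (hn k)).2.le
  have hlI := ((mem_cylinder (hΓ k)).1 hkl).1
  rw [height_stick] at hlI
  have hcard := hkM.trans (card_le_card_layer (hΓ k) hlI)
  set Λ := cylinder (Γ k) (h k)
  have hnorm := norm_sq_excitation_ge (s := s) hq0 hnk hkd (c₀ := 98 / 100 * (t / 4)) (by positivity)
    hkc (by omega) (by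
      have h1 : (M₀ : ℝ) ≤ (Finset.univ.filter fun x : Λ => height x = l).card := by
        exact_mod_cast (by omega)
      have h2 : (0 : ℝ) < (Finset.univ.filter fun x : Λ => height x = l).card := by
        exact_mod_cast (by omega)
      rw [div_lt_iff₀ (by positivity)] at hM₀
      rw [div_le_iff₀ h2]
      nlinarith) hsA
  have hZ := canonPart_pos (activity_pos (Λ := Λ) hq0) hnk
  have hs20 : 0 < s ^ 2 := by positivity
  have hpos : 0 < ‖excitation q Λ (n k) R s‖ ^ 2 := lt_of_lt_of_le (by positivity) hnorm
  have hχ : excitation q Λ (n k) R s ≠ 0 := by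
    intro h0
    rw [h0] at hpos
    simp at hpos
  obtain ⟨r, hr, hr0, hr1, hdens⟩ := exists_density_profile (h := h k) hq0 hq1 (hΓ k) hne hnk
  have henergy := energy_excitation_le hq0 hq1 hnk R s (cutPhase_besselPhase R s) hr hr0 hr1 hdens
    (D := 429 / 100 * discArea) (by positivity) (sum_sq_besselProfile_sub_le hR Λ)
  rw [groundEnergy_eq_zero hq0 hq1 hnk]
  refine ⟨⟨interfaceState_ne_zero hq0 hnk, inSector_interfaceState, expect_interfaceState hq0 hq1⟩,
    ⟨hχ, excitation_inSector R s, inner_excitation hq0 hnk R s⟩, ?_, ?_⟩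
  · have := excitedEnergy_le hq0 hq1 hχ (excitation_inSector R s) (inner_excitation hq0 hnk R s)
    linarith
  · rw [sub_zero, expect, inner_hamiltonian_excitation hq0 hq1, div_le_iff₀ hpos]
    refine henergy.trans ?_
    have hpow : q ^ (2 * (1 - intDist μ)) = q ^ 2 / t := by
      rw [mul_sub, mul_one, Real.rpow_sub hq0, ht]
      norm_num
    rw [hpow]
    set Z := canonPart (activity q Λ) (n k)
    exact (gap_arithmetic hq0 hq1 hR0 ht0 hZ.le hκ hN).trans
      (mul_le_mul_of_nonneg_left hnorm (by positivity))
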